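/- Let $\mathcal H=L^2(\mathbb R)$ be the Hilbert space of one bosonic mode, in the representation in which $X=(a+a^\dagger)/2$ is multiplication by the coordinate $q$; on Schwartz functions $a=q+\tfrac12\frac{d}{dq}$ and $a^\dagger=q-\tfrac12\frac{d}{dq}$, so that $[a,a^\dagger]=1$. Let $Y=(a-a^\dagger)/(2i)$; as a self-adjoint operator, $Y$ is multiplication by $y$ in the $Y$-representation $\langle y|\psi\rangle=\pi^{-1/2}\int e^{-2iyq}\psi(q)\,dq$, and $f(Y)$ denotes multiplication by $f(y)$ there, with its maximal domain. Let $\theta(y)=1$ for $y\ge 0$ and $\theta(y)=0$ for $y<0$. The operators $D(x)=\exp[x(a^\dagger-a)]$ and $S(r)=\exp[\tfrac r2(a^{\dagger 2}-a^2)]$ are the (existing and unique) strongly continuous one-parameter unitary groups whose generators extend $a^\dagger-a$ and $\tfrac12(a^{\dagger2}-a^2)$ from the Schwartz functions. Put $U_{x,r}=D(x)S(r)$ and $d_Lg=e^{-r}\,dx\,dr$. Then $d_Lg$ is a left Haar measure of the group of affine maps $q\mapsto e^rq+x$ with $x,r\in\mathbb R$ (the $ax+b$ group with $a=e^r>0$),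 and $U$ is a strongly continuous unitary representation of this group, with the following structure. 1. $\mathcal H=\mathcal H_+\oplus\mathcal H_-$ orthogonally, where $\mathcal H_+$ and $\mathcal H_-$ consist of the $\psi$ with $\langle y|\psi\rangle=0$ for almost every $y<0$, respectively $y>0$. The orthogonal projections onto $\mathcal H_\pm$ are $\theta(\pm Y)$. Both $\mathcal H_\pm$ are closed, invariant and irreducible, they carry inequivalent representations, and each contains a nonzero admissible vector, i.e. a $\psi\neq0$ with $\int d_Lg\,|\langle\psi|U_g|\psi\rangle|^2<\infty$. 2. The Duflo–Moore–Carey operators of the two irreps are $D_\pm=\pi\,\theta(\pm Y)/|Y|$. That is: $D_\pm$ is positive, self-adjoint and zero on $\mathcal H_\pm^\perp$; its positive square root is $D_\pm^{1/2}=(\pi\,\theta(\pm Y)/|Y|)^{1/2}$; a vector $\psi\in\mathcal H_\pm$ is admissible if and only if $\psi\in\operatorname{dom}D_\pm^{1/2}$; and for all $\varphi,\varphi'\in\mathcal H_\pm$ and all admissible $\psi,\psi'\in\mathcal H_\pm$, $$\int d_Lg\,\langle\varphi|U_g|\psi\rangle\langle\psi'|U_g^\dagger|\varphi'\rangle=\langle\varphi|\varphi'\rangle\,\langle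 D_\pm^{1/2}\psi'|D_\pm^{1/2}\psi\rangle ,$$ with absolute convergence. 3. The group average $\langle A\rangle=\int d_Lg\,U_gAU_g^\dagger$ is $$\langle A\rangle=\theta(Y)\,\operatorname{Tr}\!\left[A\,\frac{\pi\,\theta(Y)}{|Y|}\right]+\theta(-Y)\,\operatorname{Tr}\!\left[A\,\frac{\pi\,\theta(-Y)}{|Y|}\right],$$ in the following two senses. (a) For every positive bounded operator $A$ and every $\varphi\in\mathcal H$, as an identity in $[0,\infty]$ (with $0\cdot\infty=0$), $$\int d_Lg\,\langle\varphi|U_gAU_g^\dagger|\varphi\rangle=\|\theta(Y)\varphi\|^2\,\operatorname{Tr}[AD_+]+\|\theta(-Y)\varphi\|^2\,\operatorname{Tr}[AD_-],$$ where $\operatorname{Tr}[AD_\pm]=\sum_i\|D_\pm^{1/2}A^{1/2}b_i\|^2\in[0,\infty]$ for any orthonormal basis $(b_i)$, a term being $\infty$ if $A^{1/2}b_i\notin\operatorname{dom}D_\pm^{1/2}$. (b) For every bounded operator $A$, not necessarily positive, such that $(\pi/|Y|)^{1/2}A\,(\pi/|Y|)^{1/2}$ extends to a trace-class operator (in the sense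 of sesquilinear forms), $D_\pm^{1/2}AD_\pm^{1/2}$ also extend to trace-class operators, with traces $\operatorname{Tr}[AD_\pm]$, and for all $\varphi,\varphi'\in\mathcal H$ the function $g\mapsto\langle\varphi|U_gAU_g^\dagger|\varphi'\rangle$ is integrable with $$\int d_Lg\,\langle\varphi|U_gAU_g^\dagger|\varphi'\rangle=\operatorname{Tr}[AD_+]\,\langle\varphi|\theta(Y)\varphi'\rangle+\operatorname{Tr}[AD_-]\,\langle\varphi|\theta(-Y)\varphi'\rangle .$$ -/

import Mathlib

open MeasureTheory
open scoped SchwartzMap FourierTransform ENNReal InnerProductSpace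

noncomputable section

namespace AxbMode

/-! ### The affine group -/

/-- The `ax+b` group of orientation preserving affine maps `q ↦ e^r q + x` of the real line.  The
element `(x, r)` stands for that map, and the product is composition of maps. -/
def AxB : Type := ℝ × ℝ

namespace AxB

/-- The translation parameter `x` of `q ↦ e^r q + x`. -/
def x (g : AxB) : ℝ := g.1

/-- The logarithmic dilation parameter `r` of `q ↦ e^r q + x`. -/
def r (g : AxB) : ℝ := g.2

/-- The group element with parameters `x`, `r`. -/
def mk (x r : ℝ) : AxB := ((x, r) : ℝ × ℝ)

/-- The affine map `q ↦ e^r q + x`. -/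
def toFun (g : AxB) (q : ℝ) : ℝ := Real.exp g.r * q + g.x

@[ext] theorem ext {g h : AxB} (hx : g.x = h.x) (hr : g.r = h.r) : g = h := Prod.ext hx hr

instance : TopologicalSpace AxB := inferInstanceAs (TopologicalSpace (ℝ × ℝ))
instance : MeasurableSpace AxB := inferInstanceAs (MeasurableSpace (ℝ × ℝ))
instance : BorelSpace AxB := inferInstanceAs (BorelSpace (ℝ × ℝ))

instance : Mul AxB := ⟨fun g h => mk (g.x + Real.exp g.r * h.x) (g.r + h.r)⟩
instance : One AxB := ⟨mk 0 0⟩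
instance : Inv AxB := ⟨fun g => mk (-(Real.exp (-g.r) * g.x)) (-g.r)⟩

@[simp] theorem mk_x (x r : ℝ) : (mk x r).x = x := rfl
@[simp] theorem mk_r (x r : ℝ) : (mk x r).r = r := rfl
@[simp] theorem mul_x (g h : AxB) : (g * h).x = g.x + Real.exp g.r * h.x := rfl
@[simp] theorem mul_r (g h : AxB) : (g * h).r = g.r + h.r := rfl
@[simp] theorem one_x : (1 : AxB).x = 0 := rfl
@[simp] theorem one_r : (1 : AxB).r = 0 := rfl
@[simp] theorem inv_x (g : AxB) : (g⁻¹).x = -(Real.exp (-g.r) * g.x) := rfl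
@[simp] theorem inv_r (g : AxB) : (g⁻¹).r = -g.r := rfl

instance : Group AxB :=
  Group.ofLeftAxioms
    (fun a b c => by
      ext
      · simp [Real.exp_add]; ring
      · simp [add_assoc])
    (fun a => by ext <;> simp)
    (fun a => by ext <;> simp)

theorem toFun_mul (g h : AxB) (q : ℝ) : (g * h).toFun q = g.toFun (h.toFun q) := by
  simp [toFun, Real.exp_add]; ring

end AxB

/-- The left-invariant measure `e^{-r} dx dr`. -/
def leftHaar : Measure AxB :=
  (volume : Measure (ℝ × ℝ)).withDensity (fun p => ENNReal.ofReal (Real.exp (-p.2)))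

/-! ### One bosonic mode -/

/-- The Hilbert space `L²(ℝ)` of wavefunctions in the `X`-representation. -/
abbrev Mode : Type := Lp ℂ 2 (volume : Measure ℝ)

/-- Multiplication by the coordinate on Schwartz functions: the quadrature `X`. -/
def posX : 𝓢(ℝ, ℂ) →L[ℂ] 𝓢(ℝ, ℂ) := SchwartzMap.smulLeftCLM ℂ (fun q : ℝ => (q : ℂ))

/-- The annihilation operator `a = X + ½ d/dX` on Schwartz functions. -/
def ann : 𝓢(ℝ, ℂ) →L[ℂ] 𝓢(ℝ, ℂ) := posX + (1 / 2 : ℂ) • SchwartzMap.derivCLM ℂ ℂ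

/-- The creation operator `a† = X - ½ d/dX` on Schwartz functions. -/
def cre : 𝓢(ℝ, ℂ) →L[ℂ] 𝓢(ℝ, ℂ) := posX - (1 / 2 : ℂ) • SchwartzMap.derivCLM ℂ ℂ

theorem posX_apply (ψ : 𝓢(ℝ, ℂ)) (q : ℝ) : posX ψ q = q * ψ q := by
  unfold posX
  rw [SchwartzMap.smulLeftCLM_apply_apply (by fun_prop)]
  rfl

/-- The canonical commutation relation `[a, a†] = 1`. -/
theorem ann_cre_commutator (ψ : 𝓢(ℝ, ℂ)) : ann (cre ψ) - cre (ann ψ) = ψ := by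
  have key : SchwartzMap.derivCLM ℂ ℂ (posX ψ) = ψ + posX (SchwartzMap.derivCLM ℂ ℂ ψ) := by
    ext q
    have hfun : (posX ψ : ℝ → ℂ) = fun q : ℝ => (q : ℂ) * ψ q := funext (posX_apply ψ)
    have h : HasDerivAt (fun q : ℝ => (q : ℂ) * ψ q) (1 * ψ q + q * deriv ψ q) q :=
      (Complex.ofRealCLM.hasDerivAt (x := q)).mul (ψ.differentiableAt (x := q)).hasDerivAt
    simp [SchwartzMap.derivCLM_apply, posX_apply, hfun, h.deriv]
  simp only [ann, cre, _root_.add_apply, _root_.sub_apply,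
    _root_.smul_apply, map_sub, map_add, map_smul, key]
  module

/-- `V t = exp (t T)` for an operator `T` given on Schwartz functions: `V` is a strongly continuous
one-parameter unitary group whose infinitesimal generator extends `T`. -/
structure IsExponential (T : 𝓢(ℝ, ℂ) →L[ℂ] 𝓢(ℝ, ℂ)) (V : ℝ → Mode →L[ℂ] Mode) : Prop where
  map_zero : V 0 = 1
  map_add : ∀ s t, V (s + t) = V s * V t
  unitary : ∀ t, V t ∈ unitary (Mode →L[ℂ] Mode)
  continuous : ∀ ψ : Mode, Continuous fun t => V t ψ
  generator : ∀ ψ : 𝓢(ℝ, ℂ), HasDerivAt (fun t => V t (ψ.toLp 2)) ((T ψ).toLp 2) 0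

/-- `a† - a`, so that `D(x) = exp [x (a† - a)]`. -/
def dispGen : 𝓢(ℝ, ℂ) →L[ℂ] 𝓢(ℝ, ℂ) := cre - ann

/-- `(a†² - a²) / 2`, so that `S(r) = exp [(r/2) (a†² - a²)]`. -/
def sqGen : 𝓢(ℝ, ℂ) →L[ℂ] 𝓢(ℝ, ℂ) := (1 / 2 : ℂ) • (cre ∘L cre - ann ∘L ann)

/-- `(a - a†) / (2i)`, the quadrature `Y` on Schwartz functions. -/
def quadY : 𝓢(ℝ, ℂ) →L[ℂ] 𝓢(ℝ, ℂ) := (1 / (2 * Complex.I) : ℂ) • (ann - cre)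

/-! ### Functions of the quadrature `Y`

The generalized eigenfunctions of `Y` are `q ↦ π^{-1/2} e^{2iyq}`, so the wavefunction of `ψ` in the
`Y`-representation is `⟨y|ψ⟩ = π^{-1/2} (𝓕 ψ)(y / π)` with `(𝓕 ψ)(ξ) = ∫ e^{-2πiξq} ψ(q) dq`.  In
the variable `ξ = y / π`, the operator `f(Y)` is multiplication by `f(π ξ)`. -/

/-- `f(Y)`, with its natural (maximal) domain. -/
def fnY (f : ℝ → ℝ) : Mode →ₗ.[ℂ] Mode where
  domain :=
    { carrier := {ψ | MemLp (fun ξ : ℝ => (f (Real.pi * ξ) : ℂ) * (𝓕 ψ : Mode) ξ) 2 volume}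
      zero_mem' := by
        have h0 : (𝓕 (0 : Mode) : Mode) = 0 := (Lp.fourierTransformₗᵢ ℝ ℂ).map_zero
        refine (memLp_congr_ae ?_).mpr (MemLp.zero (ε := ℂ))
        rw [h0]
        filter_upwards [Lp.coeFn_zero ℂ 2 (volume : Measure ℝ)] with ξ h
        rw [h]; simp
      add_mem' := by
        intro φ ψ hφ hψ
        have ha : (𝓕 (φ + ψ) : Mode) = 𝓕 φ + 𝓕 ψ := (Lp.fourierTransformₗᵢ ℝ ℂ).map_add φ ψ
        refine (memLp_congr_ae ?_).mpr (MemLp.add hφ hψ)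
        rw [ha]
        filter_upwards [Lp.coeFn_add (𝓕 φ : Mode) (𝓕 ψ : Mode)] with ξ h
        rw [h, Pi.add_apply, mul_add, Pi.add_apply]
      smul_mem' := by
        intro c ψ hψ
        have hs : (𝓕 (c • ψ) : Mode) = c • 𝓕 ψ := (Lp.fourierTransformₗᵢ ℝ ℂ).map_smul c ψ
        refine (memLp_congr_ae ?_).mpr (MemLp.const_smul hψ c)
        rw [hs]
        filter_upwards [Lp.coeFn_smul c (𝓕 ψ : Mode)] with ξ h
        simp [h]; ring }
  toFun :=
    { toFun := fun ψ => 𝓕⁻ (MemLp.toLp _ ψ.2 : Mode)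
      map_add' := by
        rintro ⟨φ, hφ⟩ ⟨ψ, hψ⟩
        have ha : (𝓕 (φ + ψ) : Mode) = 𝓕 φ + 𝓕 ψ := (Lp.fourierTransformₗᵢ ℝ ℂ).map_add φ ψ
        refine Eq.trans (congrArg _ ?_)
          ((Lp.fourierTransformₗᵢ ℝ ℂ).symm.map_add (MemLp.toLp _ hφ) (MemLp.toLp _ hψ))
        rw [← MemLp.toLp_add]
        refine MemLp.toLp_congr _ _ ?_
        simp only [AddMemClass.mk_add_mk]
        rw [ha]
        filter_upwards [Lp.coeFn_add (𝓕 φ : Mode) (𝓕 ψ : Mode)] with ξ h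
        rw [h, Pi.add_apply, mul_add, Pi.add_apply]
      map_smul' := by
        rintro c ⟨ψ, hψ⟩
        have hs : (𝓕 (c • ψ) : Mode) = c • 𝓕 ψ := (Lp.fourierTransformₗᵢ ℝ ℂ).map_smul c ψ
        refine Eq.trans (congrArg _ ?_)
          ((Lp.fourierTransformₗᵢ ℝ ℂ).symm.map_smul c (MemLp.toLp _ hψ))
        rw [← MemLp.toLp_const_smul]
        refine MemLp.toLp_congr _ _ ?_
        simp only [SetLike.mk_smul_mk]
        rw [hs]
        filter_upwards [Lp.coeFn_smul c (𝓕 ψ : Mode)] with ξ h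
        simp [h]; ring }

/-- The step function: `1` on `[0, ∞)` and `0` on `(-∞, 0)`. -/
def theta (y : ℝ) : ℝ := if 0 ≤ y then 1 else 0

/-- The space `H_s`, `s = ±1`, of the `ψ` whose wavefunction in the `Y`-representation vanishes
(almost everywhere) where `s y < 0`. -/
def halfSpace (s : ℝ) : Submodule ℂ Mode :=
  LinearMap.ker ((LpToLpRestrictCLM ℝ ℂ ℂ volume 2 {ξ : ℝ | s * ξ < 0}).comp
    (Lp.fourierTransformₗᵢ ℝ ℂ).toContinuousLinearEquiv.toContinuousLinearMap).toLinearMap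

theorem mem_halfSpace {s : ℝ} {ψ : Mode} :
    ψ ∈ halfSpace s ↔ ∀ᵐ ξ : ℝ, s * ξ < 0 → (𝓕 ψ : Mode) ξ = 0 := by
  have hm : MeasurableSet {ξ : ℝ | s * ξ < 0} :=
    measurableSet_lt (by fun_prop) measurable_const
  have hr := LpToLpRestrictCLM_coeFn ℂ {ξ : ℝ | s * ξ < 0} (𝓕 ψ : Mode)
  have h1 : ψ ∈ halfSpace s ↔
      LpToLpRestrictCLM ℝ ℂ ℂ volume 2 {ξ : ℝ | s * ξ < 0} (𝓕 ψ : Mode) = 0 := Iff.rfl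
  rw [h1, Lp.eq_zero_iff_ae_eq_zero]
  refine Iff.trans ?_ (ae_restrict_iff' hm)
  constructor
  · intro h
    filter_upwards [h, hr] with ξ h2 h3
    rw [← h3, h2]; rfl
  · intro h
    filter_upwards [h, hr] with ξ h2 h3
    rw [h3, h2]; rfl

theorem isClosed_halfSpace (s : ℝ) : IsClosed (halfSpace s : Set Mode) :=
  ContinuousLinearMap.isClosed_ker _

instance (s : ℝ) : (halfSpace s).HasOrthogonalProjection :=
  haveI : CompleteSpace (halfSpace s) := (isClosed_halfSpace s).completeSpace_coe
  inferInstance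

/-- The operator `D_s = π θ(s Y) / |Y|`, `s = ±1`. -/
def dmc (s : ℝ) : Mode →ₗ.[ℂ] Mode := fnY fun y => Real.pi * theta (s * y) / |y|

/-- The operator `(π θ(s Y) / |Y|)^{1/2}`, `s = ±1`. -/
def sqrtDmc (s : ℝ) : Mode →ₗ.[ℂ] Mode := fnY fun y => √(Real.pi * theta (s * y) / |y|)

/-- The operator `(π / |Y|)^{1/2}`, the square root of `D_+ + D_-`. -/
def sqrtDmcTotal : Mode →ₗ.[ℂ] Mode := fnY fun y => √(Real.pi / |y|)

end AxbMode

namespace AxbMode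

/-! ### Unitary representations and their Duflo–Moore–Carey operators -/

section General

variable {H : Type*} [NormedAddCommGroup H] [InnerProductSpace ℂ H] [CompleteSpace H]
variable {G : Type*}

/-- `U` is a (strongly continuous) unitary representation of the topological group `G`. -/
structure IsUnitaryRep [Group G] [TopologicalSpace G] (U : G → H →L[ℂ] H) : Prop where
  unitary : ∀ g, U g ∈ unitary (H →L[ℂ] H)
  map_one : U 1 = 1
  map_mul : ∀ g h, U (g * h) = U g * U h
  continuous : ∀ ψ : H, Continuous fun g => U g ψ

/-- `K` is invariant under all `U g`. -/
def IsInvariant (U : G → H →L[ℂ] H) (K : Submodule ℂ H) : Prop := ∀ g, ∀ ψ ∈ K, U g ψ ∈ K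

/-- The closed subspace `K` carries an irreducible representation. -/
structure IsIrrep (U : G → H →L[ℂ] H) (K : Submodule ℂ H) : Prop where
  isClosed : IsClosed (K : Set H)
  ne_bot : K ≠ ⊥
  invariant : IsInvariant U K
  irreducible : ∀ L : Submodule ℂ H, IsClosed (L : Set H) → L ≤ K → IsInvariant U L →
    L = ⊥ ∨ L = K

/-- The representations carried by `K` and `L` are unitarily equivalent. -/
def AreEquivalent (U : G → H →L[ℂ] H) (K L : Submodule ℂ H) : Prop :=
  ∃ W : K ≃ₗᵢ[ℂ] L, ∀ (g : G) (ψ χ : K), (χ : H) = U g ψ → (W χ : H) = U g (W ψ)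

/-- `ψ` is admissible: `∫ |⟨ψ| U_g |ψ⟩|² dμ(g) < ∞`. -/
def IsAdmissible [MeasurableSpace G] (U : G → H →L[ℂ] H) (μ : Measure G) (ψ : H) : Prop :=
  ∫⁻ g, ‖⟪ψ, U g ψ⟫_ℂ‖ₑ ^ 2 ∂μ < ∞

/-- The representation on `K` is square-summable: some nonzero vector of `K` is admissible. -/
def IsSquareSummable [MeasurableSpace G] (U : G → H →L[ℂ] H) (μ : Measure G)
    (K : Submodule ℂ H) : Prop :=
  ∃ ψ ∈ K, ψ ≠ 0 ∧ IsAdmissible U μ ψ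

/-- `A` is a positive self-adjoint (possibly unbounded) operator. -/
def IsPosSelfAdjoint (A : H →ₗ.[ℂ] H) : Prop :=
  IsSelfAdjoint A ∧ ∀ ψ : A.domain, 0 ≤ (⟪(ψ : H), A ψ⟫_ℂ).re

/-- `C` is the positive square root of the operator `B`: `C² = B`, domains included. -/
def IsPosSqrt (C B : H →ₗ.[ℂ] H) : Prop :=
  IsPosSelfAdjoint C ∧
    ∀ ψ φ : H, (ψ, φ) ∈ B.graph ↔ ∃ χ : H, (ψ, χ) ∈ C.graph ∧ (χ, φ) ∈ C.graph

/-- `B` is the Duflo–Moore–Carey operator of the irreducible representation carried by `K`, with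
respect to the left Haar measure `μ`; operators on `K` are regarded as operators on `H` that vanish
on `Kᗮ`.  `B` is positive and self-adjoint, the admissible vectors of `K` are those in the domain of
`B^{1/2}`, and `∫ ⟨φ|U_g|ψ⟩ ⟨ψ'|U_g†|φ'⟩ dμ(g) = ⟨φ|φ'⟩ ⟨B^{1/2}ψ'|B^{1/2}ψ⟩` for all `φ`, `φ'` and
all admissible `ψ`, `ψ'` in `K`. -/
structure IsDMC [MeasurableSpace G] (U : G → H →L[ℂ] H) (μ : Measure G) (K : Submodule ℂ H)
    (B : H →ₗ.[ℂ] H) : Prop where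
  posSelfAdjoint : IsPosSelfAdjoint B
  supported : ∀ ψ ∈ Kᗮ, (ψ, (0 : H)) ∈ B.graph
  orthogonality : ∃ C : H →ₗ.[ℂ] H, IsPosSqrt C B ∧
    (∀ ψ ∈ K, ψ ∈ C.domain ↔ IsAdmissible U μ ψ) ∧
    ∀ φ ∈ K, ∀ φ' ∈ K, ∀ ψ ψ' : C.domain, (ψ : H) ∈ K → (ψ' : H) ∈ K →
      Integrable (fun g => ⟪φ, U g ψ⟫_ℂ * ⟪U g ψ', φ'⟫_ℂ) μ ∧
      ∫ g, ⟪φ, U g ψ⟫_ℂ * ⟪U g ψ', φ'⟫_ℂ ∂μ = ⟪φ, φ'⟫_ℂ * ⟪C ψ', C ψ⟫_ℂ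

open Classical in
/-- `⟨ψ|C²|ψ⟩ = ‖Cψ‖²` for a positive self-adjoint `C`, equal to `∞` off the domain of `C`. -/
def energy (C : H →ₗ.[ℂ] H) (ψ : H) : ℝ≥0∞ :=
  if h : ψ ∈ C.domain then ‖C ⟨ψ, h⟩‖ₑ ^ 2 else ∞

/-- `Tr [A C²] ∈ [0, ∞]` for a positive bounded `A` and a positive self-adjoint `C`, computed in the
orthonormal basis `b` as `∑ ⟨A^{1/2} b_i| C² |A^{1/2} b_i⟩`. -/
def posTrace {ι : Type*} (b : HilbertBasis ι ℂ H) (C : H →ₗ.[ℂ] H) (A : H →L[ℂ] H) : ℝ≥0∞ :=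
  ∑' i, energy C (CFC.sqrt A (b i))

/-- `T` is a trace-class (equivalently, nuclear) operator. -/
def IsTraceClass (T : H →L[ℂ] H) : Prop :=
  ∃ u v : ℕ → H, Summable (fun i => ‖u i‖ * ‖v i‖) ∧
    ∀ φ, HasSum (fun i => ⟪v i, φ⟫_ℂ • u i) (T φ)

/-- The bounded operator `A` is such that `C A C` is (extends to) a trace-class operator, with trace
`τ`.  This is the meaning of `Tr [A C²] = τ` for a positive self-adjoint `C`. -/
def HasTrace (C : H →ₗ.[ℂ] H) (A : H →L[ℂ] H) (τ : ℂ) : Prop :=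
  ∃ T : H →L[ℂ] H, IsTraceClass T ∧
    (∀ φ ψ : C.domain, ⟪(φ : H), T ψ⟫_ℂ = ⟪C φ, A (C ψ)⟫_ℂ) ∧
    ∀ (ι : Type) (b : HilbertBasis ι ℂ H), HasSum (fun i => ⟪b i, T (b i)⟫_ℂ) τ

/-- The matrix element `⟨φ| U_g A U_g† |φ'⟩`, whose integral over `g` is the matrix element of the
group average of `A`. -/
def aveElem (U : G → H →L[ℂ] H) (A : H →L[ℂ] H) (φ φ' : H) (g : G) : ℂ :=
  ⟪φ, U g (A (ContinuousLinearMap.adjoint (U g) φ'))⟫_ℂ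

end General

/-- `U_{x,r} = D(x) S(r)`. -/
def rep (D S : ℝ → Mode →L[ℂ] Mode) (g : AxB) : Mode →L[ℂ] Mode := D g.x * S g.r

end AxbMode

end

noncomputable section

namespace AxbMode

/-! ### Plancherel's identity for integrable functions -/

/-! In the momentum variable `ξ = y / π` the representation becomes explicit: `U_{x,r}` sends `f` to
`e^{-2πiξx} e^{r/2} f (e^r ξ)` (`momentumFun`, `affRep`). Its two one-parameter subgroups have the
prescribed generators on Schwartz functions and preserve the Schwartz space, and an exponential that
preserves it is the only one (`IsExponential.eq_of_preserves`). Hence `rep D S = affRep`, and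
everything else is computed in momentum space, where `f(Y)` is multiplication by `f(πξ)`.

The central identity is `lintegral_inner_affRep`. For fixed `r`, the matrix element `⟨χ|U_{x,r}|ψ⟩`
is, as a function of `x`, the Fourier transform of an integrable function, so Plancherel evaluates
the integral over `x`. Tonelli and the substitution `η = e^r ξ` do the rest: the orbit of `ξ` is the
half line containing `ξ`, and `dr = dη / |η|`. The result, in `[0, ∞]`, is `∫ |⟨χ|U_g|ψ⟩|² = ∑_±
‖P_± χ‖² ‖D_±^{1/2} ψ‖²`, where `P_±` projects onto `H_±`. The weight `1 / |η|` is what makes `D_± =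
π θ(±Y) / |Y|`.

This identity yields admissibility directly, the orthogonality relations by polarization,
irreducibility (a vector of `H_±` orthogonal to a nonzero orbit in `H_±` vanishes), and
inequivalence. The average of a positive `A` follows by Parseval for `A^{1/2} U_g† φ`, integrated
term by term.

For general `A`, let `T = ∑ |u_i⟩⟨v_i|` be the nuclear extension of `(π/|Y|)^{1/2} A (π/|Y|)^{1/2}`.
On vectors in the domain of `(|Y|/π)^{1/2}`, the covariance of `|Y|` under dilations turns `⟨φ|U_g A
U_g†|φ'⟩` into a series of products of matrix elements carrying a factor `e^{r/2}`
(`hasSum_aveElem`). That factor cancels the weight `1 / |η|`, so the corresponding square-integral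
identity contains only norms of `u_i` and `v_i` (`lintegral_modElem`) and the series can be
integrated. The resulting bound by `∑ ‖u_i‖ ‖v_i‖` extends the formula to all vectors by density. -/

theorem ae_eq_of_forall_schwartz {u v : ℝ → ℂ} (hu : LocallyIntegrable u) (hv : LocallyIntegrable v)
    (h : ∀ g : 𝓢(ℝ, ℂ), ∫ x, g x • u x = ∫ x, g x • v x) : u =ᵐ[volume] v := by
  refine ae_eq_of_integral_contDiff_smul_eq hu hv fun g hg hc => ?_
  have h1 : HasCompactSupport (Complex.ofRealCLM ∘ g) := hc.comp_left rfl
  have h2 : ContDiff ℝ (⊤ : ℕ∞) (Complex.ofRealCLM ∘ g) := by fun_prop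
  simpa using h (h1.toSchwartzMap h2)

theorem integral_fourier_smul_schwartz {f : ℝ → ℂ} (hf : Integrable f) (g : 𝓢(ℝ, ℂ)) :
    ∫ x, (𝓕 g) x • f x = ∫ x, g x • 𝓕 f x := by
  have := VectorFourier.integral_fourierIntegral_smul_eq_flip (L := innerₗ ℝ)
    (f := (g : ℝ → ℂ)) (g := f) Real.continuous_fourierChar continuous_inner (g.integrable (μ := volume)) hf
  simpa using! this

theorem continuous_fourier_of_integrable {f : ℝ → ℂ} (hf : Integrable f) : Continuous (𝓕 f) :=
  VectorFourier.fourierIntegral_continuous Real.continuous_fourierChar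
    (by exact continuous_inner) hf

theorem locallyIntegrable_of_mode (f : Mode) : LocallyIntegrable (f : ℝ → ℂ) :=
  (Lp.memLp f).locallyIntegrable (by norm_num)

theorem integral_schwartz_smul_fourier (f : Mode) (g : 𝓢(ℝ, ℂ)) :
    ∫ x, g x • (𝓕 f : Mode) x = ∫ x, (𝓕 g) x • f x := by
  have h := congrArg (fun T => T g) (Lp.fourier_toTemperedDistribution_eq f)
  simpa [TemperedDistribution.fourier_apply] using h.symm

/-- Both transforms have the same pairings with Schwartz functions, since each can be moved to the
test function. This identifies the `L²` transform with the Fourier integral. -/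
theorem fourier_toLp_ae_eq {f : ℝ → ℂ} (h1 : Integrable f) (h2 : MemLp f 2) :
    (𝓕 (h2.toLp f : Mode) : Mode) =ᵐ[volume] 𝓕 f := by
  refine ae_eq_of_forall_schwartz (locallyIntegrable_of_mode _)
    (continuous_fourier_of_integrable h1).locallyIntegrable fun g => ?_
  rw [integral_schwartz_smul_fourier, ← integral_fourier_smul_schwartz h1]
  exact integral_congr_ae (by filter_upwards [h2.coeFn_toLp] with x hx; rw [hx])

theorem memLp_two_of_fourier {f : ℝ → ℂ} (h1 : Integrable f) (h2 : MemLp (𝓕 f) 2) :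
    MemLp f 2 := by
  have : f =ᵐ[volume] (𝓕⁻ (h2.toLp (𝓕 f) : Mode) : Mode) := by
    refine ae_eq_of_forall_schwartz h1.locallyIntegrable (locallyIntegrable_of_mode _) fun g => ?_
    -- Writing the test function as a transform lets the transform be moved onto `f` on one side and
    -- onto the inverse `L²` transform on the other.
    have hg : g = 𝓕 (𝓕⁻ g) := (FourierTransform.fourier_fourierInv_eq g).symm
    rw [hg, integral_fourier_smul_schwartz h1, ← integral_schwartz_smul_fourier,
      FourierTransform.fourier_fourierInv_eq]
    exact integral_congr_ae (by filter_upwards [h2.coeFn_toLp] with x hx; rw [hx])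
  exact (memLp_congr_ae this).mpr (Lp.memLp _)

theorem enorm_sq_mode (f : Mode) : ‖f‖ₑ ^ 2 = ∫⁻ x, ‖f x‖ₑ ^ 2 := by
  rw [Lp.enorm_def, eLpNorm_eq_lintegral_rpow_enorm_toReal (by norm_num) (by norm_num)]
  simp only [ENNReal.toReal_ofNat, ENNReal.rpow_ofNat]
  rw [← ENNReal.rpow_natCast, ← ENNReal.rpow_mul]
  norm_num

theorem memLp_two_iff {f : ℝ → ℂ} (hf : AEStronglyMeasurable f) :
    MemLp f 2 ↔ ∫⁻ x, ‖f x‖ₑ ^ 2 < ∞ := by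
  rw [MemLp, and_iff_right hf, eLpNorm_lt_top_iff_lintegral_rpow_enorm_lt_top
    (by norm_num) (by norm_num)]
  simp

theorem enorm_sq_toLp {f : ℝ → ℂ} (hf : MemLp f 2) :
    ‖(hf.toLp f : Mode)‖ₑ ^ 2 = ∫⁻ x, ‖f x‖ₑ ^ 2 := by
  rw [enorm_sq_mode]
  exact lintegral_congr_ae (by filter_upwards [hf.coeFn_toLp] with x hx; rw [hx])

theorem enorm_fourier (f : Mode) : ‖(𝓕 f : Mode)‖ₑ = ‖f‖ₑ := by
  rw [← ofReal_norm, ← ofReal_norm, Lp.norm_fourier_eq]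

/-- Plancherel's identity in `[0, ∞]` for integrable functions. -/
theorem lintegral_enorm_sq_fourier {f : ℝ → ℂ} (hf : Integrable f) :
    ∫⁻ x, ‖𝓕 f x‖ₑ ^ 2 = ∫⁻ x, ‖f x‖ₑ ^ 2 := by
  by_cases h2 : MemLp f 2
  · rw [← enorm_sq_toLp h2, ← enorm_fourier, enorm_sq_mode]
    refine lintegral_congr_ae ?_
    filter_upwards [fourier_toLp_ae_eq hf h2] with x hx
    rw [hx]
  -- If `f` is not square integrable, neither is its transform, and both sides are `∞`.
  · have h3 : ¬ MemLp (𝓕 f) 2 := fun h => h2 (memLp_two_of_fourier hf h)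
    rw [memLp_two_iff hf.1, not_lt_top_iff] at h2
    rw [memLp_two_iff (continuous_fourier_of_integrable hf).aestronglyMeasurable,
      not_lt_top_iff] at h3
    rw [h2, h3]

/-- Integration over the dilation orbit of `ξ`. -/
theorem lintegral_dilation_orbit {s ξ : ℝ} (h : 0 < s * ξ) (G : ℝ → ℝ≥0∞) :
    ∫⁻ r, G (Real.exp r * ξ) = ∫⁻ η in {η | 0 < s * η}, ENNReal.ofReal |η|⁻¹ * G η := by
  have hξ : ξ ≠ 0 := by rintro rfl; simp at h
  have him : (fun r => Real.exp r * ξ) '' Set.univ = {η | 0 < s * η} := by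
    ext η
    simp only [Set.image_univ, Set.mem_range, Set.mem_ofPred_eq]
    constructor
    · rintro ⟨r, rfl⟩
      have := mul_pos (Real.exp_pos r) h
      linarith
    · intro hη
      have hq : 0 < η / ξ := by
        have : η / ξ = (s * η) / (s * ξ) := by
          rw [mul_div_mul_left]; rintro rfl; simp at h
        rw [this]; exact div_pos hη h
      exact ⟨Real.log (η / ξ), by rw [Real.exp_log hq]; field_simp⟩
  -- The derivative of `r ↦ e^r ξ` is its own value `η`, so the Jacobian `|η|` cancels the weight
  -- `|η|⁻¹`.
  have key := lintegral_image_eq_lintegral_abs_deriv_mul (s := Set.univ)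
    (f := fun r => Real.exp r * ξ) (f' := fun r => Real.exp r * ξ) MeasurableSet.univ
    (fun x _ => ((Real.hasDerivAt_exp x).mul_const ξ).hasDerivWithinAt)
    (fun a _ b _ hab => Real.exp_injective (mul_right_cancel₀ hξ hab))
    (fun η => ENNReal.ofReal |η|⁻¹ * G η)
  rw [him, setLIntegral_univ] at key
  rw [key]
  refine lintegral_congr fun r => ?_
  have h0 : 0 < |Real.exp r * ξ| := abs_pos.mpr (mul_ne_zero (Real.exp_pos r).ne' hξ)
  rw [← mul_assoc, ← ENNReal.ofReal_mul h0.le, mul_inv_cancel₀ h0.ne']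
  simp

/-! ### The representation in momentum space -/

/-- The character `e^{-2πi ξ x}`. -/
def phase (x ξ : ℝ) : ℂ := Complex.exp ((-2 * Real.pi * ξ * x : ℝ) * Complex.I)

theorem norm_phase (x ξ : ℝ) : ‖phase x ξ‖ = 1 := Complex.norm_exp_ofReal_mul_I _

theorem enorm_phase (x ξ : ℝ) : ‖phase x ξ‖ₑ = 1 := by
  rw [← ofReal_norm, norm_phase, ENNReal.ofReal_one]

theorem continuous_phase (x : ℝ) : Continuous (phase x) := by
  unfold phase; fun_prop

theorem phase_zero (ξ : ℝ) : phase 0 ξ = 1 := by simp [phase]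

/-- The action of `g` on wavefunctions in momentum space. -/
def momentumFun (g : AxB) (f : ℝ → ℂ) (ξ : ℝ) : ℂ :=
  phase g.x ξ * (Real.exp (g.r / 2) : ℂ) * f (Real.exp g.r * ξ)

theorem phase_add_mul (x a y ξ : ℝ) : phase (x + a * y) ξ = phase x ξ * phase y (a * ξ) := by
  rw [phase, phase, phase, ← Complex.exp_add]; congr 1; push_cast; ring

theorem momentumFun_mul (g h : AxB) (f : ℝ → ℂ) :
    momentumFun (g * h) f = momentumFun g (momentumFun h f) := by
  ext ξ
  simp only [momentumFun, AxB.mul_x, AxB.mul_r, phase_add_mul]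
  rw [show Real.exp (g.r + h.r) * ξ = Real.exp h.r * (Real.exp g.r * ξ) by rw [Real.exp_add]; ring,
    add_div, Real.exp_add, Complex.ofReal_mul]
  ring

theorem momentumFun_one (f : ℝ → ℂ) : momentumFun 1 f = f := by
  ext ξ; simp [momentumFun, phase]

/-- Null sets pull back to null sets, so `momentumFun` acts on almost-everywhere classes. -/
theorem quasiMeasurePreserving_exp_mul (r : ℝ) :
    Measure.QuasiMeasurePreserving (fun ξ : ℝ => Real.exp r * ξ) volume volume := by
  simpa using! Measure.quasiMeasurePreserving_smul (volume : Measure ℝ) (Real.exp_pos r).ne'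

theorem lintegral_exp_mul (r : ℝ) (F : ℝ → ℝ≥0∞) :
    ∫⁻ ξ, F (Real.exp r * ξ) = ENNReal.ofReal (Real.exp (-r)) * ∫⁻ ξ, F ξ := by
  have he : MeasurableEmbedding (fun ξ : ℝ => Real.exp r * ξ) :=
    measurableEmbedding_mulLeft₀ (Real.exp_pos r).ne'
  rw [← he.lintegral_map, Real.map_volume_mul_left (Real.exp_pos r).ne', lintegral_smul_measure,
    ← Real.exp_neg, abs_of_pos (Real.exp_pos _), smul_eq_mul]

theorem momentumFun_congr (g : AxB) {f f' : ℝ → ℂ} (h : f =ᵐ[volume] f') :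
    momentumFun g f =ᵐ[volume] momentumFun g f' := by
  filter_upwards [(quasiMeasurePreserving_exp_mul g.r).ae h] with ξ hξ
  simp only [momentumFun, hξ]

theorem enorm_sq_momentumFun (g : AxB) (f : ℝ → ℂ) (ξ : ℝ) :
    ‖momentumFun g f ξ‖ₑ ^ 2 = ENNReal.ofReal (Real.exp g.r) * ‖f (Real.exp g.r * ξ)‖ₑ ^ 2 := by
  rw [momentumFun, enorm_mul, enorm_mul, enorm_phase, one_mul, mul_pow]
  congr 1
  rw [← ofReal_norm, Complex.norm_real, Real.norm_of_nonneg (Real.exp_pos _).le,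
    ← ENNReal.ofReal_pow (Real.exp_pos _).le, ← Real.exp_nat_mul]
  congr 2; push_cast; ring

theorem lintegral_momentumFun (g : AxB) (f : ℝ → ℂ) :
    ∫⁻ ξ, ‖momentumFun g f ξ‖ₑ ^ 2 = ∫⁻ ξ, ‖f ξ‖ₑ ^ 2 := by
  simp_rw [enorm_sq_momentumFun]
  rw [lintegral_const_mul' _ _ ENNReal.ofReal_ne_top, lintegral_exp_mul g.r (fun ξ => ‖f ξ‖ₑ ^ 2),
    ← mul_assoc, ← ENNReal.ofReal_mul (Real.exp_pos _).le, ← Real.exp_add]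
  simp

theorem memLp_momentumFun (g : AxB) {f : ℝ → ℂ} (hf : MemLp f 2) : MemLp (momentumFun g f) 2 := by
  have hm : AEStronglyMeasurable (momentumFun g f) :=
    (((continuous_phase g.x).mul continuous_const).aestronglyMeasurable).mul
      (hf.1.comp_quasiMeasurePreserving (quasiMeasurePreserving_exp_mul g.r))
  rw [memLp_two_iff hm, lintegral_momentumFun]
  exact (memLp_two_iff hf.1).mp hf

/-- The action of `g` on `L²` in momentum space. -/
def momentumRep (g : AxB) : Mode →ₗᵢ[ℂ] Mode where
  toFun f := (memLp_momentumFun g (Lp.memLp f)).toLp _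
  map_add' f f' := by
    rw [← MemLp.toLp_add]
    refine MemLp.toLp_congr _ _ ((momentumFun_congr g (Lp.coeFn_add f f')).trans (.of_forall ?_))
    intro ξ; simp [momentumFun, mul_add]
  map_smul' c f := by
    rw [← MemLp.toLp_const_smul]
    refine MemLp.toLp_congr _ _ ((momentumFun_congr g (Lp.coeFn_smul c f)).trans (.of_forall ?_))
    intro ξ; simp [momentumFun]; ring
  norm_map' f := by
    have h : ‖((memLp_momentumFun g (Lp.memLp f)).toLp _ : Mode)‖ₑ ^ 2 = ‖f‖ₑ ^ 2 := by
      rw [enorm_sq_toLp, lintegral_momentumFun, enorm_sq_mode]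
    have h2 := congrArg ENNReal.toReal h
    simp only [ENNReal.toReal_pow, toReal_enorm] at h2
    exact (pow_left_inj₀ (norm_nonneg _) (norm_nonneg _) (by norm_num)).mp h2

theorem momentumRep_coe (g : AxB) (f : Mode) :
    (momentumRep g f : ℝ → ℂ) =ᵐ[volume] momentumFun g f :=
  (memLp_momentumFun g (Lp.memLp f)).coeFn_toLp

theorem momentumRep_mul (g h : AxB) (f : Mode) :
    momentumRep (g * h) f = momentumRep g (momentumRep h f) := by
  refine Lp.ext ?_
  filter_upwards [momentumRep_coe (g * h) f, momentumRep_coe g (momentumRep h f),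
    momentumFun_congr g (momentumRep_coe h f)] with ξ h1 h2 h3
  rw [h1, h2, h3, momentumFun_mul]

theorem momentumRep_one (f : Mode) : momentumRep 1 f = f := by
  refine Lp.ext ?_
  filter_upwards [momentumRep_coe 1 f] with ξ h1
  rw [h1, momentumFun_one]

/-- The representation `(U_{x,r} ψ)(q) = e^{-r/2} ψ (e^{-r} (q - x))`, defined in momentum space. -/
def affRep (g : AxB) : Mode →L[ℂ] Mode :=
  (((Lp.fourierTransformₗᵢ ℝ ℂ).symm.toLinearIsometry.comp (momentumRep g)).comp
    (Lp.fourierTransformₗᵢ ℝ ℂ).toLinearIsometry).toContinuousLinearMap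

theorem affRep_apply (g : AxB) (ψ : Mode) : affRep g ψ = 𝓕⁻ (momentumRep g (𝓕 ψ)) := rfl

theorem fourier_affRep (g : AxB) (ψ : Mode) : (𝓕 (affRep g ψ) : Mode) = momentumRep g (𝓕 ψ) := by
  rw [affRep_apply, FourierTransform.fourier_fourierInv_eq]

theorem fourier_affRep_coe (g : AxB) (ψ : Mode) :
    (𝓕 (affRep g ψ) : Mode) =ᵐ[volume] momentumFun g (𝓕 ψ : Mode) := by
  rw [fourier_affRep]; exact momentumRep_coe _ _

theorem norm_affRep (g : AxB) (ψ : Mode) : ‖affRep g ψ‖ = ‖ψ‖ := by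
  rw [← Lp.norm_fourier_eq, fourier_affRep, LinearIsometry.norm_map, Lp.norm_fourier_eq]

theorem affRep_mul (g h : AxB) : affRep (g * h) = affRep g * affRep h := by
  ext1 ψ
  change affRep (g * h) ψ = affRep g (affRep h ψ)
  rw [affRep_apply, momentumRep_mul, affRep_apply g, fourier_affRep]

theorem affRep_one : affRep 1 = 1 := by
  ext1 ψ
  rw [affRep_apply, momentumRep_one, FourierTransform.fourierInv_fourier_eq]; rfl

theorem adjoint_affRep_mul_self (g : AxB) :
    ContinuousLinearMap.adjoint (affRep g) * affRep g = 1 :=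
  (ContinuousLinearMap.norm_map_iff_adjoint_comp_self (affRep g)).mp (norm_affRep g)

theorem adjoint_affRep (g : AxB) : ContinuousLinearMap.adjoint (affRep g) = affRep g⁻¹ := by
  have h : affRep g * affRep g⁻¹ = 1 := by rw [← affRep_mul, mul_inv_cancel, affRep_one]
  calc _ = ContinuousLinearMap.adjoint (affRep g) * (affRep g * affRep g⁻¹) := by rw [h, mul_one]
    _ = _ := by rw [← mul_assoc, adjoint_affRep_mul_self, one_mul]

theorem affRep_mem_unitary (g : AxB) : affRep g ∈ unitary (Mode →L[ℂ] Mode) := by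
  rw [Unitary.mem_iff]
  refine ⟨adjoint_affRep_mul_self g, ?_⟩
  rw [ContinuousLinearMap.star_eq_adjoint, adjoint_affRep, ← affRep_mul, mul_inv_cancel, affRep_one]

theorem inner_affRep_left (g : AxB) (φ ψ : Mode) :
    ⟪affRep g φ, ψ⟫_ℂ = ⟪φ, affRep g⁻¹ ψ⟫_ℂ := by
  rw [← adjoint_affRep, ContinuousLinearMap.adjoint_inner_right]

/-! ### One-parameter groups -/

theorem exists_schwartz_bound (κ : 𝓢(ℝ, ℂ)) : ∃ C, 0 ≤ C ∧ ∀ ξ, ‖κ ξ‖ ≤ C * (1 + ξ ^ 2)⁻¹ := by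
  obtain ⟨C0, h0, hC0⟩ := κ.decay 0 0
  obtain ⟨C2, h2, hC2⟩ := κ.decay 2 0
  refine ⟨C0 + C2, by positivity, fun ξ => ?_⟩
  have a0 := hC0 ξ
  have a2 := hC2 ξ
  simp only [norm_iteratedFDeriv_zero, pow_zero, one_mul, Real.norm_eq_abs, sq_abs] at a0 a2
  rw [← div_eq_mul_inv, le_div_iff₀ (by positivity)]
  linarith

/-- A majorant uniform over dilations with `|r| ≤ 1`. In `e³ = e · e²`, the factor `e` bounds the
amplitude `e^{r/2}` and `e²` bounds the effect of the dilation on the weight `(1 + ξ²)⁻¹`. -/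
theorem norm_momentumFun_le {C : ℝ} (hC : 0 ≤ C) {κ : ℝ → ℂ} (h : ∀ ξ, ‖κ ξ‖ ≤ C * (1 + ξ ^ 2)⁻¹)
    (g : AxB) (hg : |g.r| ≤ 1) (ξ : ℝ) :
    ‖momentumFun g κ ξ‖ ≤ Real.exp 3 * C * (1 + ξ ^ 2)⁻¹ := by
  rw [momentumFun, norm_mul, norm_mul, norm_phase, one_mul, Complex.norm_real,
    Real.norm_of_nonneg (Real.exp_pos _).le]
  have hg' := abs_le.mp hg
  have h1 : (1 + (Real.exp g.r * ξ) ^ 2)⁻¹ ≤ Real.exp 2 * (1 + ξ ^ 2)⁻¹ := by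
    rw [← div_eq_mul_inv, inv_le_comm₀ (by positivity) (by positivity), inv_div,
      div_le_iff₀ (Real.exp_pos _)]
    have e1 : 1 ≤ Real.exp 2 := Real.one_le_exp (by norm_num)
    have e2 : 1 ≤ Real.exp g.r ^ 2 * Real.exp 2 := by
      rw [← Real.exp_nat_mul, ← Real.exp_add]
      exact Real.one_le_exp (by push_cast; linarith)
    nlinarith [sq_nonneg ξ]
  calc _ ≤ Real.exp 1 * (C * (Real.exp 2 * (1 + ξ ^ 2)⁻¹)) := by
        refine mul_le_mul (Real.exp_le_exp.mpr (by linarith)) ((h _).trans ?_) (norm_nonneg _)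
          (Real.exp_pos _).le
        exact mul_le_mul_of_nonneg_left h1 hC
    _ = _ := by
        rw [show (3 : ℝ) = 1 + 2 by norm_num, Real.exp_add]; ring

theorem continuous_momentumFun (g : AxB) {f : ℝ → ℂ} (hf : Continuous f) :
    Continuous (momentumFun g f) := by
  unfold momentumFun
  exact ((continuous_phase _).mul continuous_const).mul (hf.comp (by fun_prop))

/-- Pointwise differentiability is upgraded to `L²` by dominated convergence. The mean value
inequality bounds the difference quotients, which is why the pointwise derivative is required along
the whole curve and not only at `0`. -/
theorem hasDerivAt_momentumRep {γ : ℝ → AxB} (h0 : γ 0 = 1) (hr : ∀ s, |(γ s).r| ≤ |s|)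
    {η κ : 𝓢(ℝ, ℂ)}
    (hd : ∀ s ξ, HasDerivAt (fun t => momentumFun (γ t) η ξ) (momentumFun (γ s) κ ξ) s) :
    HasDerivAt (fun t => momentumRep (γ t) (η.toLp 2)) (κ.toLp 2) 0 := by
  obtain ⟨C, hC, hκ⟩ := exists_schwartz_bound κ
  have hb : ∀ s, |s| ≤ 1 → ∀ ξ, ‖momentumFun (γ s) κ ξ‖ ≤ Real.exp 3 * C * (1 + ξ ^ 2)⁻¹ :=
    fun s hs => norm_momentumFun_le hC hκ _ ((hr s).trans hs)
  set K : ℝ := Real.exp 3 * C with hK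
  have hK0 : 0 ≤ K := by positivity
  -- The error of the difference quotient at `ξ`; its squared `L²` norm has to tend to `0`.
  let q : ℝ → ℝ → ℂ := fun t ξ =>
    (t : ℂ)⁻¹ * (momentumFun (γ t) η ξ - momentumFun (γ 0) η ξ) - κ ξ
  have hqm : ∀ t, Measurable (q t) := fun t =>
    (continuous_const.mul ((continuous_momentumFun _ η.continuous).sub
      (continuous_momentumFun _ η.continuous)) |>.sub κ.continuous).measurable
  have hnorm : ∀ t, ‖slope (fun t => momentumRep (γ t) (η.toLp 2)) 0 t - κ.toLp 2 volume‖ₑ ^ 2 =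
      ∫⁻ ξ, ‖q t ξ‖ₑ ^ 2 := by
    intro t
    rw [enorm_sq_mode]
    refine lintegral_congr_ae ?_
    rw [slope_def_module]
    filter_upwards [Lp.coeFn_sub ((t - 0)⁻¹ • (momentumRep (γ t) (η.toLp 2) -
        momentumRep (γ 0) (η.toLp 2))) (κ.toLp 2),
      Lp.coeFn_smul ((t - 0)⁻¹) (momentumRep (γ t) (η.toLp 2) - momentumRep (γ 0) (η.toLp 2)),
      Lp.coeFn_sub (momentumRep (γ t) (η.toLp 2)) (momentumRep (γ 0) (η.toLp 2)),
      momentumRep_coe (γ t) (η.toLp 2), momentumRep_coe (γ 0) (η.toLp 2),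
      momentumFun_congr (γ t) (η.coeFn_toLp 2), momentumFun_congr (γ 0) (η.coeFn_toLp 2),
      κ.coeFn_toLp 2] with ξ h1 h2 h3 h4 h5 h6 h7 h8
    rw [h1, Pi.sub_apply, h2, Pi.smul_apply, h3, Pi.sub_apply, h4, h5, h6, h7, h8]
    simp [q]
  rw [hasDerivAt_iff_tendsto_slope, tendsto_iff_norm_sub_tendsto_zero]
  have hlim : Filter.Tendsto (fun t => ∫⁻ ξ, ‖q t ξ‖ₑ ^ 2) (nhdsWithin 0 {0}ᶜ)
      (nhds (∫⁻ _ : ℝ, 0)) := by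
    refine tendsto_lintegral_filter_of_dominated_convergence
      (fun ξ => ENNReal.ofReal ((2 * K) ^ 2 * (1 + ξ ^ 2)⁻¹))
      (.of_forall fun t => (hqm t).enorm.pow_const 2) ?_ ?_ ?_
    · have hmem : Metric.closedBall (0 : ℝ) 1 ∈ nhdsWithin (0 : ℝ) {0}ᶜ :=
        mem_nhdsWithin_of_mem_nhds (Metric.closedBall_mem_nhds _ one_pos)
      filter_upwards [hmem, self_mem_nhdsWithin] with t ht ht0
      refine .of_forall fun ξ => ?_
      have ht1 : |t| ≤ 1 := by simpa using ht
      have ht0' : t ≠ 0 := ht0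
      have mv := Convex.norm_image_sub_le_of_norm_hasDerivWithin_le
        (f := fun t => momentumFun (γ t) η ξ) (f' := fun s => momentumFun (γ s) κ ξ)
        (s := Metric.closedBall (0 : ℝ) 1) (x := 0) (y := t) (C := K * (1 + ξ ^ 2)⁻¹)
        (fun s _ => (hd s ξ).hasDerivWithinAt)
        (fun s hs => hb s (by simpa using hs) ξ) (convex_closedBall _ _) (by simp) ht
      have hκξ := hb 0 (by simp) ξ
      rw [h0, momentumFun_one] at hκξ
      have hq : ‖q t ξ‖ ≤ 2 * K * (1 + ξ ^ 2)⁻¹ := by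
        refine (norm_sub_le _ _).trans ?_
        have : ‖(t : ℂ)⁻¹ * (momentumFun (γ t) η ξ - momentumFun (γ 0) η ξ)‖
            ≤ K * (1 + ξ ^ 2)⁻¹ := by
          rw [norm_mul, norm_inv, Complex.norm_real, inv_mul_le_iff₀ (norm_pos_iff.mpr ht0')]
          rw [sub_zero] at mv
          linarith
        linarith
      rw [← ofReal_norm, ← ENNReal.ofReal_pow (norm_nonneg _)]
      refine ENNReal.ofReal_le_ofReal ?_
      have hw : 0 < (1 + ξ ^ 2)⁻¹ := by positivity
      have hw1 : (1 + ξ ^ 2)⁻¹ ≤ 1 := inv_le_one_of_one_le₀ (by nlinarith [sq_nonneg ξ])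
      -- The square of the bound carries two factors `(1 + ξ²)⁻¹`; one of them already gives an
      -- integrable majorant.
      calc ‖q t ξ‖ ^ 2 ≤ (2 * K * (1 + ξ ^ 2)⁻¹) ^ 2 := pow_le_pow_left₀ (norm_nonneg _) hq 2
        _ = (2 * K) ^ 2 * (1 + ξ ^ 2)⁻¹ * (1 + ξ ^ 2)⁻¹ := by ring
        _ ≤ (2 * K) ^ 2 * (1 + ξ ^ 2)⁻¹ * 1 :=
          mul_le_mul_of_nonneg_left hw1 (by positivity)
        _ = _ := mul_one _
    · exact (Integrable.lintegral_lt_top (integrable_inv_one_add_sq.const_mul _)).ne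
    · refine .of_forall fun ξ => ?_
      have hs := hasDerivAt_iff_tendsto_slope.mp (hd 0 ξ)
      rw [h0, momentumFun_one] at hs
      have h2 : Filter.Tendsto (fun t => q t ξ) (nhdsWithin 0 {0}ᶜ) (nhds 0) := by
        have := hs.sub_const (κ ξ)
        rw [sub_self] at this
        refine this.congr fun t => ?_
        simp [slope_def_module, q, h0]
      have h3 := (ENNReal.continuous_pow 2).tendsto _ |>.comp h2.enorm
      simpa [Function.comp_def] using h3
  rw [lintegral_zero] at hlim
  simp_rw [← hnorm] at hlim
  have h4 : Filter.Tendsto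
      (fun t => √(‖slope (fun t => momentumRep (γ t) (η.toLp 2)) 0 t - κ.toLp 2 volume‖ₑ ^ 2).toReal)
      (nhdsWithin 0 {0}ᶜ) (nhds 0) := by
    have := (Real.continuous_sqrt.tendsto _).comp
      ((ENNReal.tendsto_toReal ENNReal.zero_ne_top).comp hlim)
    simpa [Function.comp_def] using this
  simpa using h4

theorem hasDerivAt_affRep {γ : ℝ → AxB} (h0 : γ 0 = 1) (hr : ∀ s, |(γ s).r| ≤ |s|)
    {ψ χ : 𝓢(ℝ, ℂ)}
    (hd : ∀ s ξ, HasDerivAt (fun t => momentumFun (γ t) (𝓕 ψ : 𝓢(ℝ, ℂ)) ξ)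
      (momentumFun (γ s) (𝓕 χ : 𝓢(ℝ, ℂ)) ξ) s) :
    HasDerivAt (fun t => affRep (γ t) (ψ.toLp 2)) (χ.toLp 2) 0 := by
  have h := hasDerivAt_momentumRep h0 hr hd
  have h2 := ((Lp.fourierTransformₗᵢ ℝ ℂ).symm.toContinuousLinearEquiv.toContinuousLinearMap
    |>.restrictScalars ℝ).hasFDerivAt.comp_hasDerivAt 0 h
  have e : (Lp.fourierTransformₗᵢ ℝ ℂ).symm ((𝓕 χ).toLp 2) = χ.toLp 2 := by
    rw [← SchwartzMap.toLp_fourier_eq]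
    exact (Lp.fourierTransformₗᵢ ℝ ℂ).symm_apply_apply _
  have e' : ∀ t, (Lp.fourierTransformₗᵢ ℝ ℂ).symm (momentumRep (γ t) ((𝓕 ψ).toLp 2)) =
      affRep (γ t) (ψ.toLp 2) := by
    intro t
    rw [affRep_apply, SchwartzMap.toLp_fourier_eq]; rfl
  simpa [Function.comp_def, e, e'] using! h2

/-! ### The generators in momentum space. -/

theorem fourier_derivCLM_apply (ψ : 𝓢(ℝ, ℂ)) (ξ : ℝ) :
    𝓕 (SchwartzMap.derivCLM ℂ ℂ ψ) ξ = 2 * Real.pi * Complex.I * ξ * 𝓕 ψ ξ := by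
  have := congrFun (Real.fourier_deriv ψ.integrable ψ.differentiable
    (SchwartzMap.derivCLM ℂ ℂ ψ).integrable) ξ
  rw [SchwartzMap.fourier_coe, SchwartzMap.fourier_coe]
  simpa using! this

theorem deriv_fourier_apply (ψ : 𝓢(ℝ, ℂ)) (ξ : ℝ) :
    deriv (𝓕 ψ : 𝓢(ℝ, ℂ)) ξ = -2 * Real.pi * Complex.I * 𝓕 (posX ψ) ξ := by
  have hi : Integrable (fun x : ℝ => x • ψ x) := by
    refine ((posX ψ).integrable (μ := volume)).congr (.of_forall fun x => ?_)
    rw [posX_apply]; simp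
  have := congrFun (Real.deriv_fourier ψ.integrable hi) ξ
  rw [SchwartzMap.fourier_coe, this, SchwartzMap.fourier_coe]
  have e : (fun x : ℝ => (-2 * Real.pi * Complex.I * x) • ψ x) =
      ((-2 * Real.pi * Complex.I : ℂ) • posX ψ : 𝓢(ℝ, ℂ)) := by
    ext x; simp [posX_apply]; ring
  rw [e, ← SchwartzMap.fourier_coe, FourierTransform.fourier_smul]
  rfl

theorem dispGen_eq (ψ : 𝓢(ℝ, ℂ)) : dispGen ψ = -SchwartzMap.derivCLM ℂ ℂ ψ := by
  simp only [dispGen, cre, ann, _root_.add_apply, _root_.sub_apply, _root_.smul_apply]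
  module

theorem quadY_eq (ψ : 𝓢(ℝ, ℂ)) :
    quadY ψ = (1 / (2 * Complex.I) : ℂ) • SchwartzMap.derivCLM ℂ ℂ ψ := by
  simp only [quadY, cre, ann, _root_.add_apply, _root_.sub_apply, _root_.smul_apply]
  congr 1
  module

theorem deriv_posX (ψ : 𝓢(ℝ, ℂ)) :
    SchwartzMap.derivCLM ℂ ℂ (posX ψ) = ψ + posX (SchwartzMap.derivCLM ℂ ℂ ψ) := by
  have h := ann_cre_commutator ψ
  simp only [ann, cre, _root_.add_apply, _root_.sub_apply,
    _root_.smul_apply, map_sub, map_add, map_smul] at h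
  rw [← sub_eq_iff_eq_add]
  rw [← sub_eq_zero] at h ⊢
  rw [← h]
  module

/-- `a†² - a²` is minus the anticommutator of `X` and `d/dX`. The commutation relation puts the
derivative outermost, where the Fourier rules for a derivative and for multiplication by `q` apply
in turn. -/
theorem sqGen_eq (ψ : 𝓢(ℝ, ℂ)) :
    sqGen ψ = (1 / 2 : ℂ) • ψ - SchwartzMap.derivCLM ℂ ℂ (posX ψ) := by
  simp only [sqGen, ann, cre, _root_.add_apply, _root_.sub_apply, ContinuousLinearMap.comp_apply,
    _root_.smul_apply, map_sub, map_add, map_smul, deriv_posX]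
  module

theorem fourier_dispGen (ψ : 𝓢(ℝ, ℂ)) (ξ : ℝ) :
    𝓕 (dispGen ψ) ξ = -(2 * Real.pi * Complex.I * ξ * 𝓕 ψ ξ) := by
  rw [dispGen_eq, ← neg_one_smul ℂ, FourierTransform.fourier_smul, _root_.smul_apply,
    fourier_derivCLM_apply]
  simp

theorem fourier_quadY (ψ : 𝓢(ℝ, ℂ)) (ξ : ℝ) :
    𝓕 (quadY ψ) ξ = ((Real.pi * ξ : ℝ) : ℂ) * 𝓕 ψ ξ := by
  rw [quadY_eq, FourierTransform.fourier_smul, _root_.smul_apply, fourier_derivCLM_apply]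
  simp; ring_nf; simp

theorem fourier_sqGen (ψ : 𝓢(ℝ, ℂ)) (ξ : ℝ) :
    𝓕 (sqGen ψ) ξ = (1 / 2) * 𝓕 ψ ξ + ξ * deriv (𝓕 ψ : 𝓢(ℝ, ℂ)) ξ := by
  rw [sqGen_eq, sub_eq_add_neg, ← neg_one_smul ℂ, FourierTransform.fourier_add,
    FourierTransform.fourier_smul, FourierTransform.fourier_smul, _root_.add_apply,
    _root_.smul_apply, _root_.smul_apply, fourier_derivCLM_apply, deriv_fourier_apply]
  simp; ring

/-! ### Unitary one-parameter groups and their uniqueness. -/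

theorem dense_schwartz : Dense (Set.range fun ψ : 𝓢(ℝ, ℂ) => (ψ.toLp 2 volume : Mode)) :=
  SchwartzMap.denseRange_toLpCLM (F := ℂ) (p := 2) (μ := (volume : Measure ℝ)) ENNReal.ofNat_ne_top

theorem norm_of_mem_unitary {V : Mode →L[ℂ] Mode} (h : V ∈ unitary (Mode →L[ℂ] Mode)) (ψ : Mode) :
    ‖V ψ‖ = ‖ψ‖ :=
  (ContinuousLinearMap.norm_map_iff_adjoint_comp_self V).mpr (Unitary.mem_iff.mp h).1 ψ

section

variable {H : Type*} [NormedAddCommGroup H] [InnerProductSpace ℂ H]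

/-- An `ε/3` argument: isometries are equicontinuous, so continuity of orbits passes from a dense
set to its closure. -/
theorem continuous_of_continuous_dense {X : Type*} [TopologicalSpace X] {s : Set H} (hs : Dense s)
    {V : X → H →L[ℂ] H} (hV : ∀ t ψ, ‖V t ψ‖ = ‖ψ‖)
    (h : ∀ ψ ∈ s, Continuous fun t => V t ψ) (ψ : H) : Continuous fun t => V t ψ := by
  rw [continuous_iff_continuousAt]
  intro t
  rw [Metric.continuousAt_iff']
  intro ε hε
  obtain ⟨χ, hχs, hχ⟩ := Metric.mem_closure_iff.mp (hs ψ) (ε / 3) (by positivity)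
  have hc := Metric.continuousAt_iff'.mp ((h χ hχs).continuousAt (x := t)) (ε / 3) (by positivity)
  filter_upwards [hc] with s hs
  have e : ∀ s, dist (V s ψ) (V s χ) = dist ψ χ := by
    intro s; rw [dist_eq_norm, dist_eq_norm, ← map_sub, hV]
  calc _ ≤ dist (V s ψ) (V s χ) + dist (V s χ) (V t χ) + dist (V t χ) (V t ψ) :=
        dist_triangle4 _ _ _ _
    _ < ε / 3 + ε / 3 + ε / 3 := by
        rw [dist_comm (V t χ), e, e]
        gcongr
    _ = ε := by ring

theorem hasDerivAt_of_map_add {V : ℝ → H →L[ℂ] H} (hadd : ∀ s t, V (s + t) = V s * V t)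
    {ψ χ : H} (h : HasDerivAt (fun t => V t ψ) χ 0) (t : ℝ) :
    HasDerivAt (fun t => V t ψ) (V t χ) t := by
  have h' : HasDerivAt (fun t => V t ψ) χ (t - t) := by rwa [sub_self]
  have h1 := ((V t).restrictScalars ℝ).hasFDerivAt.comp_hasDerivAt t (h'.comp_sub_const t t)
  refine HasDerivAt.congr_of_eventuallyEq h1 (.of_forall fun s => ?_)
  change V s ψ = V t (V (s - t) ψ)
  have := congrArg (fun A => A ψ) (hadd t (s - t))
  rw [add_sub_cancel] at this
  exact this

/-- By unitarity `⟪V (s + t) a, V s b⟫` does not depend on `s`; differentiating at `s = 0` gives the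
skew-symmetry of the generator. -/
theorem inner_add_inner_eq_zero_of_unitary [CompleteSpace H] {V : ℝ → H →L[ℂ] H} (h0 : V 0 = 1)
    (hadd : ∀ s t, V (s + t) = V s * V t) (hU : ∀ t, V t ∈ unitary (H →L[ℂ] H))
    {a b a' b' : H} (ha : HasDerivAt (fun t => V t a) a' 0) (hb : HasDerivAt (fun t => V t b) b' 0)
    (t : ℝ) : ⟪V t a, b'⟫_ℂ + ⟪V t a', b⟫_ℂ = 0 := by
  have h1 : HasDerivAt (fun t => V t a) (V t a') (0 + t) := by
    rw [zero_add]; exact hasDerivAt_of_map_add hadd ha t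
  have h2 := HasDerivAt.inner ℂ (h1.comp_add_const 0 t) hb
  have h3 : (fun s => ⟪V (s + t) a, V s b⟫_ℂ) = fun _ => ⟪V t a, b⟫_ℂ := by
    funext s
    rw [hadd]
    exact (ContinuousLinearMap.inner_map_map_iff_adjoint_comp_self (V s)).mpr
      (Unitary.mem_iff.mp (hU s)).1 _ _
  rw [h3] at h2
  have h4 := h2.unique (hasDerivAt_const _ _)
  simpa [h0] using h4

theorem inner_eq_of_hasDerivAt {u w u' w' : ℝ → H} (hu : ∀ t, HasDerivAt u (u' t) t)
    (hw : ∀ t, HasDerivAt w (w' t) t) (h : ∀ t, ⟪u t, w' t⟫_ℂ + ⟪u' t, w t⟫_ℂ = 0) (t : ℝ) :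
    ⟪u t, w t⟫_ℂ = ⟪u 0, w 0⟫_ℂ := by
  have hd : ∀ t, HasDerivAt (fun t => ⟪u t, w t⟫_ℂ) 0 t := fun t => by
    have := HasDerivAt.inner ℂ (hu t) (hw t)
    rwa [h t] at this
  exact is_const_of_deriv_eq_zero (fun t => (hd t).differentiableAt) (fun t => (hd t).deriv) t 0

end

theorem isExponential_of_hasDerivAt {T : 𝓢(ℝ, ℂ) →L[ℂ] 𝓢(ℝ, ℂ)} {V : ℝ → Mode →L[ℂ] Mode}
    (h0 : V 0 = 1) (hadd : ∀ s t, V (s + t) = V s * V t)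
    (hU : ∀ t, V t ∈ unitary (Mode →L[ℂ] Mode))
    (hd : ∀ ψ : 𝓢(ℝ, ℂ), HasDerivAt (fun t => V t (ψ.toLp 2)) ((T ψ).toLp 2) 0) :
    IsExponential T V where
  map_zero := h0
  map_add := hadd
  unitary := hU
  continuous := continuous_of_continuous_dense dense_schwartz
    (fun t => norm_of_mem_unitary (hU t)) <| by
      rintro _ ⟨ψ, rfl⟩
      exact continuous_iff_continuousAt.mpr fun t =>
        (hasDerivAt_of_map_add hadd (hd ψ) t).continuousAt
  generator := hd

/-- An exponential that preserves the Schwartz functions is the only one. -/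
theorem IsExponential.eq_of_preserves {T : 𝓢(ℝ, ℂ) →L[ℂ] 𝓢(ℝ, ℂ)} {V W : ℝ → Mode →L[ℂ] Mode}
    (hV : IsExponential T V) (hW : IsExponential T W)
    (hS : ∀ t (ψ : 𝓢(ℝ, ℂ)), ∃ χ : 𝓢(ℝ, ℂ), W t (ψ.toLp 2) = χ.toLp 2) : V = W := by
  have key : ∀ (φ ψ : 𝓢(ℝ, ℂ)) (t : ℝ),
      ⟪V t (φ.toLp 2), W t (ψ.toLp 2)⟫_ℂ = ⟪(φ.toLp 2 : Mode), ψ.toLp 2⟫_ℂ := by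
    intro φ ψ t
    have h0 := inner_eq_of_hasDerivAt (hasDerivAt_of_map_add hV.map_add (hV.generator φ))
      (hasDerivAt_of_map_add hW.map_add (hW.generator ψ)) (fun t => ?_) t
    · rw [h0, hV.map_zero, hW.map_zero]; rfl
    -- As `W t ψ` is again a Schwartz function `χ`, the generator of `V` is known on it: it is `T
    -- χ`, which also equals `W t (T ψ)`. Skew-symmetry for `V` then makes the derivative of `⟪V t
    -- φ, W t ψ⟫` vanish.
    obtain ⟨χ, hχ⟩ := hS t ψ
    have h3 : W t ((T ψ).toLp 2) = (T χ).toLp 2 := by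
      have h2 := hasDerivAt_of_map_add hW.map_add (hW.generator ψ) (0 + t)
      have h4 := h2.comp_add_const 0 t
      have h5 : (fun s => W (s + t) (ψ.toLp 2)) = fun s => W s (χ.toLp 2) := by
        funext s; rw [hW.map_add, ← hχ]; rfl
      rw [h5, zero_add] at h4
      exact h4.unique (hW.generator χ)
    rw [hχ, h3]
    exact inner_add_inner_eq_zero_of_unitary hV.map_zero hV.map_add hV.unitary (hV.generator φ)
      (hV.generator χ) t
  funext t
  have hcl : ∀ ψ : Mode, W t ψ = V t ψ := by
    have hs : ∀ ψ : 𝓢(ℝ, ℂ), W t (ψ.toLp 2) = V t (ψ.toLp 2) := by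
      intro ψ
      -- The constant inner products say that `V t† W t` fixes every Schwartz function.
      have h1 : ContinuousLinearMap.adjoint (V t) (W t (ψ.toLp 2)) = ψ.toLp 2 := by
        refine dense_schwartz.eq_of_inner_right ℂ ?_
        rintro _ ⟨φ, rfl⟩
        rw [ContinuousLinearMap.adjoint_inner_right]
        exact key φ ψ t
      have h2 := congrArg (V t) h1
      rw [← h2]
      exact congrArg (fun A => A (W t (ψ.toLp 2))) (Unitary.mem_iff.mp (hV.unitary t)).2.symm
    exact fun ψ => congrFun (Continuous.ext_on dense_schwartz (W t).continuous (V t).continuous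
      (by rintro _ ⟨ψ, rfl⟩; exact hs ψ)) ψ
  ext1 ψ
  exact (hcl ψ).symm

/-! ### Invariance of the Schwartz space and identification of the exponentials. -/

theorem hasTemperateGrowth_phase (x : ℝ) : (phase x).HasTemperateGrowth := by
  have hd : ∀ ξ, HasDerivAt (phase x) ((-2 * Real.pi * x : ℝ) * Complex.I * phase x ξ) ξ := by
    intro ξ
    have h1 : HasDerivAt (fun ξ : ℝ => ((-2 * Real.pi * ξ * x : ℝ) : ℂ) * Complex.I)
        ((-2 * Real.pi * x : ℝ) * Complex.I) ξ := by
      refine HasDerivAt.mul_const ?_ _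
      refine HasDerivAt.ofReal_comp ?_
      simpa using ((hasDerivAt_id ξ).const_mul (-2 * Real.pi)).mul_const x
    have := h1.cexp
    rw [mul_comm (Complex.exp _)] at this
    exact this
  have hit : ∀ n, iteratedDeriv n (phase x) =
      fun ξ => ((-2 * Real.pi * x : ℝ) * Complex.I) ^ n * phase x ξ := by
    intro n
    induction n with
    | zero => simp
    | succ n ih =>
      rw [iteratedDeriv_succ, ih]
      funext ξ
      rw [((hd ξ).const_mul _).deriv]; ring
  -- Every derivative of the character is a constant multiple of it, hence bounded: polynomial
  -- degree `0` suffices.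
  refine ⟨?_, fun n => ⟨0, ‖((-2 * Real.pi * x : ℝ) * Complex.I : ℂ)‖ ^ n, fun ξ => ?_⟩⟩
  · unfold phase
    refine ContDiff.cexp (ContDiff.mul ?_ contDiff_const)
    exact Complex.ofRealCLM.contDiff.comp
      ((contDiff_const.mul contDiff_id).mul contDiff_const)
  · rw [norm_iteratedFDeriv_eq_norm_iteratedDeriv, hit, norm_mul, norm_phase, norm_pow]
    simp

theorem exists_schwartz_momentumFun (g : AxB) (η : 𝓢(ℝ, ℂ)) :
    ∃ κ : 𝓢(ℝ, ℂ), (κ : ℝ → ℂ) = momentumFun g η := by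
  let u : ℝˣ := Units.mk0 (Real.exp g.r) (Real.exp_pos _).ne'
  refine ⟨SchwartzMap.smulLeftCLM ℂ (phase g.x) ((Real.exp (g.r / 2) : ℂ) •
    SchwartzMap.compCLMOfContinuousLinearEquiv ℂ (ContinuousLinearEquiv.unitsEquivAut ℝ u) η), ?_⟩
  ext ξ
  rw [SchwartzMap.smulLeftCLM_apply_apply (hasTemperateGrowth_phase _), _root_.smul_apply,
    SchwartzMap.compCLMOfContinuousLinearEquiv_apply]
  simp [momentumFun, u, mul_assoc, mul_comm ξ]

/-- Momentum-space dilations and characters act on Schwartz functions. This supplies the hypothesis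
of `IsExponential.eq_of_preserves`. -/
theorem affRep_schwartz (g : AxB) (ψ : 𝓢(ℝ, ℂ)) :
    ∃ χ : 𝓢(ℝ, ℂ), affRep g (ψ.toLp 2) = χ.toLp 2 := by
  obtain ⟨κ, hκ⟩ := exists_schwartz_momentumFun g (𝓕 ψ)
  refine ⟨𝓕⁻ κ, ?_⟩
  rw [affRep_apply, ← SchwartzMap.toLp_fourierInv_eq, SchwartzMap.toLp_fourier_eq]
  congr 1
  refine Lp.ext ?_
  filter_upwards [momentumRep_coe g ((𝓕 ψ).toLp 2), momentumFun_congr g ((𝓕 ψ).coeFn_toLp 2),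
    κ.coeFn_toLp 2] with ξ h1 h2 h3
  rw [h1, h2, h3, hκ]

theorem isExponential_displacement : IsExponential dispGen fun x => affRep (AxB.mk x 0) := by
  refine isExponential_of_hasDerivAt affRep_one (fun s t => ?_) (fun t => affRep_mem_unitary _)
    fun ψ => ?_
  · rw [← affRep_mul]; congr 1; ext <;> simp
  · refine hasDerivAt_affRep (γ := fun x => AxB.mk x 0) rfl (fun s => by simp) fun s ξ => ?_
    simp only [momentumFun, AxB.mk_x, AxB.mk_r, zero_div, Real.exp_zero, one_mul, fourier_dispGen,
      Complex.ofReal_one, mul_one]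
    have h1 : HasDerivAt (fun s : ℝ => ((-2 * Real.pi * ξ * s : ℝ) : ℂ) * Complex.I)
        ((-2 * Real.pi * ξ : ℝ) * Complex.I) s := by
      refine HasDerivAt.mul_const ?_ _
      refine HasDerivAt.ofReal_comp ?_
      have := (hasDerivAt_id s).const_mul (-2 * Real.pi * ξ)
      rwa [mul_one] at this
    refine (h1.cexp.mul_const ((𝓕 ψ : 𝓢(ℝ, ℂ)) ξ)).congr_deriv ?_
    simp only [phase]; push_cast; ring

theorem isExponential_squeezing : IsExponential sqGen fun r => affRep (AxB.mk 0 r) := by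
  refine isExponential_of_hasDerivAt affRep_one (fun s t => ?_) (fun t => affRep_mem_unitary _)
    fun ψ => ?_
  · rw [← affRep_mul]; congr 1; ext <;> simp
  · refine hasDerivAt_affRep (γ := fun r => AxB.mk 0 r) rfl (fun s => by simp) fun s ξ => ?_
    simp only [momentumFun, AxB.mk_x, AxB.mk_r, phase_zero, one_mul, fourier_sqGen]
    have h1 : HasDerivAt (fun s : ℝ => ((Real.exp (s / 2) : ℝ) : ℂ))
        ((Real.exp (s / 2) * (1 / 2) : ℝ) : ℂ) s :=
      HasDerivAt.ofReal_comp (((hasDerivAt_id s).div_const 2).exp)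
    have h2 : HasDerivAt (fun s => (𝓕 ψ : 𝓢(ℝ, ℂ)) (Real.exp s * ξ))
        ((Real.exp s * ξ) • deriv (𝓕 ψ : 𝓢(ℝ, ℂ)) (Real.exp s * ξ)) s :=
      ((𝓕 ψ : 𝓢(ℝ, ℂ)).hasDerivAt (Real.exp s * ξ)).scomp s
        ((Real.hasDerivAt_exp s).mul_const ξ)
    refine (h1.mul h2).congr_deriv ?_
    simp only [Complex.real_smul]; push_cast; ring

theorem displacement_eq {D : ℝ → Mode →L[ℂ] Mode} (hD : IsExponential dispGen D) :
    D = fun x => affRep (AxB.mk x 0) :=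
  hD.eq_of_preserves isExponential_displacement fun _ => affRep_schwartz _

theorem squeezing_eq {S : ℝ → Mode →L[ℂ] Mode} (hS : IsExponential sqGen S) :
    S = fun r => affRep (AxB.mk 0 r) :=
  hS.eq_of_preserves isExponential_squeezing fun _ => affRep_schwartz _

theorem affRep_eq_mul (g : AxB) : affRep g = affRep (AxB.mk g.x 0) * affRep (AxB.mk 0 g.r) := by
  rw [← affRep_mul]; congr 1; ext <;> simp

theorem rep_eq_affRep {D S : ℝ → Mode →L[ℂ] Mode} (hD : IsExponential dispGen D)
    (hS : IsExponential sqGen S) : rep D S = affRep := by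
  funext g
  rw [rep, displacement_eq hD, squeezing_eq hS, affRep_eq_mul g]

theorem continuous_x : Continuous AxB.x := continuous_fst (X := ℝ) (Y := ℝ)

theorem continuous_r : Continuous AxB.r := continuous_snd (X := ℝ) (Y := ℝ)

/-- Joint continuity from separate continuity: with `U = D(x) S(r)` and `D(x)` isometric, the change
in `r` is controlled by `S` alone, and the change in `x` acts on the fixed vector `S(r₀) ψ`. -/
theorem continuous_affRep (ψ : Mode) : Continuous fun g => affRep g ψ := by
  rw [continuous_iff_continuousAt]
  intro g
  have h1 : Filter.Tendsto (fun h : AxB => ‖affRep (AxB.mk 0 h.r) ψ - affRep (AxB.mk 0 g.r) ψ‖)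
      (nhds g) (nhds 0) := by
    have := (isExponential_squeezing.continuous ψ).comp continuous_r
    exact tendsto_iff_norm_sub_tendsto_zero.mp (this.tendsto g)
  have h2 : Filter.Tendsto (fun h : AxB => affRep (AxB.mk h.x 0) (affRep (AxB.mk 0 g.r) ψ))
      (nhds g) (nhds (affRep (AxB.mk g.x 0) (affRep (AxB.mk 0 g.r) ψ))) :=
    ((isExponential_displacement.continuous (affRep (AxB.mk 0 g.r) ψ)).comp continuous_x).tendsto g
  have h2 := tendsto_iff_norm_sub_tendsto_zero.mp h2
  refine tendsto_iff_norm_sub_tendsto_zero.mpr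
    (squeeze_zero (fun _ => norm_nonneg _) (fun h => ?_) (by simpa using h1.add h2))
  have e : ∀ h, affRep h ψ = affRep (AxB.mk h.x 0) (affRep (AxB.mk 0 h.r) ψ) := fun h => by
    conv_lhs => rw [affRep_eq_mul h]
    rfl
  change ‖affRep h ψ - affRep g ψ‖ ≤ _
  rw [e h, e g]
  calc _ ≤ _ := norm_sub_le_norm_sub_add_norm_sub _
        (affRep (AxB.mk h.x 0) (affRep (AxB.mk 0 g.r) ψ)) _
    _ = _ := by rw [← map_sub, norm_affRep]

theorem isUnitaryRep_affRep : IsUnitaryRep affRep where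
  unitary := affRep_mem_unitary
  map_one := affRep_one
  map_mul := affRep_mul
  continuous := continuous_affRep

/-! ### Functions of `Y` -/

theorem fourier_inj {φ ψ : Mode} (h : (𝓕 φ : Mode) =ᵐ[volume] (𝓕 ψ : Mode)) : φ = ψ :=
  (Lp.fourierTransformₗᵢ ℝ ℂ).injective (Lp.ext h)

theorem exists_fourier_ae_eq {f : ℝ → ℂ} (hf : MemLp f 2) : ∃ φ : Mode, (𝓕 φ : Mode) =ᵐ[volume] f := by
  refine ⟨𝓕⁻ (hf.toLp f : Mode), ?_⟩
  rw [FourierTransform.fourier_fourierInv_eq]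
  exact hf.coeFn_toLp

theorem inner_eq_integral_fourier (φ ψ : Mode) :
    ⟪φ, ψ⟫_ℂ = ∫ ξ, ⟪(𝓕 φ : Mode) ξ, (𝓕 ψ : Mode) ξ⟫_ℂ := by
  rw [← L2.inner_def, Lp.inner_fourier_eq]

theorem enorm_sq_eq_lintegral_fourier (φ : Mode) : ‖φ‖ₑ ^ 2 = ∫⁻ ξ, ‖(𝓕 φ : Mode) ξ‖ₑ ^ 2 := by
  rw [← enorm_sq_mode, enorm_fourier]

theorem fourier_add_coe (φ ψ : Mode) :
    (𝓕 (φ + ψ) : Mode) =ᵐ[volume] fun ξ => (𝓕 φ : Mode) ξ + (𝓕 ψ : Mode) ξ := by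
  have : (𝓕 (φ + ψ) : Mode) = 𝓕 φ + 𝓕 ψ := (Lp.fourierTransformₗᵢ ℝ ℂ).map_add φ ψ
  rw [this]; exact Lp.coeFn_add _ _

theorem fourier_sub_coe (φ ψ : Mode) :
    (𝓕 (φ - ψ) : Mode) =ᵐ[volume] fun ξ => (𝓕 φ : Mode) ξ - (𝓕 ψ : Mode) ξ := by
  have : (𝓕 (φ - ψ) : Mode) = 𝓕 φ - 𝓕 ψ := (Lp.fourierTransformₗᵢ ℝ ℂ).map_sub φ ψ
  rw [this]; exact Lp.coeFn_sub _ _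

theorem fourier_smul_coe (c : ℂ) (φ : Mode) :
    (𝓕 (c • φ) : Mode) =ᵐ[volume] fun ξ => c * (𝓕 φ : Mode) ξ := by
  have : (𝓕 (c • φ) : Mode) = c • 𝓕 φ := (Lp.fourierTransformₗᵢ ℝ ℂ).map_smul c φ
  rw [this]; exact Lp.coeFn_smul _ _

theorem fourier_zero_coe : (𝓕 (0 : Mode) : Mode) =ᵐ[volume] fun _ => 0 := by
  have : (𝓕 (0 : Mode) : Mode) = 0 := (Lp.fourierTransformₗᵢ ℝ ℂ).map_zero
  rw [this]; exact Lp.coeFn_zero _ _ _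

theorem aestronglyMeasurable_fourier (φ : Mode) :
    AEStronglyMeasurable ((𝓕 φ : Mode) : ℝ → ℂ) volume := Lp.aestronglyMeasurable _

section FunctionalCalculus

variable {f : ℝ → ℝ}

theorem mem_domain_fnY {ψ : Mode} : ψ ∈ (fnY f).domain ↔
    MemLp (fun ξ : ℝ => (f (Real.pi * ξ) : ℂ) * (𝓕 ψ : Mode) ξ) 2 volume := Iff.rfl

theorem fourier_fnY_apply (ψ : (fnY f).domain) : (𝓕 (fnY f ψ) : Mode) =ᵐ[volume]
    fun ξ => (f (Real.pi * ξ) : ℂ) * (𝓕 (ψ : Mode) : Mode) ξ := by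
  have h : (𝓕 (fnY f ψ) : Mode) = MemLp.toLp _ ψ.2 :=
    (Lp.fourierTransformₗᵢ ℝ ℂ).apply_symm_apply _
  rw [h]
  exact MemLp.coeFn_toLp _

theorem mem_graph_fnY {ψ φ : Mode} : (ψ, φ) ∈ (fnY f).graph ↔
    (𝓕 φ : Mode) =ᵐ[volume] fun ξ => (f (Real.pi * ξ) : ℂ) * (𝓕 ψ : Mode) ξ := by
  rw [LinearPMap.mem_graph_iff]
  constructor
  · rintro ⟨y, rfl, rfl⟩
    exact fourier_fnY_apply y
  · intro h
    have hm : ψ ∈ (fnY f).domain :=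
      mem_domain_fnY.mpr ((memLp_congr_ae h).mp (Lp.memLp (𝓕 φ : Mode)))
    exact ⟨⟨ψ, hm⟩, rfl, fourier_inj ((fourier_fnY_apply ⟨ψ, hm⟩).trans h.symm)⟩

theorem aestronglyMeasurable_fnY (hf : Measurable f) (ψ : Mode) :
    AEStronglyMeasurable (fun ξ : ℝ => (f (Real.pi * ξ) : ℂ) * (𝓕 ψ : Mode) ξ) volume :=
  (Complex.measurable_ofReal.comp (hf.comp (measurable_const_mul _))).aestronglyMeasurable.mul
    (aestronglyMeasurable_fourier ψ)

theorem energy_fnY (hf : Measurable f) (ψ : Mode) : energy (fnY f) ψ =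
    ∫⁻ ξ, ‖(f (Real.pi * ξ) : ℂ) * (𝓕 ψ : Mode) ξ‖ₑ ^ 2 := by
  unfold energy
  split_ifs with h
  · rw [enorm_sq_eq_lintegral_fourier]
    refine lintegral_congr_ae ?_
    filter_upwards [fourier_fnY_apply ⟨ψ, h⟩] with ξ hξ
    rw [hξ]
  · rw [mem_domain_fnY, memLp_two_iff (aestronglyMeasurable_fnY hf ψ), not_lt_top_iff] at h
    exact h.symm

theorem inner_graph_fnY {a b ψ w : Mode} (h1 : (a, b) ∈ (fnY f).graph)
    (h2 : (ψ, w) ∈ (fnY f).graph) : ⟪b, ψ⟫_ℂ = ⟪a, w⟫_ℂ := by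
  rw [mem_graph_fnY] at h1 h2
  rw [inner_eq_integral_fourier, inner_eq_integral_fourier]
  refine integral_congr_ae ?_
  filter_upwards [h1, h2] with ξ e1 e2
  simp only [e1, e2, RCLike.inner_apply, map_mul, Complex.conj_ofReal]
  ring

/-- The substantial half of self-adjointness: the adjoint is no larger than the multiplication
operator. On the set where `|f| ≤ n` the defect `f ψ̂ - ŵ` is square integrable and, cut off there,
is an allowed test vector; testing against it forces it to vanish. These sets exhaust the line. -/
theorem mem_graph_fnY_of_adjoint (hf : Measurable f) {ψ w : Mode}
    (h : ∀ a b, (a, b) ∈ (fnY f).graph → ⟪b, ψ⟫_ℂ = ⟪a, w⟫_ℂ) : (ψ, w) ∈ (fnY f).graph := by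
  rw [mem_graph_fnY]
  have key : ∀ n : ℕ, ∀ᵐ ξ : ℝ, |f (Real.pi * ξ)| ≤ n →
      (f (Real.pi * ξ) : ℂ) * (𝓕 ψ : Mode) ξ - (𝓕 w : Mode) ξ = 0 := by
    intro n
    have hS : MeasurableSet {ξ : ℝ | |f (Real.pi * ξ)| ≤ n} :=
      measurableSet_le (hf.comp (measurable_const_mul _)).abs measurable_const
    let d : ℝ → ℂ := fun ξ => (f (Real.pi * ξ) : ℂ) * (𝓕 ψ : Mode) ξ - (𝓕 w : Mode) ξ
    have h1 : MemLp ({ξ : ℝ | |f (Real.pi * ξ)| ≤ n}.indicator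
        fun ξ => (f (Real.pi * ξ) : ℂ) * (𝓕 ψ : Mode) ξ) 2 := by
      refine MemLp.of_le_mul (c := n) (Lp.memLp (𝓕 ψ : Mode))
        ((aestronglyMeasurable_fnY hf ψ).indicator hS) (.of_forall fun ξ => ?_)
      by_cases hξ : |f (Real.pi * ξ)| ≤ n
      · rw [Set.indicator_of_mem (by exact hξ), norm_mul, Complex.norm_real]
        exact mul_le_mul_of_nonneg_right hξ (norm_nonneg _)
      · rw [Set.indicator_of_notMem (by exact hξ), norm_zero]; positivity
    have hd : MemLp ({ξ : ℝ | |f (Real.pi * ξ)| ≤ n}.indicator d) 2 := by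
      have := h1.sub ((Lp.memLp (𝓕 w : Mode)).indicator hS)
      rwa [← Set.indicator_sub'] at this
    have hfd : MemLp (fun ξ => (f (Real.pi * ξ) : ℂ) *
        {ξ : ℝ | |f (Real.pi * ξ)| ≤ n}.indicator d ξ) 2 := by
      refine MemLp.of_le_mul (c := n) hd
        ((Complex.measurable_ofReal.comp
          (hf.comp (measurable_const_mul _))).aestronglyMeasurable.mul hd.1)
        (.of_forall fun ξ => ?_)
      by_cases hξ : |f (Real.pi * ξ)| ≤ n
      · rw [norm_mul, Complex.norm_real]
        exact mul_le_mul_of_nonneg_right hξ (norm_nonneg _)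
      · rw [Set.indicator_of_notMem (by exact hξ)]; simp
    obtain ⟨a, ha⟩ := exists_fourier_ae_eq hd
    obtain ⟨b, hb⟩ := exists_fourier_ae_eq hfd
    have hab : (a, b) ∈ (fnY f).graph := by
      rw [mem_graph_fnY]
      filter_upwards [ha, hb] with ξ e1 e2
      rw [e1, e2]
    -- For this test vector, `⟪b, ψ⟫ - ⟪a, w⟫` is exactly `‖a‖²`.
    have ha0 : a = 0 := by
      rw [← inner_self_eq_zero (𝕜 := ℂ), ← sub_eq_zero.mpr (h a b hab),
        inner_eq_integral_fourier a a, inner_eq_integral_fourier b ψ, inner_eq_integral_fourier a w,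
        ← integral_sub (L2.integrable_inner _ _) (L2.integrable_inner _ _)]
      refine integral_congr_ae ?_
      filter_upwards [ha, hb] with ξ e1 e2
      rw [e1, e2]
      by_cases hξ : |f (Real.pi * ξ)| ≤ n
      · rw [Set.indicator_of_mem (by exact hξ)]
        simp only [d, RCLike.inner_apply, map_mul, Complex.conj_ofReal]
        ring
      · rw [Set.indicator_of_notMem (by exact hξ)]; simp
    rw [ha0] at ha
    filter_upwards [ha, fourier_zero_coe] with ξ e1 e2 hξ
    rw [e2, Set.indicator_of_mem (by exact hξ)] at e1
    exact e1.symm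
  filter_upwards [ae_all_iff.mpr key] with ξ hξ
  obtain ⟨n, hn⟩ := exists_nat_ge |f (Real.pi * ξ)|
  exact (sub_eq_zero.mp (hξ n hn)).symm

/-- If `w` is orthogonal to the domain, then `(0, w)` satisfies the adjoint relation, so it lies in
the graph and `w = 0`. -/
theorem dense_domain_fnY (hf : Measurable f) : Dense ((fnY f).domain : Set Mode) := by
  rw [Submodule.dense_iff_topologicalClosure_eq_top, Submodule.topologicalClosure_eq_top_iff,
    Submodule.eq_bot_iff]
  intro w hw
  have h : ((0 : Mode), w) ∈ (fnY f).graph := by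
    refine mem_graph_fnY_of_adjoint hf fun a b hab => ?_
    rw [inner_zero_right, hw a (LinearPMap.mem_domain_of_mem_graph hab)]
  exact LinearPMap.graph_fst_eq_zero_snd _ h rfl

theorem isSelfAdjoint_fnY (hf : Measurable f) : IsSelfAdjoint (fnY f) := by
  refine LinearPMap.eq_of_eq_graph ?_
  change (LinearPMap.adjoint (fnY f)).graph = _
  rw [LinearPMap.adjoint_graph_eq_graph_adjoint (dense_domain_fnY hf)]
  ext ⟨ψ, w⟩
  rw [Submodule.mem_adjoint_iff]
  constructor
  · exact fun h => mem_graph_fnY_of_adjoint hf fun a b hab => sub_eq_zero.mp (h a b hab)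
  · exact fun h a b hab => sub_eq_zero.mpr (inner_graph_fnY hab h)

theorem isPosSelfAdjoint_fnY (hf : Measurable f) (h0 : ∀ y, 0 ≤ f y) :
    IsPosSelfAdjoint (fnY f) := by
  refine ⟨isSelfAdjoint_fnY hf, fun ψ => ?_⟩
  rw [inner_eq_integral_fourier]
  have hi := L2.integrable_inner (𝕜 := ℂ) (𝓕 (ψ : Mode) : Mode) (𝓕 (fnY f ψ) : Mode)
  have hre := integral_re hi
  simp only [RCLike.re_eq_complex_re] at hre
  rw [← hre]
  refine integral_nonneg_of_ae ?_
  filter_upwards [fourier_fnY_apply ψ] with ξ hξ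
  rw [hξ, RCLike.inner_apply, mul_assoc, Complex.mul_conj, ← Complex.ofReal_mul, Complex.ofReal_re]
  exact mul_nonneg (h0 _) (Complex.normSq_nonneg _)

theorem isPosSqrt_fnY (hf : Measurable f) (h0 : ∀ y, 0 ≤ f y) :
    IsPosSqrt (fnY fun y => √(f y)) (fnY f) := by
  have hs : Measurable fun y => √(f y) := hf.sqrt
  have hsq : ∀ y, ((√(f y) : ℝ) : ℂ) * ((√(f y) : ℝ) : ℂ) = f y := fun y => by
    rw [← Complex.ofReal_mul, Real.mul_self_sqrt (h0 y)]
  refine ⟨isPosSelfAdjoint_fnY hs fun _ => Real.sqrt_nonneg _, fun ψ φ => ?_⟩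
  simp only [mem_graph_fnY]
  constructor
  · intro h
    -- The bound `√f ≤ f + 1` places the domain of `f(Y)` inside that of its square root.
    have hm : MemLp (fun ξ : ℝ => ((√(f (Real.pi * ξ)) : ℝ) : ℂ) * (𝓕 ψ : Mode) ξ) 2 := by
      refine MemLp.of_le ((Lp.memLp (𝓕 φ : Mode)).norm.add (Lp.memLp (𝓕 ψ : Mode)).norm)
        (aestronglyMeasurable_fnY hs ψ) ?_
      filter_upwards [h] with ξ hξ
      have h1 : √(f (Real.pi * ξ)) ≤ f (Real.pi * ξ) + 1 := by
        rw [Real.sqrt_le_left (by linarith [h0 (Real.pi * ξ)])]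
        nlinarith [h0 (Real.pi * ξ)]
      rw [Pi.add_apply, hξ, norm_mul, norm_mul, Complex.norm_real, Complex.norm_real,
        Real.norm_of_nonneg (Real.sqrt_nonneg _), Real.norm_of_nonneg (h0 _),
        Real.norm_of_nonneg (by have := h0 (Real.pi * ξ); positivity)]
      nlinarith [norm_nonneg ((𝓕 ψ : Mode) ξ)]
    obtain ⟨χ, hχ⟩ := exists_fourier_ae_eq hm
    refine ⟨χ, hχ, ?_⟩
    filter_upwards [h, hχ] with ξ e1 e2
    rw [e1, e2, ← mul_assoc, hsq]
  · rintro ⟨χ, h1, h2⟩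
    filter_upwards [h1, h2] with ξ e1 e2
    rw [e2, e1, ← mul_assoc, hsq]

end FunctionalCalculus

theorem quadY_mem_graph (ψ : 𝓢(ℝ, ℂ)) :
    (ψ.toLp 2 volume, (quadY ψ).toLp 2 volume) ∈ (fnY id).graph := by
  rw [mem_graph_fnY, SchwartzMap.toLp_fourier_eq, SchwartzMap.toLp_fourier_eq]
  filter_upwards [(𝓕 ψ).coeFn_toLp 2, (𝓕 (quadY ψ)).coeFn_toLp 2] with ξ e1 e2
  rw [e1, e2, fourier_quadY]; rfl

/-! ### The half spaces -/

/-- The open half line where `s ξ > 0`. -/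
def halfLine (s : ℝ) : Set ℝ := {ξ | 0 < s * ξ}

theorem measurableSet_halfLine (s : ℝ) : MeasurableSet (halfLine s) :=
  measurableSet_lt measurable_const (measurable_const_mul s)

theorem ae_ne_zero : ∀ᵐ ξ : ℝ, ξ ≠ 0 := Measure.ae_ne volume 0

theorem mem_halfSpace_iff_indicator {s : ℝ} (hs : s ≠ 0) {ψ : Mode} :
    ψ ∈ halfSpace s ↔ (𝓕 ψ : Mode) =ᵐ[volume] (halfLine s).indicator (𝓕 ψ : Mode) := by
  rw [mem_halfSpace]
  constructor
  · intro h
    filter_upwards [h, ae_ne_zero] with ξ e1 e2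
    by_cases hξ : 0 < s * ξ
    · rw [Set.indicator_of_mem (by exact hξ)]
    · rw [Set.indicator_of_notMem (by exact hξ)]
      exact e1 (lt_of_le_of_ne (not_lt.mp hξ) (mul_ne_zero hs e2))
  · intro h
    filter_upwards [h] with ξ e1 hξ
    rw [e1]
    exact Set.indicator_of_notMem (show ξ ∉ halfLine s from fun h' => lt_asymm hξ h') _

theorem fourier_starProjection {s : ℝ} (hs : s ≠ 0) (ψ : Mode) :
    (𝓕 ((halfSpace s).starProjection ψ) : Mode) =ᵐ[volume] (halfLine s).indicator (𝓕 ψ : Mode) := by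
  obtain ⟨φ, hφ⟩ := exists_fourier_ae_eq
    ((Lp.memLp (𝓕 ψ : Mode)).indicator (measurableSet_halfLine s))
  have hmem : φ ∈ halfSpace s := by
    rw [mem_halfSpace_iff_indicator hs]
    filter_upwards [hφ] with ξ e
    by_cases hξ : ξ ∈ halfLine s
    · rw [Set.indicator_of_mem hξ]
    · rw [Set.indicator_of_notMem hξ, e, Set.indicator_of_notMem hξ]
  have : (halfSpace s).starProjection ψ = φ := by
    refine Submodule.eq_starProjection_of_mem_of_inner_eq_zero hmem fun u hu => ?_
    rw [mem_halfSpace_iff_indicator hs] at hu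
    rw [inner_eq_integral_fourier]
    refine integral_eq_zero_of_ae ?_
    filter_upwards [hu, hφ, fourier_sub_coe ψ φ] with ξ e1 e2 e3
    rw [e1, e3, e2]
    by_cases hξ : ξ ∈ halfLine s
    · rw [Set.indicator_of_mem hξ, Set.indicator_of_mem hξ]; simp
    · simp [hξ]
  rw [this]; exact hφ

theorem halfSpace_neg {s : ℝ} (hs : s ≠ 0) : halfSpace (-s) = (halfSpace s)ᗮ := by
  ext ψ
  rw [← Submodule.starProjection_apply_eq_zero_iff, mem_halfSpace]
  have h := fourier_starProjection hs ψ
  constructor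
  · intro h1
    refine fourier_inj ?_
    filter_upwards [h, h1, fourier_zero_coe] with ξ e1 e2 e3
    rw [e1, e3]
    by_cases hξ : ξ ∈ halfLine s
    · rw [Set.indicator_of_mem hξ, e2 (by have : 0 < s * ξ := hξ; linarith)]
    · rw [Set.indicator_of_notMem hξ]
  · intro h1
    rw [h1] at h
    filter_upwards [h, fourier_zero_coe] with ξ e1 e2 hξ
    rw [← e2, e1, Set.indicator_of_mem]
    change 0 < s * ξ
    linarith

/-- `θ` includes the point `0` and the half line does not, a null difference. Since the projection
is defined everywhere, containment of its graph already forces equality. -/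
theorem fnY_theta {s : ℝ} (hs : s ≠ 0) : fnY (fun y => theta (s * y)) =
    ((halfSpace s).starProjection.toLinearMap).toPMap ⊤ := by
  refine LinearPMap.eq_of_eq_graph ?_
  ext ⟨ψ, φ⟩
  have key : ∀ ψ : Mode, (ψ, (halfSpace s).starProjection ψ) ∈ (fnY fun y => theta (s * y)).graph := by
    intro ψ
    rw [mem_graph_fnY]
    filter_upwards [fourier_starProjection hs ψ, ae_ne_zero] with ξ e1 e2
    rw [e1]
    by_cases hξ : 0 < s * ξ
    · rw [Set.indicator_of_mem (by exact hξ), theta, if_pos (by nlinarith [Real.pi_pos])]; simp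
    · have h2 : s * ξ < 0 := lt_of_le_of_ne (not_lt.mp hξ) (mul_ne_zero hs e2)
      rw [Set.indicator_of_notMem (by exact hξ), theta, if_neg (by nlinarith [Real.pi_pos])]; simp
  constructor
  · intro h
    have := LinearPMap.mem_graph_snd_inj _ h (key ψ) rfl
    rw [LinearPMap.mem_graph_iff]
    exact ⟨⟨ψ, trivial⟩, rfl, this.symm⟩
  · intro h
    rw [LinearPMap.mem_graph_iff] at h
    obtain ⟨y, hy, h2⟩ := h
    have h3 : (halfSpace s).starProjection ψ = φ := by
      change (y : Mode) = ψ at hy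
      subst hy; exact h2
    rw [← h3]; exact key ψ

/-! ### The Duflo–Moore–Carey operators as multiplication operators. -/

theorem theta_nonneg (y : ℝ) : 0 ≤ theta y := by unfold theta; split_ifs <;> norm_num

theorem measurable_theta : Measurable theta :=
  Measurable.ite measurableSet_Ici measurable_const measurable_const

theorem measurable_dmcFun (s : ℝ) : Measurable fun y => Real.pi * theta (s * y) / |y| :=
  ((measurable_theta.comp (measurable_const_mul s)).const_mul _).div measurable_id.abs

theorem dmcFun_nonneg (s y : ℝ) : 0 ≤ Real.pi * theta (s * y) / |y| :=
  div_nonneg (mul_nonneg Real.pi_pos.le (theta_nonneg _)) (abs_nonneg _)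

theorem dmcFun_of_pos {s ξ : ℝ} (h : 0 < s * ξ) :
    Real.pi * theta (s * (Real.pi * ξ)) / |Real.pi * ξ| = |ξ|⁻¹ := by
  have : ξ ≠ 0 := by rintro rfl; simp at h
  rw [theta, if_pos (by nlinarith [Real.pi_pos]), abs_mul, abs_of_pos Real.pi_pos]
  have := abs_pos.mpr this
  field_simp

theorem dmcFun_of_neg {s ξ : ℝ} (h : s * ξ < 0) :
    Real.pi * theta (s * (Real.pi * ξ)) / |Real.pi * ξ| = 0 := by
  rw [theta, if_neg (by nlinarith [Real.pi_pos])]; simp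

/-- The change of variable `y = πξ` absorbs the factor `π`. The remaining weight `|ξ|⁻¹` is the
Jacobian of `lintegral_dilation_orbit`. -/
theorem energy_sqrtDmc {s : ℝ} (hs : s ≠ 0) (ψ : Mode) : energy (sqrtDmc s) ψ =
    ∫⁻ ξ in halfLine s, ENNReal.ofReal |ξ|⁻¹ * ‖(𝓕 ψ : Mode) ξ‖ₑ ^ 2 := by
  rw [sqrtDmc, energy_fnY (measurable_dmcFun s).sqrt,
    ← lintegral_indicator (measurableSet_halfLine s)]
  refine lintegral_congr_ae ?_
  filter_upwards [ae_ne_zero] with ξ e2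
  by_cases hξ : 0 < s * ξ
  · rw [Set.indicator_of_mem (by exact hξ), dmcFun_of_pos hξ, enorm_mul, mul_pow]
    congr 1
    rw [← ofReal_norm, Complex.norm_real, ← ENNReal.ofReal_pow (norm_nonneg _), Real.norm_eq_abs,
      sq_abs, Real.sq_sqrt (by positivity)]
  · have h2 : s * ξ < 0 := lt_of_le_of_ne (not_lt.mp hξ) (mul_ne_zero hs e2)
    rw [Set.indicator_of_notMem (by exact hξ), dmcFun_of_neg h2]; simp

theorem isPosSqrt_sqrtDmc (s : ℝ) : IsPosSqrt (sqrtDmc s) (dmc s) :=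
  isPosSqrt_fnY (measurable_dmcFun s) (dmcFun_nonneg s)

theorem isPosSelfAdjoint_dmc (s : ℝ) : IsPosSelfAdjoint (dmc s) :=
  isPosSelfAdjoint_fnY (measurable_dmcFun s) (dmcFun_nonneg s)

theorem dmc_supported {s : ℝ} (hs : s ≠ 0) {ψ : Mode} (hψ : ψ ∈ (halfSpace s)ᗮ) :
    (ψ, (0 : Mode)) ∈ (dmc s).graph := by
  rw [← halfSpace_neg hs, mem_halfSpace] at hψ
  rw [dmc, mem_graph_fnY]
  filter_upwards [hψ, ae_ne_zero, fourier_zero_coe] with ξ e1 e2 e3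
  rw [e3]
  by_cases hξ : 0 < s * ξ
  · rw [e1 (by linarith), mul_zero]
  · rw [dmcFun_of_neg (lt_of_le_of_ne (not_lt.mp hξ) (mul_ne_zero hs e2))]; simp

theorem lintegral_halfLine_fourier {s : ℝ} (hs : s ≠ 0) (ψ : Mode) :
    ∫⁻ ξ in halfLine s, ‖(𝓕 ψ : Mode) ξ‖ₑ ^ 2 = ‖(halfSpace s).starProjection ψ‖ₑ ^ 2 := by
  rw [enorm_sq_eq_lintegral_fourier, ← lintegral_indicator (measurableSet_halfLine s)]
  refine lintegral_congr_ae ?_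
  filter_upwards [fourier_starProjection hs ψ] with ξ e
  rw [e]
  by_cases hξ : ξ ∈ halfLine s
  · rw [Set.indicator_of_mem hξ, Set.indicator_of_mem hξ]
  · rw [Set.indicator_of_notMem hξ, Set.indicator_of_notMem hξ]; simp

theorem lintegral_eq_add_halfLine (F : ℝ → ℝ≥0∞) :
    ∫⁻ ξ, F ξ = (∫⁻ ξ in halfLine 1, F ξ) + ∫⁻ ξ in halfLine (-1), F ξ := by
  rw [← lintegral_add_compl F (measurableSet_halfLine 1)]
  congr 1
  refine setLIntegral_congr ?_
  filter_upwards [ae_ne_zero] with ξ h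
  refine propext ?_
  change ¬ (0 < 1 * ξ) ↔ 0 < -1 * ξ
  rcases lt_or_gt_of_ne h with h | h
  · exact ⟨fun _ => by linarith, fun _ => by linarith⟩
  · exact ⟨fun h' => absurd (by linarith) h', fun _ => by linarith⟩

/-! ### The Haar measure -/

theorem measurable_ofReal_exp_neg_snd :
    Measurable fun p : ℝ × ℝ => ENNReal.ofReal (Real.exp (-p.2)) := by fun_prop

theorem lintegral_leftHaar {F : AxB → ℝ≥0∞} (hF : Measurable F) :
    ∫⁻ g, F g ∂leftHaar = ∫⁻ r, ENNReal.ofReal (Real.exp (-r)) * ∫⁻ x, F (AxB.mk x r) := by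
  have hF' : Measurable (fun p : ℝ × ℝ => F (AxB.mk p.1 p.2)) := hF
  have h1 := lintegral_withDensity_eq_lintegral_mul (volume : Measure (ℝ × ℝ))
    measurable_ofReal_exp_neg_snd hF'
  refine h1.trans ?_
  rw [Measure.volume_eq_prod, lintegral_prod_symm' _ (measurable_ofReal_exp_neg_snd.mul hF')]
  refine lintegral_congr fun r => ?_
  have hm : Measurable fun x => F (AxB.mk x r) := hF'.comp (measurable_prodMk_right (y := r))
  exact lintegral_const_mul (ENNReal.ofReal (Real.exp (-r))) hm

theorem continuous_mul_left (g : AxB) : Continuous fun h => g * h := by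
  have h : Continuous fun p : ℝ × ℝ => (g.x + Real.exp g.r * p.1, g.r + p.2) := by fun_prop
  exact h

/-- Left translation by `g` stretches `x` by `e^{g.r}` and shifts `r` by `g.r`; the density `e^{-r}`
compensates the stretching exactly. -/
theorem isHaarMeasure_leftHaar : leftHaar.IsHaarMeasure := by
  have hinv : leftHaar.IsMulLeftInvariant := by
    refine ⟨fun g => ?_⟩
    have hm : Measurable fun h => g * h := (continuous_mul_left g).measurable
    refine Measure.ext_of_lintegral _ fun F hF => ?_
    have hFm : Measurable fun h => F (g * h) := hF.comp hm
    rw [lintegral_map hF hm, lintegral_leftHaar hFm, lintegral_leftHaar hF,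
      ← lintegral_add_left_eq_self (fun r => ENNReal.ofReal (Real.exp (-r)) *
        ∫⁻ x, F (AxB.mk x r)) g.r]
    refine lintegral_congr fun r => ?_
    have h1 : ∀ x, F (g * AxB.mk x r) = F (AxB.mk (g.x + Real.exp g.r * x) (g.r + r)) :=
      fun x => rfl
    simp only [h1]
    rw [lintegral_exp_mul g.r (fun y => F (AxB.mk (g.x + y) (g.r + r))),
      lintegral_add_left_eq_self (fun y => F (AxB.mk y (g.r + r))) g.x, ← mul_assoc,
      ← ENNReal.ofReal_mul (Real.exp_pos _).le, ← Real.exp_add]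
    congr 3; ring
  have hlf : IsLocallyFiniteMeasure leftHaar :=
    IsLocallyFiniteMeasure.withDensity_ofReal (μ := (volume : Measure (ℝ × ℝ)))
      (f := fun p => Real.exp (-p.2)) (by fun_prop)
  have hop : leftHaar.IsOpenPosMeasure := by
    -- The density is strictly positive, so Lebesgue measure is absolutely continuous with respect
    -- to the new measure, which therefore charges open sets.
    have hac : (volume : Measure (ℝ × ℝ)) ≪ (leftHaar : Measure (ℝ × ℝ)) :=
      withDensity_absolutelyContinuous' measurable_ofReal_exp_neg_snd.aemeasurable
        (.of_forall fun p => by simp [Real.exp_pos])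
    exact hac.isOpenPosMeasure
  exact { toIsFiniteMeasureOnCompacts := inferInstance
          toIsMulLeftInvariant := hinv
          toIsOpenPosMeasure := hop }

/-! ### Matrix elements are square integrable -/

theorem inner_affRep_eq_fourier (χ ψ : Mode) (x r : ℝ) :
    ⟪χ, affRep (AxB.mk x r) ψ⟫_ℂ = 𝓕 (fun ξ => ⟪(𝓕 χ : Mode) ξ,
      momentumFun (AxB.mk 0 r) (𝓕 ψ : Mode) ξ⟫_ℂ) x := by
  rw [inner_eq_integral_fourier, Real.fourier_real_eq_integral_exp_smul]
  refine integral_congr_ae ?_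
  filter_upwards [fourier_affRep_coe (AxB.mk x r) ψ] with ξ e
  simp only [e, momentumFun, RCLike.inner_apply, AxB.mk_x, AxB.mk_r, phase_zero, smul_eq_mul]
  rw [phase]
  ring

/-- Plancherel in `x`. The function being transformed is a product of two `L²` functions, integrable
but perhaps not square integrable, so the `[0, ∞]` form of Plancherel is needed. -/
theorem lintegral_inner_affRep_translation (χ ψ : Mode) (r : ℝ) :
    ∫⁻ x, ‖⟪χ, affRep (AxB.mk x r) ψ⟫_ℂ‖ₑ ^ 2 = ENNReal.ofReal (Real.exp r) *
      ∫⁻ ξ, ‖(𝓕 χ : Mode) ξ‖ₑ ^ 2 * ‖(𝓕 ψ : Mode) (Real.exp r * ξ)‖ₑ ^ 2 := by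
  have hi : Integrable (fun ξ => ⟪(𝓕 χ : Mode) ξ,
      momentumFun (AxB.mk 0 r) (𝓕 ψ : Mode) ξ⟫_ℂ) := by
    refine (L2.integrable_inner (𝕜 := ℂ) (𝓕 χ : Mode)
      (momentumRep (AxB.mk 0 r) (𝓕 ψ))).congr ?_
    filter_upwards [momentumRep_coe (AxB.mk 0 r) (𝓕 ψ)] with ξ e
    rw [e]
  simp only [inner_affRep_eq_fourier]
  rw [lintegral_enorm_sq_fourier hi, ← lintegral_const_mul' _ _ ENNReal.ofReal_ne_top]
  refine lintegral_congr fun ξ => ?_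
  rw [RCLike.inner_apply, enorm_mul, mul_pow, enorm_sq_momentumFun, RCLike.enorm_conj, AxB.mk_r]
  ring

theorem measurable_fourier (ψ : Mode) : Measurable ((𝓕 ψ : Mode) : ℝ → ℂ) :=
  (Lp.stronglyMeasurable _).measurable

theorem continuous_inner_affRep (χ ψ : Mode) : Continuous fun g => ⟪χ, affRep g ψ⟫_ℂ :=
  continuous_const.inner (continuous_affRep ψ)

/-- The factor `e^r` from the unitary dilation cancels the Haar density `e^{-r}`, and Tonelli
exchanges `r` and `ξ`. The weight is `1` for the orthogonality relations and `e^r` for operators of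
finite trace. -/
theorem lintegral_weight_inner_affRep (χ ψ : Mode) {w : ℝ → ℝ≥0∞} (hw : Measurable w) :
    ∫⁻ g, w g.r * ‖⟪χ, affRep g ψ⟫_ℂ‖ₑ ^ 2 ∂leftHaar =
      ∫⁻ ξ, ‖(𝓕 χ : Mode) ξ‖ₑ ^ 2 * ∫⁻ r, w r * ‖(𝓕 ψ : Mode) (Real.exp r * ξ)‖ₑ ^ 2 := by
  have hm : ∀ r, Measurable fun ξ => ‖(𝓕 χ : Mode) ξ‖ₑ ^ 2 *
      ‖(𝓕 ψ : Mode) (Real.exp r * ξ)‖ₑ ^ 2 := fun r =>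
    ((measurable_fourier χ).enorm.pow_const 2).mul
      (((measurable_fourier ψ).comp (measurable_const_mul _)).enorm.pow_const 2)
  have hm2 : ∀ ξ, Measurable fun r => w r * ‖(𝓕 ψ : Mode) (Real.exp r * ξ)‖ₑ ^ 2 := fun ξ =>
    hw.mul (((measurable_fourier ψ).comp (by fun_prop)).enorm.pow_const 2)
  have hF : Measurable fun g : AxB => w g.r * ‖⟪χ, affRep g ψ⟫_ℂ‖ₑ ^ 2 :=
    (hw.comp continuous_r.measurable).mul
      ((continuous_inner_affRep χ ψ).measurable.enorm.pow_const 2)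
  rw [lintegral_leftHaar hF]
  have h1 : ∀ r, ENNReal.ofReal (Real.exp (-r)) *
      ∫⁻ x, w (AxB.mk x r).r * ‖⟪χ, affRep (AxB.mk x r) ψ⟫_ℂ‖ₑ ^ 2 =
      ∫⁻ ξ, w r * (‖(𝓕 χ : Mode) ξ‖ₑ ^ 2 * ‖(𝓕 ψ : Mode) (Real.exp r * ξ)‖ₑ ^ 2) := by
    intro r
    simp only [AxB.mk_r]
    have hc : Measurable fun x => ‖⟪χ, affRep (AxB.mk x r) ψ⟫_ℂ‖ₑ ^ 2 := by
      have : Measurable fun x : ℝ => AxB.mk x r := measurable_prodMk_right (y := r)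
      exact (((continuous_inner_affRep χ ψ).measurable.comp this).enorm.pow_const 2)
    rw [lintegral_const_mul _ hc, lintegral_const_mul _ (hm r),
      lintegral_inner_affRep_translation, mul_left_comm, ← mul_assoc (ENNReal.ofReal _),
      ← ENNReal.ofReal_mul (Real.exp_pos _).le, ← Real.exp_add]
    simp
  simp only [h1]
  rw [lintegral_lintegral_swap]
  · refine lintegral_congr fun ξ => ?_
    rw [← lintegral_const_mul _ (hm2 ξ)]
    exact lintegral_congr fun r => by ring
  · refine Measurable.aemeasurable ?_
    refine (hw.comp measurable_fst).mul
      ((((measurable_fourier χ).comp measurable_snd).enorm.pow_const 2).mul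
      (((measurable_fourier ψ).comp ?_).enorm.pow_const 2))
    fun_prop

theorem lintegral_halfLine_mul_orbit {s : ℝ} (hs : s ≠ 0) (χ ψ : Mode) :
    ∫⁻ ξ in halfLine s, ‖(𝓕 χ : Mode) ξ‖ₑ ^ 2 *
      ∫⁻ r, ‖(𝓕 ψ : Mode) (Real.exp r * ξ)‖ₑ ^ 2 =
      ‖(halfSpace s).starProjection χ‖ₑ ^ 2 * energy (sqrtDmc s) ψ := by
  rw [← lintegral_halfLine_fourier hs, energy_sqrtDmc hs,
    ← lintegral_mul_const _ ((measurable_fourier χ).enorm.pow_const 2)]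
  refine setLIntegral_congr_fun (measurableSet_halfLine s) fun ξ hξ => ?_
  rw [lintegral_dilation_orbit hξ fun η => ‖(𝓕 ψ : Mode) η‖ₑ ^ 2]
  rfl

/-- The squared `L²(G)` norm of a matrix element. -/
theorem lintegral_inner_affRep (χ ψ : Mode) :
    ∫⁻ g, ‖⟪χ, affRep g ψ⟫_ℂ‖ₑ ^ 2 ∂leftHaar =
      ‖(halfSpace 1).starProjection χ‖ₑ ^ 2 * energy (sqrtDmc 1) ψ +
        ‖(halfSpace (-1)).starProjection χ‖ₑ ^ 2 * energy (sqrtDmc (-1)) ψ := by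
  have h := lintegral_weight_inner_affRep χ ψ (w := fun _ => 1) measurable_const
  simp only [one_mul] at h
  rw [h, lintegral_eq_add_halfLine, lintegral_halfLine_mul_orbit one_ne_zero,
    lintegral_halfLine_mul_orbit (by norm_num)]

/-- Here `|ξ| e^r = |η|` cancels the orbit weight `|η|⁻¹`, so a plain norm of `ψ` appears where
`lintegral_halfLine_mul_orbit` has an energy. -/
theorem lintegral_halfLine_mul_orbit_exp {s : ℝ} (hs : s ≠ 0) {χ φ : Mode} (ψ : Mode)
    (h : ∀ᵐ ξ, ‖(𝓕 χ : Mode) ξ‖ₑ ^ 2 = ENNReal.ofReal |ξ| * ‖(𝓕 φ : Mode) ξ‖ₑ ^ 2) :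
    ∫⁻ ξ in halfLine s, ‖(𝓕 χ : Mode) ξ‖ₑ ^ 2 *
      ∫⁻ r, ENNReal.ofReal (Real.exp r) * ‖(𝓕 ψ : Mode) (Real.exp r * ξ)‖ₑ ^ 2 =
      ‖(halfSpace s).starProjection φ‖ₑ ^ 2 * ‖(halfSpace s).starProjection ψ‖ₑ ^ 2 := by
  rw [← lintegral_halfLine_fourier hs φ, ← lintegral_halfLine_fourier hs ψ,
    ← lintegral_mul_const _ ((measurable_fourier φ).enorm.pow_const 2)]
  refine setLIntegral_congr_fun_ae (measurableSet_halfLine s) ?_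
  filter_upwards [h, ae_ne_zero] with ξ e h0 hξ
  have hξ0 : 0 < |ξ| := abs_pos.mpr h0
  rw [e, mul_comm (ENNReal.ofReal |ξ|), mul_assoc,
    ← lintegral_const_mul' _ _ ENNReal.ofReal_ne_top]
  congr 1
  have h2 : ∀ r, ENNReal.ofReal |ξ| * (ENNReal.ofReal (Real.exp r) *
      ‖(𝓕 ψ : Mode) (Real.exp r * ξ)‖ₑ ^ 2) =
      ENNReal.ofReal |Real.exp r * ξ| * ‖(𝓕 ψ : Mode) (Real.exp r * ξ)‖ₑ ^ 2 := by
    intro r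
    rw [abs_mul, abs_of_pos (Real.exp_pos r), mul_comm (Real.exp r) |ξ|,
      ENNReal.ofReal_mul (abs_nonneg _), mul_assoc]
  simp only [h2]
  rw [lintegral_dilation_orbit hξ fun η => ENNReal.ofReal |η| * ‖(𝓕 ψ : Mode) η‖ₑ ^ 2]
  refine setLIntegral_congr_fun (measurableSet_halfLine s) fun η hη => ?_
  have hη0 : 0 < |η| := abs_pos.mpr (by rintro rfl; simp at hη)
  rw [← mul_assoc, ← ENNReal.ofReal_mul (by positivity), inv_mul_cancel₀ hη0.ne']
  simp

theorem lintegral_exp_inner_affRep {χ φ : Mode} (ψ : Mode)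
    (h : ∀ᵐ ξ, ‖(𝓕 χ : Mode) ξ‖ₑ ^ 2 = ENNReal.ofReal |ξ| * ‖(𝓕 φ : Mode) ξ‖ₑ ^ 2) :
    ∫⁻ g, ENNReal.ofReal (Real.exp g.r) * ‖⟪χ, affRep g ψ⟫_ℂ‖ₑ ^ 2 ∂leftHaar =
      ‖(halfSpace 1).starProjection φ‖ₑ ^ 2 * ‖(halfSpace 1).starProjection ψ‖ₑ ^ 2 +
        ‖(halfSpace (-1)).starProjection φ‖ₑ ^ 2 * ‖(halfSpace (-1)).starProjection ψ‖ₑ ^ 2 := by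
  rw [lintegral_weight_inner_affRep χ ψ (w := fun r => ENNReal.ofReal (Real.exp r)) (by fun_prop),
    lintegral_eq_add_halfLine, lintegral_halfLine_mul_orbit_exp one_ne_zero ψ h,
    lintegral_halfLine_mul_orbit_exp (by norm_num) ψ h]

/-! ### Polarization -/

section Polarization

variable {V W L E E' : Type*} [AddCommGroup V] [Module ℂ V] [AddCommGroup W] [Module ℂ W]
  [NormedAddCommGroup L] [InnerProductSpace ℂ L] [NormedAddCommGroup E] [InnerProductSpace ℂ E]
  [NormedAddCommGroup E'] [InnerProductSpace ℂ E']

theorem sesquilinear_eq_zero {B : V →ₗ⋆[ℂ] V →ₗ[ℂ] ℂ} (h : ∀ v, B v v = 0) (v w : V) :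
    B v w = 0 := by
  have h1 := h (v + w)
  have h2 := h (v + Complex.I • w)
  simp only [map_add, LinearMap.add_apply, map_smul, LinearMap.map_smulₛₗ, LinearMap.smul_apply,
    h, smul_eq_mul, Complex.conj_I, mul_zero, add_zero, zero_add] at h1 h2
  have h3 : Complex.I * (B v w) = 0 := by linear_combination (Complex.I / 2) * h1 + h2 / 2
  exact (mul_eq_zero.mp h3).resolve_left Complex.I_ne_zero

/-- Polarization in two stages: first in `v, v'` with a single `w`, then in `w, w'`. Each time the
difference of the two sides is a sesquilinear form that vanishes on the diagonal. -/
theorem inner_eq_sum_of_norm_sq_eq {κ : Type*} [Fintype κ] (T : V →ₗ⋆[ℂ] W →ₗ[ℂ] L)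
    (p : κ → V →ₗ[ℂ] E) (q : κ → W →ₗ[ℂ] E')
    (h : ∀ v w, ‖T v w‖ ^ 2 = ∑ k, ‖p k v‖ ^ 2 * ‖q k w‖ ^ 2) (v v' : V) (w w' : W) :
    ⟪T v' w', T v w⟫_ℂ = ∑ k, ⟪p k v, p k v'⟫_ℂ * ⟪q k w', q k w⟫_ℂ := by
  have h1 : ∀ (w : W) (v v' : V),
      ⟪T v' w, T v w⟫_ℂ = ∑ k, ⟪p k v, p k v'⟫_ℂ * ⟪q k w, q k w⟫_ℂ := by
    intro w v v'
    let B : V →ₗ⋆[ℂ] V →ₗ[ℂ] ℂ := LinearMap.mk₂'ₛₗ (starRingEnd ℂ) (RingHom.id ℂ)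
      (fun v v' => ⟪T v' w, T v w⟫_ℂ - ∑ k, ⟪p k v, p k v'⟫_ℂ * ⟪q k w, q k w⟫_ℂ)
      (fun a b c => by
        simp only [map_add, LinearMap.add_apply, inner_add_right, inner_add_left, add_mul,
          Finset.sum_add_distrib]; ring)
      (fun c a b => by
        simp only [LinearMap.map_smulₛₗ, LinearMap.smul_apply, inner_smul_right, inner_smul_left,
          mul_assoc, ← Finset.mul_sum, smul_eq_mul, RingHom.id_apply]; ring)
      (fun a b c => by
        simp only [map_add, LinearMap.add_apply, inner_add_right, inner_add_left, add_mul,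
          Finset.sum_add_distrib]; ring)
      (fun c a b => by
        simp only [LinearMap.map_smulₛₗ, LinearMap.smul_apply, inner_smul_right, inner_smul_left,
          mul_assoc, ← Finset.mul_sum, smul_eq_mul, RingHom.id_apply, Complex.conj_conj]; ring)
    refine sub_eq_zero.mp (sesquilinear_eq_zero (B := B) (fun v => ?_) v v')
    change ⟪T v w, T v w⟫_ℂ - ∑ k, ⟪p k v, p k v⟫_ℂ * ⟪q k w, q k w⟫_ℂ = 0
    simp only [inner_self_eq_norm_sq_to_K]
    rw [sub_eq_zero]
    exact_mod_cast h v w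
  let B : W →ₗ⋆[ℂ] W →ₗ[ℂ] ℂ := LinearMap.mk₂'ₛₗ (starRingEnd ℂ) (RingHom.id ℂ)
    (fun w' w => ⟪T v' w', T v w⟫_ℂ - ∑ k, ⟪p k v, p k v'⟫_ℂ * ⟪q k w', q k w⟫_ℂ)
    (fun a b c => by
      simp only [map_add, inner_add_left, mul_add, Finset.sum_add_distrib]; ring)
    (fun c a b => by
      simp only [map_smul, inner_smul_left, mul_left_comm _ (starRingEnd ℂ c), ← Finset.mul_sum,
        smul_eq_mul]; ring)
    (fun a b c => by
      simp only [map_add, inner_add_right, mul_add, Finset.sum_add_distrib]; ring)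
    (fun c a b => by
      simp only [map_smul, inner_smul_right, mul_left_comm _ c, ← Finset.mul_sum,
        smul_eq_mul, RingHom.id_apply]; ring)
  exact sub_eq_zero.mp
    (sesquilinear_eq_zero (B := B) (fun w => sub_eq_zero.mpr (h1 w v v')) w' w)

/-- The norm identity makes every `F v w` square integrable, so `F` is a sesquilinear map into
`L²(μ)` and its inner products can be polarized. -/
theorem integral_eq_sum_of_lintegral_eq {G : Type*} [MeasurableSpace G] {μ : Measure G}
    {κ : Type*} [Fintype κ] (F : V →ₗ⋆[ℂ] W →ₗ[ℂ] (G → ℂ))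
    (p : κ → V →ₗ[ℂ] E) (q : κ → W →ₗ[ℂ] E') (hm : ∀ v w, AEStronglyMeasurable (F v w) μ)
    (h : ∀ v w, ∫⁻ g, ‖F v w g‖ₑ ^ 2 ∂μ = ∑ k, ‖p k v‖ₑ ^ 2 * ‖q k w‖ₑ ^ 2)
    (v v' : V) (w w' : W) :
    Integrable (fun g => F v w g * starRingEnd ℂ (F v' w' g)) μ ∧
      ∫ g, F v w g * starRingEnd ℂ (F v' w' g) ∂μ =
        ∑ k, ⟪p k v, p k v'⟫_ℂ * ⟪q k w', q k w⟫_ℂ := by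
  have hL : ∀ v w, MemLp (F v w) 2 μ := fun v w => by
    rw [MemLp, and_iff_right (hm v w), eLpNorm_lt_top_iff_lintegral_rpow_enorm_lt_top
      (by norm_num) (by norm_num)]
    simp only [ENNReal.toReal_ofNat, ENNReal.rpow_ofNat, h]
    exact ENNReal.sum_lt_top.mpr fun k _ =>
      ENNReal.mul_lt_top (ENNReal.pow_lt_top enorm_lt_top) (ENNReal.pow_lt_top enorm_lt_top)
  let T : V →ₗ⋆[ℂ] W →ₗ[ℂ] Lp ℂ 2 μ := LinearMap.mk₂'ₛₗ (starRingEnd ℂ) (RingHom.id ℂ)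
    (fun v w => (hL v w).toLp (F v w))
    (fun a b c => by
      rw [← MemLp.toLp_add]; exact MemLp.toLp_congr _ _ (.of_forall fun g => by simp))
    (fun c a b => by
      rw [← MemLp.toLp_const_smul]; exact MemLp.toLp_congr _ _ (.of_forall fun g => by simp))
    (fun a b c => by
      rw [← MemLp.toLp_add]; exact MemLp.toLp_congr _ _ (.of_forall fun g => by simp))
    (fun c a b => by
      rw [← MemLp.toLp_const_smul]; exact MemLp.toLp_congr _ _ (.of_forall fun g => by simp))
  have hT : ∀ v w, (T v w : G → ℂ) =ᵐ[μ] F v w := fun v w => (hL v w).coeFn_toLp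
  have hN : ∀ v w, ‖T v w‖ ^ 2 = ∑ k, ‖p k v‖ ^ 2 * ‖q k w‖ ^ 2 := by
    intro v w
    have h1 : ‖T v w‖ₑ ^ 2 = ∑ k, ‖p k v‖ₑ ^ 2 * ‖q k w‖ₑ ^ 2 := by
      rw [← h, Lp.enorm_def, eLpNorm_eq_lintegral_rpow_enorm_toReal (by norm_num) (by norm_num)]
      simp only [ENNReal.toReal_ofNat, ENNReal.rpow_ofNat]
      rw [← ENNReal.rpow_natCast, ← ENNReal.rpow_mul]
      norm_num
      exact lintegral_congr_ae (by filter_upwards [hT v w] with g hg; rw [hg])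
    have h2 := congrArg ENNReal.toReal h1
    rw [ENNReal.toReal_sum fun k _ => ENNReal.mul_ne_top (ENNReal.pow_ne_top enorm_ne_top)
      (ENNReal.pow_ne_top enorm_ne_top)] at h2
    simpa using h2
  have hin : ∀ g, F v w g * starRingEnd ℂ (F v' w' g) = ⟪F v' w' g, F v w g⟫_ℂ := fun g => by
    rw [RCLike.inner_apply]
  have hae : (fun g => ⟪(T v' w' : G → ℂ) g, (T v w : G → ℂ) g⟫_ℂ) =ᵐ[μ]
      fun g => F v w g * starRingEnd ℂ (F v' w' g) := by
    filter_upwards [hT v w, hT v' w'] with g h1 h2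
    rw [h1, h2, hin]
  refine ⟨(L2.integrable_inner (𝕜 := ℂ) (T v' w') (T v w)).congr hae, ?_⟩
  rw [← integral_congr_ae hae, ← inner_eq_sum_of_norm_sq_eq T p q hN, L2.inner_def]

end Polarization

/-! ### Hilbert bases -/

section Basis

variable {H : Type*} [NormedAddCommGroup H] [InnerProductSpace ℂ H]

theorem countable_of_hilbertBasis [TopologicalSpace.SeparableSpace H] {ι : Type*}
    (b : HilbertBasis ι ℂ H) : Countable ι := by
  -- Distinct basis vectors are at distance `√2 > 1`, so the balls of radius `1/2` around them are
  -- disjoint.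
  refine Pairwise.countable_of_isOpen_disjoint (s := fun i => Metric.ball (b i) (1 / 2))
    (fun i j hij => Metric.ball_disjoint_ball ?_) (fun i => Metric.isOpen_ball)
    fun i => ⟨b i, Metric.mem_ball_self (by norm_num)⟩
  have h := norm_sub_sq (𝕜 := ℂ) (b i) (b j)
  rw [b.orthonormal.2 hij, b.orthonormal.1, b.orthonormal.1] at h
  norm_num at h
  rw [dist_eq_norm]
  nlinarith [norm_nonneg (b i - b j)]

theorem hasSum_norm_inner_sq {ι : Type*} (b : HilbertBasis ι ℂ H) (x : H) :
    HasSum (fun i => ‖⟪b i, x⟫_ℂ‖ ^ 2) (‖x‖ ^ 2) := by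
  have h := Complex.hasSum_re (b.hasSum_inner_mul_inner x x)
  have e : (⟪x, x⟫_ℂ).re = ‖x‖ ^ 2 := inner_self_eq_norm_sq (𝕜 := ℂ) x
  rw [e] at h
  refine h.congr_fun fun i => ?_
  rw [← inner_conj_symm x (b i), mul_comm, Complex.mul_conj, Complex.ofReal_re,
    Complex.normSq_eq_norm_sq]

theorem tsum_enorm_inner_sq {ι : Type*} (b : HilbertBasis ι ℂ H) (x : H) :
    ∑' i, ‖⟪b i, x⟫_ℂ‖ₑ ^ 2 = ‖x‖ₑ ^ 2 := by
  have h := hasSum_norm_inner_sq b x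
  rw [← ofReal_norm x, ← ENNReal.ofReal_pow (norm_nonneg _), ← h.tsum_eq,
    ENNReal.ofReal_tsum_of_nonneg (fun _ => by positivity) h.summable]
  refine tsum_congr fun i => ?_
  rw [ENNReal.ofReal_pow (norm_nonneg _), ofReal_norm]

end Basis

/-! ### The irreducible subrepresentations -/

theorem enorm_pos_iff_ne_zero {φ : Mode} : ‖φ‖ₑ ^ 2 ≠ 0 ↔ φ ≠ 0 := by
  rw [ne_eq, pow_eq_zero_iff two_ne_zero, enorm_eq_zero]

theorem mem_domain_iff_energy_lt_top {H : Type*} [NormedAddCommGroup H] [InnerProductSpace ℂ H]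
    {C : H →ₗ.[ℂ] H} {ψ : H} : ψ ∈ C.domain ↔ energy C ψ < ∞ := by
  unfold energy
  split_ifs with h
  · exact iff_of_true h (ENNReal.pow_lt_top enorm_lt_top)
  · exact iff_of_false h (lt_irrefl _)

theorem energy_apply {H : Type*} [NormedAddCommGroup H] [InnerProductSpace ℂ H]
    {C : H →ₗ.[ℂ] H} (ψ : C.domain) : energy C ψ = ‖C ψ‖ₑ ^ 2 := by
  unfold energy
  rw [dif_pos ψ.2]

theorem starProjection_halfSpace_neg {s : ℝ} (hs : s ≠ 0) {ψ : Mode} (h : ψ ∈ halfSpace s) :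
    (halfSpace (-s)).starProjection ψ = 0 := by
  rw [Submodule.starProjection_apply_eq_zero_iff, ← halfSpace_neg (neg_ne_zero.mpr hs), neg_neg]
  exact h

theorem ne_zero_of_sign {s : ℝ} (hs : s = 1 ∨ s = -1) : s ≠ 0 := by
  rcases hs with rfl | rfl <;> norm_num

theorem lintegral_inner_affRep_of_mem {s : ℝ} (hs : s = 1 ∨ s = -1) {χ : Mode}
    (hχ : χ ∈ halfSpace s) (ψ : Mode) :
    ∫⁻ g, ‖⟪χ, affRep g ψ⟫_ℂ‖ₑ ^ 2 ∂leftHaar = ‖χ‖ₑ ^ 2 * energy (sqrtDmc s) ψ := by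
  have h1 := starProjection_halfSpace_neg (ne_zero_of_sign hs) hχ
  have h2 := Submodule.starProjection_eq_self_iff.mpr hχ
  rw [lintegral_inner_affRep]
  rcases hs with rfl | rfl
  · rw [h1, h2]; simp
  · rw [neg_neg] at h1
    rw [h1, h2]; simp

theorem energy_sqrtDmc_eq_zero {s : ℝ} (hs : s ≠ 0) {ψ : Mode} (hψ : ψ ∈ halfSpace s)
    (h : energy (sqrtDmc s) ψ = 0) : ψ = 0 := by
  have hm : Measurable fun ξ : ℝ => ENNReal.ofReal |ξ|⁻¹ * ‖(𝓕 ψ : Mode) ξ‖ₑ ^ 2 :=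
    (by fun_prop : Measurable fun ξ : ℝ => ENNReal.ofReal |ξ|⁻¹).mul
      ((measurable_fourier ψ).enorm.pow_const 2)
  rw [energy_sqrtDmc hs, lintegral_eq_zero_iff hm,
    Filter.EventuallyEq, ae_restrict_iff' (measurableSet_halfLine s)] at h
  rw [mem_halfSpace_iff_indicator hs] at hψ
  refine fourier_inj ?_
  filter_upwards [h, hψ, fourier_zero_coe, ae_ne_zero] with ξ e1 e2 e3 e4
  rw [e3]
  by_cases hξ : ξ ∈ halfLine s
  · have h5 := e1 hξ
    simpa [e4] using h5
  · rw [e2, Set.indicator_of_notMem hξ]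

theorem affRep_mem_halfSpace {s : ℝ} (g : AxB) {ψ : Mode} (h : ψ ∈ halfSpace s) :
    affRep g ψ ∈ halfSpace s := by
  rw [mem_halfSpace] at h ⊢
  filter_upwards [fourier_affRep_coe g ψ, (quasiMeasurePreserving_exp_mul g.r).ae h]
    with ξ e1 e2 hξ
  rw [e1, momentumFun, e2, mul_zero]
  have := mul_neg_of_pos_of_neg (Real.exp_pos g.r) hξ
  linarith

theorem exists_admissible {s : ℝ} (hs : s = 1 ∨ s = -1) :
    ∃ ψ ∈ halfSpace s, ψ ≠ 0 ∧ energy (sqrtDmc s) ψ < ∞ := by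
  have hs0 := ne_zero_of_sign hs
  -- The transform of the vector is the indicator of `[1, 2]` or `[-2, -1]`, where the weight
  -- `|ξ|⁻¹` is at most `1`.
  obtain ⟨c, hc, hvol⟩ : ∃ c : ℝ, (∀ ξ ∈ Set.Icc c (c + 1), 1 ≤ s * ξ ∧ 1 ≤ |ξ|) ∧
      volume (Set.Icc c (c + 1)) = 1 := by
    rcases hs with rfl | rfl
    · exact ⟨1, fun ξ hξ => ⟨by linarith [hξ.1], hξ.1.trans (le_abs_self _)⟩, by simp⟩
    · exact ⟨-2, fun ξ hξ => ⟨by linarith [hξ.2],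
        le_trans (by linarith [hξ.2]) (neg_le_abs ξ)⟩, by simp⟩
  have hm : MemLp ((Set.Icc c (c + 1)).indicator fun _ => (1 : ℂ)) 2 volume :=
    memLp_indicator_const 2 measurableSet_Icc 1 (Or.inr (by rw [hvol]; exact ENNReal.one_ne_top))
  obtain ⟨ψ, hψ⟩ := exists_fourier_ae_eq hm
  refine ⟨ψ, ?_, ?_, ?_⟩
  · rw [mem_halfSpace]
    filter_upwards [hψ] with ξ e hξ
    rw [e, Set.indicator_of_notMem]
    exact fun h => by linarith [(hc ξ h).1]
  · rintro rfl
    have h0 : ∀ᵐ ξ : ℝ, ξ ∉ Set.Icc c (c + 1) := by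
      filter_upwards [hψ, fourier_zero_coe] with ξ e1 e2 h
      rw [e2, Set.indicator_of_mem h] at e1
      exact zero_ne_one e1
    have h1 := measure_eq_zero_iff_ae_notMem.mpr h0
    rw [hvol] at h1
    exact one_ne_zero h1
  · rw [energy_sqrtDmc hs0]
    refine lt_of_le_of_lt (lintegral_mono_ae ?_ |>.trans (setLIntegral_le_lintegral _ _))
      (show ∫⁻ ξ, ‖(𝓕 ψ : Mode) ξ‖ₑ ^ 2 < ∞ by
        rw [← enorm_sq_eq_lintegral_fourier]; exact ENNReal.pow_lt_top enorm_lt_top)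
    filter_upwards [ae_restrict_of_ae hψ] with ξ e
    rw [e]
    by_cases h : ξ ∈ Set.Icc c (c + 1)
    · have h1 : ENNReal.ofReal |ξ|⁻¹ ≤ 1 :=
        ENNReal.ofReal_le_one.mpr (inv_le_one_of_one_le₀ (hc ξ h).2)
      exact mul_le_of_le_one_left zero_le h1
    · rw [Set.indicator_of_notMem h]; simp

theorem isAdmissible_iff {s : ℝ} (hs : s = 1 ∨ s = -1) {ψ : Mode} (hψ : ψ ∈ halfSpace s) :
    ψ ∈ (sqrtDmc s).domain ↔ IsAdmissible affRep leftHaar ψ := by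
  rw [IsAdmissible, lintegral_inner_affRep_of_mem hs hψ, mem_domain_iff_energy_lt_top]
  constructor
  · exact fun h => ENNReal.mul_lt_top (ENNReal.pow_lt_top enorm_lt_top) h
  · intro h
    -- Finiteness of `‖ψ‖²` times the energy bounds the energy only when `ψ ≠ 0`.
    rcases eq_or_ne ψ 0 with rfl | h0
    · exact mem_domain_iff_energy_lt_top.mp (sqrtDmc s).domain.zero_mem
    · exact ENNReal.lt_top_of_mul_ne_top_right h.ne (enorm_pos_iff_ne_zero.mpr h0)

theorem isSquareSummable_halfSpace {s : ℝ} (hs : s = 1 ∨ s = -1) :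
    IsSquareSummable affRep leftHaar (halfSpace s) := by
  obtain ⟨ψ, h1, h2, h3⟩ := exists_admissible hs
  exact ⟨ψ, h1, h2, (isAdmissible_iff hs h1).mp (mem_domain_iff_energy_lt_top.mpr h3)⟩

theorem isIrrep_halfSpace {s : ℝ} (hs : s = 1 ∨ s = -1) : IsIrrep affRep (halfSpace s) where
  isClosed := isClosed_halfSpace s
  ne_bot := by
    obtain ⟨ψ, h1, h2, -⟩ := exists_admissible hs
    exact fun h => h2 (by rw [h] at h1; exact h1)
  invariant := fun g _ h => affRep_mem_halfSpace g h
  irreducible := by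
    intro L hL hLs hinv
    by_cases hb : L = ⊥
    · exact Or.inl hb
    right
    obtain ⟨ψ, hψL, hψ⟩ := L.ne_bot_iff.mp hb
    have : CompleteSpace L := hL.completeSpace_coe
    refine le_antisymm hLs fun φ hφ => ?_
    -- The component of `φ` orthogonal to `L` is orthogonal to the whole orbit of `ψ`. The
    -- integrated matrix element is then `0`, so either this component or the energy of `ψ`
    -- vanishes.
    have hmem : φ - L.starProjection φ ∈ halfSpace s :=
      Submodule.sub_mem _ hφ (hLs (Submodule.starProjection_apply_mem L φ))
    have h0 : ∀ g, ⟪φ - L.starProjection φ, affRep g ψ⟫_ℂ = 0 := fun g =>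
      Submodule.starProjection_inner_eq_zero φ _ (hinv g ψ hψL)
    have h1 := lintegral_inner_affRep_of_mem hs hmem ψ
    simp only [h0, enorm_zero, ne_eq, OfNat.ofNat_ne_zero, not_false_eq_true, zero_pow,
      lintegral_zero] at h1
    rcases mul_eq_zero.mp h1.symm with h2 | h2
    · have h3 : φ - L.starProjection φ = 0 := by
        by_contra h
        exact enorm_pos_iff_ne_zero.mpr h h2
      rw [sub_eq_zero.mp h3]
      exact Submodule.starProjection_apply_mem L φ
    · exact absurd (energy_sqrtDmc_eq_zero (ne_zero_of_sign hs) (hLs hψL) h2) hψ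

theorem energy_sqrtDmc_add {s : ℝ} (hs : s ≠ 0) (ψ : Mode) {χ : Mode}
    (hχ : χ ∈ halfSpace (-s)) : energy (sqrtDmc s) (ψ + χ) = energy (sqrtDmc s) ψ := by
  rw [energy_sqrtDmc hs, energy_sqrtDmc hs]
  refine setLIntegral_congr_fun_ae (measurableSet_halfLine s) ?_
  rw [mem_halfSpace] at hχ
  filter_upwards [fourier_add_coe ψ χ, hχ] with ξ e1 e2 hξ
  have : 0 < s * ξ := hξ
  rw [e1, e2 (by linarith), add_zero]

theorem inner_eq_zero_of_halfSpace {φ ψ : Mode} (hφ : φ ∈ halfSpace 1) (hψ : ψ ∈ halfSpace (-1)) :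
    ⟪φ, ψ⟫_ℂ = 0 := by
  rw [halfSpace_neg one_ne_zero] at hψ
  exact hψ φ hφ

/-- An equivalence would carry an admissible `ψ ∈ H_+` to some `χ ∈ H_-` with the same diagonal
matrix element, whose square integral is `I`. The diagonal element of `ψ + χ` is twice as large and
gives `4I`, whereas the central identity gives `I + I`; and `0 < I < ∞`. -/
theorem not_areEquivalent : ¬ AreEquivalent affRep (halfSpace 1) (halfSpace (-1)) := by
  rintro ⟨W, hW⟩
  obtain ⟨ψ, hψ, hψ0, hE⟩ := exists_admissible (s := 1) (Or.inl rfl)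
  set χ : Mode := (W ⟨ψ, hψ⟩ : Mode) with hχdef
  have hχ : χ ∈ halfSpace (-1) := (W ⟨ψ, hψ⟩).2
  have hχ' : ∀ g, affRep g χ ∈ halfSpace (-1) := fun g => affRep_mem_halfSpace g hχ
  have hψ' : ∀ g, affRep g ψ ∈ halfSpace 1 := fun g => affRep_mem_halfSpace g hψ
  have h1 : ∀ g, ⟪χ, affRep g χ⟫_ℂ = ⟪ψ, affRep g ψ⟫_ℂ := by
    intro g
    have h2 := hW g ⟨ψ, hψ⟩ ⟨affRep g ψ, hψ' g⟩ rfl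
    rw [← hχdef] at h2
    rw [← h2]
    exact W.inner_map_map ⟨ψ, hψ⟩ ⟨affRep g ψ, hψ' g⟩
  have h2 : ∀ g, ⟪ψ + χ, affRep g (ψ + χ)⟫_ℂ = 2 * ⟪ψ, affRep g ψ⟫_ℂ := by
    intro g
    rw [map_add, inner_add_left, inner_add_right, inner_add_right,
      inner_eq_zero_of_halfSpace hψ (hχ' g), h1, ← inner_conj_symm χ,
      inner_eq_zero_of_halfSpace (hψ' g) hχ, map_zero]
    ring
  set I : ℝ≥0∞ := ∫⁻ g, ‖⟪ψ, affRep g ψ⟫_ℂ‖ₑ ^ 2 ∂leftHaar with hI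
  have hIψ := lintegral_inner_affRep_of_mem (Or.inl rfl) hψ ψ
  have hIχ := lintegral_inner_affRep_of_mem (Or.inr rfl) hχ χ
  simp only [h1] at hIχ
  rw [← hI] at hIψ hIχ
  have h3 := lintegral_inner_affRep (ψ + χ) (ψ + χ)
  have h4 : (halfSpace 1).starProjection (ψ + χ) = ψ := by
    have := starProjection_halfSpace_neg (s := -1) (by norm_num) hχ
    rw [neg_neg] at this
    rw [map_add, this, Submodule.starProjection_eq_self_iff.mpr hψ, add_zero]
  have h5 : (halfSpace (-1)).starProjection (ψ + χ) = χ := by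
    rw [map_add, starProjection_halfSpace_neg one_ne_zero hψ,
      Submodule.starProjection_eq_self_iff.mpr hχ, zero_add]
  rw [h4, h5, energy_sqrtDmc_add one_ne_zero ψ hχ, add_comm ψ χ,
    energy_sqrtDmc_add (by norm_num) χ (by rwa [neg_neg]), ← hIψ, ← hIχ, add_comm χ ψ] at h3
  simp only [h2, enorm_mul, mul_pow] at h3
  rw [lintegral_const_mul' _ _ (ENNReal.pow_ne_top enorm_ne_top), ← hI] at h3
  have hItop : I ≠ ∞ := by
    rw [hIψ]; exact (ENNReal.mul_lt_top (ENNReal.pow_lt_top enorm_lt_top) hE).ne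
  have hI0 : I ≠ 0 := by
    rw [hIψ]
    exact mul_ne_zero (enorm_pos_iff_ne_zero.mpr hψ0)
      fun h => hψ0 (energy_sqrtDmc_eq_zero one_ne_zero hψ h)
  have h6 := congrArg ENNReal.toReal h3
  rw [ENNReal.toReal_mul, ENNReal.toReal_add hItop hItop] at h6
  have h7 := ENNReal.toReal_pos hI0 hItop
  norm_num at h6
  linarith

theorem isDMC_dmc {s : ℝ} (hs : s = 1 ∨ s = -1) :
    IsDMC affRep leftHaar (halfSpace s) (dmc s) where
  posSelfAdjoint := isPosSelfAdjoint_dmc s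
  supported := fun _ => dmc_supported (ne_zero_of_sign hs)
  orthogonality := by
    refine ⟨sqrtDmc s, isPosSqrt_sqrtDmc s, fun ψ hψ => isAdmissible_iff hs hψ, ?_⟩
    intro φ hφ φ' hφ' ψ ψ' _ _
    let F : halfSpace s →ₗ⋆[ℂ] (sqrtDmc s).domain →ₗ[ℂ] (AxB → ℂ) :=
      LinearMap.mk₂'ₛₗ (starRingEnd ℂ) (RingHom.id ℂ)
        (fun v w g => ⟪(v : Mode), affRep g w⟫_ℂ)
        (fun a b c => by ext g; simp [inner_add_left])
        (fun c a b => by ext g; simp [inner_smul_left])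
        (fun a b c => by ext g; simp [inner_add_right])
        (fun c a b => by ext g; simp [inner_smul_right])
    have h := integral_eq_sum_of_lintegral_eq (κ := Unit) (μ := leftHaar) F
      (fun _ => (halfSpace s).subtype) (fun _ => (sqrtDmc s).toFun)
      (fun v w => (continuous_inner_affRep _ _).aestronglyMeasurable)
      (fun v w => by
        rw [Fintype.sum_unique]
        exact (lintegral_inner_affRep_of_mem hs v.2 w).trans (by rw [energy_apply]; rfl))
      ⟨φ, hφ⟩ ⟨φ', hφ'⟩ ψ ψ'
    rw [Fintype.sum_unique] at h
    have e : ∀ g, F ⟨φ, hφ⟩ ψ g * starRingEnd ℂ (F ⟨φ', hφ'⟩ ψ' g) =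
        ⟪φ, affRep g ψ⟫_ℂ * ⟪affRep g ψ', φ'⟫_ℂ := fun g =>
      congrArg _ (inner_conj_symm (affRep g ψ' : Mode) φ')
    simp only [e] at h
    exact h

/-! ### The group average of a positive operator -/

theorem aveElem_affRep (A : Mode →L[ℂ] Mode) (φ φ' : Mode) (g : AxB) :
    aveElem affRep A φ φ' g = ⟪affRep g⁻¹ φ, A (affRep g⁻¹ φ')⟫_ℂ := by
  rw [aveElem, adjoint_affRep, ← ContinuousLinearMap.adjoint_inner_left, adjoint_affRep]

/-- Isolates what is used of `A^{1/2}`: it squares to `A` and is symmetric. -/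
theorem exists_posTrace_eq {H : Type*} [NormedAddCommGroup H] [InnerProductSpace ℂ H]
    [CompleteSpace H] {A : H →L[ℂ] H} (hA : A.IsPositive) : ∃ B : H →L[ℂ] H,
      (∀ x, A x = B (B x)) ∧ (∀ x y, ⟪B x, y⟫_ℂ = ⟪x, B y⟫_ℂ) ∧
      ∀ {ι : Type*} (b : HilbertBasis ι ℂ H) (C : H →ₗ.[ℂ] H),
        posTrace b C A = ∑' i, energy C (B (b i)) := by
  have hA0 : 0 ≤ A := (ContinuousLinearMap.nonneg_iff_isPositive A).mpr hA
  have hB : (CFC.sqrt A).IsPositive :=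
    (ContinuousLinearMap.nonneg_iff_isPositive _).mp (CFC.sqrt_nonneg A)
  refine ⟨CFC.sqrt A, fun x => ?_, hB.isSymmetric, fun b C => rfl⟩
  exact (congrArg (fun T => T x) (CFC.sqrt_mul_sqrt_self A hA0)).symm

/-- The integrand is `‖A^{1/2} U_g† φ‖²`. Parseval in the basis `b` gives `∑ |⟨φ|U_g|A^{1/2}
b_i⟩|²`, and each term is covered by `lintegral_inner_affRep`. Separability makes the basis
countable, so sum and integral commute. -/
theorem lintegral_aveElem {A : Mode →L[ℂ] Mode} (hA : A.IsPositive) {ι : Type*}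
    (b : HilbertBasis ι ℂ Mode) (φ : Mode) :
    ∫⁻ g, ENNReal.ofReal (aveElem affRep A φ φ g).re ∂leftHaar =
      ‖(halfSpace 1).starProjection φ‖ₑ ^ 2 * posTrace b (sqrtDmc 1) A +
        ‖(halfSpace (-1)).starProjection φ‖ₑ ^ 2 * posTrace b (sqrtDmc (-1)) A := by
  obtain ⟨B, hBB, hBs, hB⟩ := exists_posTrace_eq hA
  have : Fact ((2 : ℝ≥0∞) ≠ ∞) := ⟨ENNReal.ofNat_ne_top⟩
  have := countable_of_hilbertBasis b
  have h1 : ∀ g, ENNReal.ofReal (aveElem affRep A φ φ g).re =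
      ∑' i, ‖⟪φ, affRep g (B (b i))⟫_ℂ‖ₑ ^ 2 := by
    intro g
    have h3 : (⟪B (affRep g⁻¹ φ), B (affRep g⁻¹ φ)⟫_ℂ).re = ‖B (affRep g⁻¹ φ)‖ ^ 2 :=
      inner_self_eq_norm_sq (𝕜 := ℂ) _
    rw [aveElem_affRep, hBB, ← hBs, h3, ENNReal.ofReal_pow (norm_nonneg _), ofReal_norm,
      ← tsum_enorm_inner_sq b]
    refine tsum_congr fun i => ?_
    rw [← hBs, ← inv_inv g, ← inner_affRep_left, ← inner_conj_symm, RCLike.enorm_conj, inv_inv]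
  simp only [h1]
  rw [lintegral_tsum fun i =>
    ((continuous_inner_affRep φ (B (b i))).measurable.enorm.pow_const 2).aemeasurable]
  simp only [lintegral_inner_affRep]
  rw [ENNReal.tsum_add, ENNReal.tsum_mul_left, ENNReal.tsum_mul_left, hB, hB]

/-! ### Traces -/

section Trace

variable {H : Type*} [NormedAddCommGroup H] [InnerProductSpace ℂ H]

theorem sum_norm_inner_mul_inner_le {ι : Type*} (b : HilbertBasis ι ℂ H) (u v : H)
    (s : Finset ι) : ∑ j ∈ s, ‖⟪v, b j⟫_ℂ * ⟪b j, u⟫_ℂ‖ ≤ ‖u‖ * ‖v‖ := by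
  have h := Real.sum_mul_le_sqrt_mul_sqrt s (fun j => ‖⟪v, b j⟫_ℂ‖) fun j => ‖⟪b j, u⟫_ℂ‖
  have h1 : √(∑ j ∈ s, ‖⟪v, b j⟫_ℂ‖ ^ 2) ≤ ‖v‖ := by
    refine Real.sqrt_le_iff.mpr ⟨norm_nonneg _, ?_⟩
    simp only [norm_inner_symm v]
    exact b.orthonormal.sum_inner_products_le v
  have h2 : √(∑ j ∈ s, ‖⟪b j, u⟫_ℂ‖ ^ 2) ≤ ‖u‖ :=
    Real.sqrt_le_iff.mpr ⟨norm_nonneg _, b.orthonormal.sum_inner_products_le u⟩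
  simp only [norm_mul]
  refine h.trans ?_
  rw [mul_comm ‖u‖]
  exact mul_le_mul h1 h2 (Real.sqrt_nonneg _) (norm_nonneg _)

/-- Cauchy–Schwarz and Bessel make the double series `⟪v i, b j⟫ ⟪b j, u i⟫` absolutely summable.
Summed over `j` first it gives `⟪v i, u i⟫`, summed over `i` first the diagonal of `T`; hence the
trace does not depend on the basis. -/
theorem hasSum_trace_of_nuclear {T : H →L[ℂ] H} {u v : ℕ → H}
    (hs : Summable fun i => ‖u i‖ * ‖v i‖) (hT : ∀ φ, HasSum (fun i => ⟪v i, φ⟫_ℂ • u i) (T φ))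
    {ι : Type*} (b : HilbertBasis ι ℂ H) :
    HasSum (fun j => ⟪b j, T (b j)⟫_ℂ) (∑' i, ⟪v i, u i⟫_ℂ) := by
  let a : ℕ × ι → ℂ := fun x => ⟪v x.1, b x.2⟫_ℂ * ⟪b x.2, u x.1⟫_ℂ
  have hrow : ∀ i, Summable fun j => ‖a (i, j)‖ := fun i =>
    summable_of_sum_le (fun _ => norm_nonneg _) (sum_norm_inner_mul_inner_le b (u i) (v i))
  have ha : Summable a := by
    refine Summable.of_norm ?_
    rw [summable_prod_of_nonneg fun _ => norm_nonneg _]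
    refine ⟨hrow, Summable.of_nonneg_of_le (fun i => tsum_nonneg fun _ => norm_nonneg _)
      (fun i => ?_) hs⟩
    exact (hrow i).tsum_le_of_sum_le (sum_norm_inner_mul_inner_le b (u i) (v i))
  have h1 : HasSum (fun i => ⟪v i, u i⟫_ℂ) (∑' x, a x) :=
    ha.hasSum.prod_fiberwise fun i => b.hasSum_inner_mul_inner (v i) (u i)
  rw [h1.tsum_eq]
  have h2 : HasSum (a ∘ Equiv.prodComm ι ℕ) (∑' x, a x) :=
    (Equiv.hasSum_iff (Equiv.prodComm ι ℕ)).mpr ha.hasSum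
  refine h2.prod_fiberwise fun j => ?_
  have h3 := (innerSL ℂ (b j)).hasSum (hT (b j))
  simp only [innerSL_apply_apply, inner_smul_right] at h3
  exact h3

theorem hasSum_compression_of_nuclear {T P : H →L[ℂ] H} {u v : ℕ → H}
    (hP : ∀ x y, ⟪P x, y⟫_ℂ = ⟪x, P y⟫_ℂ)
    (hT : ∀ φ, HasSum (fun i => ⟪v i, φ⟫_ℂ • u i) (T φ)) (φ : H) :
    HasSum (fun i => ⟪P (v i), φ⟫_ℂ • P (u i)) ((P * T * P) φ) := by
  have h := P.hasSum (hT (P φ))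
  simp only [map_smul, ← hP] at h
  exact h

theorem summable_compression {P : H →L[ℂ] H} (hP : ∀ x, ‖P x‖ ≤ ‖x‖) {u v : ℕ → H}
    (hs : Summable fun i => ‖u i‖ * ‖v i‖) : Summable fun i => ‖P (u i)‖ * ‖P (v i)‖ :=
  hs.of_nonneg_of_le (fun _ => by positivity) fun i =>
    mul_le_mul (hP _) (hP _) (norm_nonneg _) (norm_nonneg _)

end Trace

/-- The projection onto `halfSpace s` is symmetric. -/
theorem inner_proj_left (s : ℝ) (x y : Mode) : ⟪(halfSpace s).starProjection x, y⟫_ℂ =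
    ⟪x, (halfSpace s).starProjection y⟫_ℂ :=
  Submodule.inner_starProjection_left_eq_right _ x y

theorem proj_proj (s : ℝ) (x : Mode) : (halfSpace s).starProjection
    ((halfSpace s).starProjection x) = (halfSpace s).starProjection x :=
  Submodule.starProjection_eq_self_iff.mpr (Submodule.starProjection_apply_mem _ x)

/-- `D_s^{1/2}` acts as `(π/|Y|)^{1/2}` after projection to the half space. Thus `D_s^{1/2} A
D_s^{1/2}` is the compression of `T`, as used in `hasTrace_sqrtDmc`. -/
theorem proj_mem_graph_total {s : ℝ} (hs : s ≠ 0) (φ : (sqrtDmc s).domain) :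
    ((halfSpace s).starProjection (φ : Mode), sqrtDmc s φ) ∈ sqrtDmcTotal.graph := by
  rw [sqrtDmcTotal, mem_graph_fnY]
  filter_upwards [fourier_fnY_apply φ, fourier_starProjection hs (φ : Mode), ae_ne_zero]
    with ξ e1 e2 e3
  have e1' : (𝓕 (sqrtDmc s φ) : Mode) ξ = _ := e1
  rw [e1', e2]
  by_cases hξ : 0 < s * ξ
  · rw [Set.indicator_of_mem (by exact hξ), dmcFun_of_pos hξ]
    congr 3
    rw [abs_mul, abs_of_pos Real.pi_pos]
    have := abs_pos.mpr e3
    field_simp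
  · rw [Set.indicator_of_notMem (by exact hξ),
      dmcFun_of_neg (lt_of_le_of_ne (not_lt.mp hξ) (mul_ne_zero hs e3))]
    simp

theorem form_of_graph {H : Type*} [NormedAddCommGroup H] [InnerProductSpace ℂ H]
    {C : H →ₗ.[ℂ] H} {A T : H →L[ℂ] H}
    (h : ∀ φ ψ : C.domain, ⟪(φ : H), T ψ⟫_ℂ = ⟪C φ, A (C ψ)⟫_ℂ) {φ φ' ψ ψ' : H}
    (h1 : (φ, φ') ∈ C.graph) (h2 : (ψ, ψ') ∈ C.graph) : ⟪φ, T ψ⟫_ℂ = ⟪φ', A ψ'⟫_ℂ := by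
  rw [LinearPMap.mem_graph_iff] at h1 h2
  obtain ⟨x, rfl, rfl⟩ := h1
  obtain ⟨y, rfl, rfl⟩ := h2
  exact h x y

theorem hasTrace_sqrtDmc {s : ℝ} (hs : s ≠ 0) {A T : Mode →L[ℂ] Mode} {u v : ℕ → Mode}
    (hsum : Summable fun i => ‖u i‖ * ‖v i‖) (hT : ∀ φ, HasSum (fun i => ⟪v i, φ⟫_ℂ • u i) (T φ))
    (h : ∀ φ ψ : sqrtDmcTotal.domain,
      ⟪(φ : Mode), T ψ⟫_ℂ = ⟪sqrtDmcTotal φ, A (sqrtDmcTotal ψ)⟫_ℂ) :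
    HasTrace (sqrtDmc s) A
      (∑' i, ⟪(halfSpace s).starProjection (v i), (halfSpace s).starProjection (u i)⟫_ℂ) := by
  have h1 := hasSum_compression_of_nuclear (inner_proj_left s) hT
  have h2 := summable_compression (P := (halfSpace s).starProjection)
    (Submodule.norm_starProjection_apply_le _) hsum
  refine ⟨_, ⟨_, _, h2, h1⟩, fun φ ψ => ?_, fun ι b => hasSum_trace_of_nuclear h2 h1 b⟩
  rw [← form_of_graph h (proj_mem_graph_total hs φ) (proj_mem_graph_total hs ψ), inner_proj_left]
  rfl

/-! ### The group average of an operator of finite trace -/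

/-- The operator `(|Y| / π)^{1/2}`. -/
def sqrtAbsY : Mode →ₗ.[ℂ] Mode := fnY fun y => √(|y| / Real.pi)

theorem measurable_sqrtAbsY : Measurable fun y : ℝ => √(|y| / Real.pi) := by fun_prop

theorem abs_pi_mul_div (ξ : ℝ) : |Real.pi * ξ| / Real.pi = |ξ| := by
  rw [abs_mul, abs_of_pos Real.pi_pos]
  have := Real.pi_pos
  field_simp

theorem mem_graph_sqrtAbsY {ψ φ : Mode} : (ψ, φ) ∈ sqrtAbsY.graph ↔
    (𝓕 φ : Mode) =ᵐ[volume] fun ξ => ((√|ξ| : ℝ) : ℂ) * (𝓕 ψ : Mode) ξ := by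
  rw [sqrtAbsY, mem_graph_fnY]
  simp only [abs_pi_mul_div]

/-- `(π/|Y|)^{1/2}` inverts `(|Y|/π)^{1/2}`, so a vector in the domain of the latter can be fed into
the hypothesis on `T`. -/
theorem mem_graph_total_of_sqrtAbsY {φ χ : Mode} (h : (φ, χ) ∈ sqrtAbsY.graph) :
    (χ, φ) ∈ sqrtDmcTotal.graph := by
  rw [mem_graph_sqrtAbsY] at h
  rw [sqrtDmcTotal, mem_graph_fnY]
  filter_upwards [h, ae_ne_zero] with ξ e1 e2
  have h0 : 0 < |ξ| := abs_pos.mpr e2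
  have e3 : Real.pi / (Real.pi * |ξ|) * |ξ| = 1 := by
    have := Real.pi_pos
    field_simp
  rw [e1, ← mul_assoc, ← Complex.ofReal_mul, ← Real.sqrt_mul (by positivity), abs_mul,
    abs_of_pos Real.pi_pos, e3]
  simp

/-- Covariance: translations commute with `Y`, and a dilation by `e^r` rescales `|Y|^{1/2}` by
`e^{-r/2}`. -/
theorem sqrtAbsY_affRep {φ χ : Mode} (h : (φ, χ) ∈ sqrtAbsY.graph) (g : AxB) :
    (affRep g φ, (Real.exp (-g.r / 2) : ℂ) • affRep g χ) ∈ sqrtAbsY.graph := by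
  rw [mem_graph_sqrtAbsY] at h ⊢
  filter_upwards [fourier_smul_coe (Real.exp (-g.r / 2) : ℂ) (affRep g χ), fourier_affRep_coe g χ,
    fourier_affRep_coe g φ, (quasiMeasurePreserving_exp_mul g.r).ae h] with ξ e1 e2 e3 e4
  rw [e1, e2, e3, momentumFun, momentumFun, e4]
  have h1 : √|Real.exp g.r * ξ| = Real.exp (g.r / 2) * √|ξ| := by
    rw [abs_mul, abs_of_pos (Real.exp_pos _), Real.sqrt_mul (Real.exp_pos _).le, Real.exp_half]
  have h2 : (Real.exp (-g.r / 2) : ℂ) * (Real.exp (g.r / 2) : ℂ) = 1 := by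
    rw [← Complex.ofReal_mul, ← Real.exp_add]; ring_nf; simp
  rw [h1, Complex.ofReal_mul]
  linear_combination (phase g.x ξ * (Real.exp (g.r / 2) : ℂ) * (√|ξ| : ℂ) *
    (𝓕 φ : Mode) (Real.exp g.r * ξ)) * h2

theorem enorm_sq_fourier_sqrtAbsY {φ χ : Mode} (h : (φ, χ) ∈ sqrtAbsY.graph) :
    ∀ᵐ ξ, ‖(𝓕 χ : Mode) ξ‖ₑ ^ 2 = ENNReal.ofReal |ξ| * ‖(𝓕 φ : Mode) ξ‖ₑ ^ 2 := by
  rw [mem_graph_sqrtAbsY] at h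
  filter_upwards [h] with ξ e
  rw [e, enorm_mul, mul_pow]
  congr 1
  rw [← ofReal_norm, Complex.norm_real, ← ENNReal.ofReal_pow (norm_nonneg _), Real.norm_eq_abs,
    sq_abs, Real.sq_sqrt (abs_nonneg _)]

/-- The matrix element of `U_g` with the square root of the modular weight. -/
def modElem (χ u : Mode) (g : AxB) : ℂ := (Real.exp (g.r / 2) : ℂ) * ⟪χ, affRep g u⟫_ℂ

theorem continuous_modElem (χ u : Mode) : Continuous (modElem χ u) := by
  refine Continuous.mul ?_ (continuous_inner_affRep χ u)
  exact Complex.continuous_ofReal.comp (Real.continuous_exp.comp (continuous_r.div_const 2))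

theorem lintegral_modElem {φ χ : Mode} (h : (φ, χ) ∈ sqrtAbsY.graph) (u : Mode) :
    ∫⁻ g, ‖modElem χ u g‖ₑ ^ 2 ∂leftHaar =
      ‖(halfSpace 1).starProjection φ‖ₑ ^ 2 * ‖(halfSpace 1).starProjection u‖ₑ ^ 2 +
        ‖(halfSpace (-1)).starProjection φ‖ₑ ^ 2 * ‖(halfSpace (-1)).starProjection u‖ₑ ^ 2 := by
  rw [← lintegral_exp_inner_affRep u (enorm_sq_fourier_sqrtAbsY h)]
  refine lintegral_congr fun g => ?_
  rw [modElem, enorm_mul, mul_pow]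
  congr 1
  rw [← ofReal_norm, Complex.norm_real, Real.norm_of_nonneg (Real.exp_pos _).le,
    ← ENNReal.ofReal_pow (Real.exp_pos _).le, ← Real.exp_nat_mul]
  congr 2; push_cast; ring

theorem lintegral_modElem_le {φ χ : Mode} (h : (φ, χ) ∈ sqrtAbsY.graph) (u : Mode) :
    ∫⁻ g, ‖modElem χ u g‖ₑ ^ 2 ∂leftHaar ≤ (‖φ‖ₑ * ‖u‖ₑ) ^ 2 := by
  have hd : ∀ ψ : Mode, ‖ψ‖ₑ ^ 2 = ‖(halfSpace 1).starProjection ψ‖ₑ ^ 2 +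
      ‖(halfSpace (-1)).starProjection ψ‖ₑ ^ 2 := fun ψ => by
    rw [enorm_sq_eq_lintegral_fourier, lintegral_eq_add_halfLine,
      lintegral_halfLine_fourier one_ne_zero, lintegral_halfLine_fourier (by norm_num)]
  rw [lintegral_modElem h, mul_pow, hd φ, hd u, add_mul, mul_add, mul_add]
  exact add_le_add le_self_add le_add_self

theorem lintegral_modElem_mul_le {φ χ φ' χ' : Mode} (h : (φ, χ) ∈ sqrtAbsY.graph)
    (h' : (φ', χ') ∈ sqrtAbsY.graph) (u v : Mode) :
    ∫⁻ g, ‖modElem χ u g * starRingEnd ℂ (modElem χ' v g)‖ₑ ∂leftHaar ≤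
      ENNReal.ofReal (‖φ‖ * ‖φ'‖ * (‖u‖ * ‖v‖)) := by
  have hm : ∀ χ u, AEMeasurable (fun g => ‖modElem χ u g‖ₑ) leftHaar := fun χ u =>
    (continuous_modElem χ u).measurable.enorm.aemeasurable
  have h1 := ENNReal.lintegral_mul_le_Lp_mul_Lq leftHaar (p := 2) (q := 2)
    Real.HolderConjugate.two_two (hm χ u) (hm χ' v)
  simp only [enorm_mul, RCLike.enorm_conj]
  refine h1.trans ?_
  have h2 : ∀ {φ χ : Mode} (u : Mode), (φ, χ) ∈ sqrtAbsY.graph →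
      (∫⁻ g, ‖modElem χ u g‖ₑ ^ (2 : ℝ) ∂leftHaar) ^ (1 / (2 : ℝ)) ≤ ‖φ‖ₑ * ‖u‖ₑ := by
    intro φ χ u h
    simp only [ENNReal.rpow_ofNat]
    refine (ENNReal.rpow_le_rpow (lintegral_modElem_le h u) (by norm_num)).trans_eq ?_
    rw [← ENNReal.rpow_natCast, ← ENNReal.rpow_mul]
    norm_num
  refine (mul_le_mul' (h2 u h) (h2 v h')).trans_eq ?_
  rw [ENNReal.ofReal_mul (by positivity), ENNReal.ofReal_mul (by positivity),
    ENNReal.ofReal_mul (by positivity)]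
  simp only [ofReal_norm]
  ring

theorem integral_modElem_mul {φ χ φ' χ' : Mode} (h : (φ, χ) ∈ sqrtAbsY.graph)
    (h' : (φ', χ') ∈ sqrtAbsY.graph) (u v : Mode) :
    Integrable (fun g => modElem χ u g * starRingEnd ℂ (modElem χ' v g)) leftHaar ∧
    ∫ g, modElem χ u g * starRingEnd ℂ (modElem χ' v g) ∂leftHaar =
      ⟪φ, (halfSpace 1).starProjection φ'⟫_ℂ *
          ⟪(halfSpace 1).starProjection v, (halfSpace 1).starProjection u⟫_ℂ +
        ⟪φ, (halfSpace (-1)).starProjection φ'⟫_ℂ *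
          ⟪(halfSpace (-1)).starProjection v, (halfSpace (-1)).starProjection u⟫_ℂ := by
  let F : sqrtAbsY.domain →ₗ⋆[ℂ] Mode →ₗ[ℂ] (AxB → ℂ) :=
    LinearMap.mk₂'ₛₗ (starRingEnd ℂ) (RingHom.id ℂ)
      (fun x u => modElem (sqrtAbsY x) u)
      (fun a b c => by ext g; simp [modElem, inner_add_left, mul_add, LinearPMap.map_add])
      (fun c a b => by ext g; simp [modElem, inner_smul_left, LinearPMap.map_smul]; ring)
      (fun a b c => by ext g; simp [modElem, inner_add_right, mul_add])
      (fun c a b => by ext g; simp [modElem, inner_smul_right]; ring)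
  -- The polarized sum has two terms, one for each half space.
  let sgn : Bool → ℝ := fun k => if k then 1 else -1
  let P : Bool → Mode →ₗ[ℂ] Mode := fun k => (halfSpace (sgn k)).starProjection.toLinearMap
  rw [LinearPMap.mem_graph_iff] at h h'
  obtain ⟨x, hx, rfl⟩ := h
  obtain ⟨x', hx', rfl⟩ := h'
  simp only at hx hx'
  subst hx hx'
  have key := integral_eq_sum_of_lintegral_eq (κ := Bool) (μ := leftHaar) F
    (fun k => (P k).comp sqrtAbsY.domain.subtype) P
    (fun x u => (continuous_modElem _ _).aestronglyMeasurable)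
    (fun x u => by
      rw [Fintype.sum_bool]
      exact lintegral_modElem (LinearPMap.mem_graph _ x) u) x x' u v
  rw [Fintype.sum_bool] at key
  refine ⟨key.1, key.2.trans ?_⟩
  rw [← proj_proj 1 (x' : Mode), ← proj_proj (-1) (x' : Mode), ← inner_proj_left 1 (x : Mode),
    ← inner_proj_left (-1) (x : Mode)]
  rfl

/-- Covariance gives `U_g† φ = (π/|Y|)^{1/2} (e^{r/2} U_g† χ)`, and likewise for `φ'`. The matrix
element of `A` is therefore one of `T`, which is expanded in its nuclear series. -/
theorem hasSum_aveElem {A T : Mode →L[ℂ] Mode} {u v : ℕ → Mode}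
    (hT : ∀ φ, HasSum (fun i => ⟪v i, φ⟫_ℂ • u i) (T φ))
    (h : ∀ φ ψ : sqrtDmcTotal.domain,
      ⟪(φ : Mode), T ψ⟫_ℂ = ⟪sqrtDmcTotal φ, A (sqrtDmcTotal ψ)⟫_ℂ)
    {φ χ φ' χ' : Mode} (h1 : (φ, χ) ∈ sqrtAbsY.graph) (h2 : (φ', χ') ∈ sqrtAbsY.graph) (g : AxB) :
    HasSum (fun i => modElem χ (u i) g * starRingEnd ℂ (modElem χ' (v i) g))
      (aveElem affRep A φ φ' g) := by
  have e1 := mem_graph_total_of_sqrtAbsY (sqrtAbsY_affRep h1 g⁻¹)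
  have e2 := mem_graph_total_of_sqrtAbsY (sqrtAbsY_affRep h2 g⁻¹)
  rw [aveElem_affRep, ← form_of_graph h e1 e2]
  have h3 := (innerSL ℂ ((Real.exp (-g⁻¹.r / 2) : ℂ) • affRep g⁻¹ χ)).hasSum
    (hT ((Real.exp (-g⁻¹.r / 2) : ℂ) • affRep g⁻¹ χ'))
  simp only [innerSL_apply_apply] at h3
  refine h3.congr_fun fun i => ?_
  rw [inner_smul_right, inner_smul_right, inner_smul_left, inner_affRep_left, inv_inv, modElem,
    modElem, map_mul, inner_conj_symm, inner_affRep_left, AxB.inv_r, neg_neg, Complex.conj_ofReal]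
  ring

theorem continuous_inv_axb : Continuous fun g : AxB => g⁻¹ := by
  have h : Continuous fun p : ℝ × ℝ => (-(Real.exp (-p.2) * p.1), -p.2) := by fun_prop
  exact h

theorem continuous_aveElem (A : Mode →L[ℂ] Mode) (φ φ' : Mode) :
    Continuous (aveElem affRep A φ φ') := by
  have e : aveElem affRep A φ φ' = fun g => ⟪affRep g⁻¹ φ, A (affRep g⁻¹ φ')⟫_ℂ :=
    funext (aveElem_affRep A φ φ')
  rw [e]
  exact ((continuous_affRep φ).comp continuous_inv_axb).inner
    (A.continuous.comp ((continuous_affRep φ').comp continuous_inv_axb))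

theorem lintegral_aveElem_le_of_graph {A T : Mode →L[ℂ] Mode} {u v : ℕ → Mode}
    (hs : Summable fun i => ‖u i‖ * ‖v i‖)
    (hT : ∀ φ, HasSum (fun i => ⟪v i, φ⟫_ℂ • u i) (T φ))
    (h : ∀ φ ψ : sqrtDmcTotal.domain,
      ⟪(φ : Mode), T ψ⟫_ℂ = ⟪sqrtDmcTotal φ, A (sqrtDmcTotal ψ)⟫_ℂ)
    {φ χ φ' χ' : Mode} (h1 : (φ, χ) ∈ sqrtAbsY.graph) (h2 : (φ', χ') ∈ sqrtAbsY.graph) :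
    ∫⁻ g, ‖aveElem affRep A φ φ' g‖ₑ ∂leftHaar ≤
      ENNReal.ofReal ((∑' i, ‖u i‖ * ‖v i‖) * ‖φ‖ * ‖φ'‖) := by
  calc _ ≤ ∫⁻ g, ∑' i, ‖modElem χ (u i) g * starRingEnd ℂ (modElem χ' (v i) g)‖ₑ ∂leftHaar := by
        refine lintegral_mono fun g => ?_
        simp only
        rw [← (hasSum_aveElem hT h h1 h2 g).tsum_eq]
        exact enorm_tsum_le_tsum_enorm
    _ = ∑' i, ∫⁻ g, ‖modElem χ (u i) g * starRingEnd ℂ (modElem χ' (v i) g)‖ₑ ∂leftHaar :=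
        lintegral_tsum fun i => ((continuous_modElem _ _).mul
          (Complex.continuous_conj.comp (continuous_modElem _ _))).measurable.enorm.aemeasurable
    _ ≤ ∑' i, ENNReal.ofReal (‖φ‖ * ‖φ'‖ * (‖u i‖ * ‖v i‖)) :=
        ENNReal.tsum_le_tsum fun i => lintegral_modElem_mul_le h1 h2 _ _
    _ = _ := by
        rw [← ENNReal.ofReal_tsum_of_nonneg (fun i => by positivity) (hs.mul_left _), tsum_mul_left]
        congr 1; ring

/-- Fatou's lemma along sequences in the dense domain of `(|Y|/π)^{1/2}`: the bound there involves
only `‖φ‖` and `‖φ'‖`, so it survives the limit. -/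
theorem lintegral_aveElem_le {A T : Mode →L[ℂ] Mode} {u v : ℕ → Mode}
    (hs : Summable fun i => ‖u i‖ * ‖v i‖)
    (hT : ∀ φ, HasSum (fun i => ⟪v i, φ⟫_ℂ • u i) (T φ))
    (h : ∀ φ ψ : sqrtDmcTotal.domain,
      ⟪(φ : Mode), T ψ⟫_ℂ = ⟪sqrtDmcTotal φ, A (sqrtDmcTotal ψ)⟫_ℂ) (φ φ' : Mode) :
    ∫⁻ g, ‖aveElem affRep A φ φ' g‖ₑ ∂leftHaar ≤
      ENNReal.ofReal ((∑' i, ‖u i‖ * ‖v i‖) * ‖φ‖ * ‖φ'‖) := by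
  have hd := dense_domain_fnY measurable_sqrtAbsY
  obtain ⟨x, hx, hxl⟩ := mem_closure_iff_seq_limit.mp (hd φ)
  obtain ⟨y, hy, hyl⟩ := mem_closure_iff_seq_limit.mp (hd φ')
  have hg : ∀ n, (x n, sqrtAbsY ⟨x n, hx n⟩) ∈ sqrtAbsY.graph := fun n =>
    LinearPMap.mem_graph _ ⟨x n, hx n⟩
  have hg' : ∀ n, (y n, sqrtAbsY ⟨y n, hy n⟩) ∈ sqrtAbsY.graph := fun n =>
    LinearPMap.mem_graph _ ⟨y n, hy n⟩
  have hb := fun n => lintegral_aveElem_le_of_graph hs hT h (hg n) (hg' n)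
  have hpt : ∀ g, Filter.Tendsto (fun n => ‖aveElem affRep A (x n) (y n) g‖ₑ) Filter.atTop
      (nhds ‖aveElem affRep A φ φ' g‖ₑ) := by
    intro g
    simp only [aveElem_affRep]
    refine Filter.Tendsto.enorm ?_
    exact (((affRep g⁻¹).continuous.tendsto _).comp hxl).inner
      ((A.continuous.tendsto _).comp (((affRep g⁻¹).continuous.tendsto _).comp hyl))
  have hlim : Filter.Tendsto
      (fun n => ENNReal.ofReal ((∑' i, ‖u i‖ * ‖v i‖) * ‖x n‖ * ‖y n‖)) Filter.atTop
      (nhds (ENNReal.ofReal ((∑' i, ‖u i‖ * ‖v i‖) * ‖φ‖ * ‖φ'‖))) :=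
    ENNReal.tendsto_ofReal ((hxl.norm.const_mul _).mul hyl.norm)
  calc _ = ∫⁻ g, Filter.liminf (fun n => ‖aveElem affRep A (x n) (y n) g‖ₑ) Filter.atTop
          ∂leftHaar := lintegral_congr fun g => (hpt g).liminf_eq.symm
    _ ≤ Filter.liminf (fun n => ∫⁻ g, ‖aveElem affRep A (x n) (y n) g‖ₑ ∂leftHaar) Filter.atTop :=
        lintegral_liminf_le fun n => (continuous_aveElem A _ _).measurable.enorm
    _ ≤ Filter.liminf (fun n => ENNReal.ofReal ((∑' i, ‖u i‖ * ‖v i‖) * ‖x n‖ * ‖y n‖))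
          Filter.atTop := Filter.liminf_le_liminf (.of_forall hb)
    _ = _ := hlim.liminf_eq

theorem integral_aveElem_of_graph {A T : Mode →L[ℂ] Mode} {u v : ℕ → Mode}
    (hs : Summable fun i => ‖u i‖ * ‖v i‖)
    (hT : ∀ φ, HasSum (fun i => ⟪v i, φ⟫_ℂ • u i) (T φ))
    (h : ∀ φ ψ : sqrtDmcTotal.domain,
      ⟪(φ : Mode), T ψ⟫_ℂ = ⟪sqrtDmcTotal φ, A (sqrtDmcTotal ψ)⟫_ℂ)
    {φ χ φ' χ' : Mode} (h1 : (φ, χ) ∈ sqrtAbsY.graph) (h2 : (φ', χ') ∈ sqrtAbsY.graph) :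
    ∫ g, aveElem affRep A φ φ' g ∂leftHaar =
      (∑' i, ⟪(halfSpace 1).starProjection (v i), (halfSpace 1).starProjection (u i)⟫_ℂ) *
          ⟪φ, (halfSpace 1).starProjection φ'⟫_ℂ +
        (∑' i, ⟪(halfSpace (-1)).starProjection (v i), (halfSpace (-1)).starProjection (u i)⟫_ℂ) *
          ⟪φ, (halfSpace (-1)).starProjection φ'⟫_ℂ := by
  have hi := fun i => integral_modElem_mul h1 h2 (u i) (v i)
  have hn : Summable fun i =>
      ∫ g, ‖modElem χ (u i) g * starRingEnd ℂ (modElem χ' (v i) g)‖ ∂leftHaar := by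
    refine Summable.of_nonneg_of_le (fun i => integral_nonneg fun _ => norm_nonneg _) (fun i => ?_)
      (hs.mul_left (‖φ‖ * ‖φ'‖))
    rw [integral_norm_eq_lintegral_enorm (hi i).1.1]
    exact ENNReal.toReal_le_of_le_ofReal (by positivity) (lintegral_modElem_mul_le h1 h2 _ _)
  -- Each term is bounded in `L¹` by a multiple of `‖u i‖ ‖v i‖`, which justifies integrating the
  -- series termwise.
  have h3 := hasSum_integral_of_summable_integral_norm (fun i => (hi i).1) hn
  simp only [(hasSum_aveElem hT h h1 h2 _).tsum_eq, fun i => (hi i).2] at h3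
  have hsum : ∀ s : ℝ, Summable fun i =>
      ⟪(halfSpace s).starProjection (v i), (halfSpace s).starProjection (u i)⟫_ℂ := fun s =>
    Summable.of_norm_bounded (summable_compression (P := (halfSpace s).starProjection)
      (Submodule.norm_starProjection_apply_le _) hs) fun i => by
        rw [mul_comm]; exact norm_inner_le_norm _ _
  have h4 := ((hsum 1).hasSum.mul_left ⟪φ, (halfSpace 1).starProjection φ'⟫_ℂ).add
    ((hsum (-1)).hasSum.mul_left ⟪φ, (halfSpace (-1)).starProjection φ'⟫_ℂ)
  rw [h3.unique h4]
  ring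

theorem integrable_aveElem {A T : Mode →L[ℂ] Mode} {u v : ℕ → Mode}
    (hs : Summable fun i => ‖u i‖ * ‖v i‖)
    (hT : ∀ φ, HasSum (fun i => ⟪v i, φ⟫_ℂ • u i) (T φ))
    (h : ∀ φ ψ : sqrtDmcTotal.domain,
      ⟪(φ : Mode), T ψ⟫_ℂ = ⟪sqrtDmcTotal φ, A (sqrtDmcTotal ψ)⟫_ℂ) (φ φ' : Mode) :
    Integrable (aveElem affRep A φ φ') leftHaar :=
  ⟨(continuous_aveElem A φ φ').aestronglyMeasurable,
    (lintegral_aveElem_le hs hT h φ φ').trans_lt ENNReal.ofReal_lt_top⟩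

/-- Both sides are bounded sesquilinear forms in `φ, φ'`, the left one by `lintegral_aveElem_le`.
They agree on the dense domain of `(|Y|/π)^{1/2}`, and the identity is extended one argument at a
time. -/
theorem integral_aveElem {A T : Mode →L[ℂ] Mode} {u v : ℕ → Mode}
    (hs : Summable fun i => ‖u i‖ * ‖v i‖)
    (hT : ∀ φ, HasSum (fun i => ⟪v i, φ⟫_ℂ • u i) (T φ))
    (h : ∀ φ ψ : sqrtDmcTotal.domain,
      ⟪(φ : Mode), T ψ⟫_ℂ = ⟪sqrtDmcTotal φ, A (sqrtDmcTotal ψ)⟫_ℂ) (φ φ' : Mode) :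
    ∫ g, aveElem affRep A φ φ' g ∂leftHaar =
      (∑' i, ⟪(halfSpace 1).starProjection (v i), (halfSpace 1).starProjection (u i)⟫_ℂ) *
          ⟪φ, (halfSpace 1).starProjection φ'⟫_ℂ +
        (∑' i, ⟪(halfSpace (-1)).starProjection (v i), (halfSpace (-1)).starProjection (u i)⟫_ℂ) *
          ⟪φ, (halfSpace (-1)).starProjection φ'⟫_ℂ := by
  have hi := integrable_aveElem hs hT h
  let B : Mode →ₗ⋆[ℂ] Mode →ₗ[ℂ] ℂ := LinearMap.mk₂'ₛₗ (starRingEnd ℂ) (RingHom.id ℂ)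
    (fun φ φ' => ∫ g, aveElem affRep A φ φ' g ∂leftHaar)
    (fun a b c => by
      rw [← integral_add (hi _ _) (hi _ _)]
      simp only [aveElem, inner_add_left])
    (fun c a b => by
      rw [smul_eq_mul, ← integral_const_mul]
      simp only [aveElem, inner_smul_left])
    (fun a b c => by
      rw [← integral_add (hi _ _) (hi _ _)]
      simp only [aveElem, map_add, inner_add_right])
    (fun c a b => by
      rw [smul_eq_mul, ← integral_const_mul]
      simp only [aveElem, map_smul, inner_smul_right, RingHom.id_apply])
  let Bc := B.mkContinuous₂ (∑' i, ‖u i‖ * ‖v i‖) fun φ φ' => by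
    have h1 := (enorm_integral_le_lintegral_enorm _).trans (lintegral_aveElem_le hs hT h φ φ')
    rw [← ofReal_norm, ENNReal.ofReal_le_ofReal_iff
      (by have : 0 ≤ ∑' i, ‖u i‖ * ‖v i‖ := tsum_nonneg fun _ => by positivity
          positivity)] at h1
    exact h1
  have hd := dense_domain_fnY measurable_sqrtAbsY
  have hc1 : ∀ φ, Continuous fun φ' => ∫ g, aveElem affRep A φ φ' g ∂leftHaar := fun φ =>
    (Bc φ).continuous
  have hc2 : ∀ φ', Continuous fun φ => ∫ g, aveElem affRep A φ φ' g ∂leftHaar := fun φ' =>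
    (Bc.flip φ').continuous
  have h1 : ∀ φ ∈ (sqrtAbsY.domain : Set Mode), ∀ φ' : Mode,
      ∫ g, aveElem affRep A φ φ' g ∂leftHaar = _ := fun φ hφ φ' =>
    congrFun (Continuous.ext_on hd (hc1 φ)
      ((continuous_const.mul (continuous_const.inner (ContinuousLinearMap.continuous _))).add
        (continuous_const.mul (continuous_const.inner (ContinuousLinearMap.continuous _))))
      fun φ' hφ' => integral_aveElem_of_graph hs hT h (LinearPMap.mem_graph _ ⟨φ, hφ⟩)
        (LinearPMap.mem_graph _ ⟨φ', hφ'⟩)) φ'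
  exact congrFun (Continuous.ext_on hd (hc2 φ')
    ((continuous_const.mul (continuous_id.inner continuous_const)).add
      (continuous_const.mul (continuous_id.inner continuous_const)))
    fun φ hφ => h1 φ hφ φ') φ

end AxbMode

end

theorem mainTheorem3 :
    -- the exponentials `D(x) = exp [x (a† - a)]` and `S(r) = exp [(r/2) (a†² - a²)]` exist, uniquely
    (∃! D : ℝ → AxbMode.Mode →L[ℂ] AxbMode.Mode, AxbMode.IsExponential AxbMode.dispGen D) ∧
    (∃! S : ℝ → AxbMode.Mode →L[ℂ] AxbMode.Mode, AxbMode.IsExponential AxbMode.sqGen S) ∧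
    -- the measure `e^{-r} dx dr` is a left Haar measure
    AxbMode.leftHaar.IsHaarMeasure ∧
    -- the self-adjoint operator `Y` extends `(a - a†) / (2i)`
    (IsSelfAdjoint (AxbMode.fnY id) ∧
      ∀ ψ : 𝓢(ℝ, ℂ),
        (ψ.toLp 2 MeasureTheory.volume, (AxbMode.quadY ψ).toLp 2 MeasureTheory.volume) ∈ (AxbMode.fnY id).graph) ∧
    ∀ D S : ℝ → AxbMode.Mode →L[ℂ] AxbMode.Mode,
      AxbMode.IsExponential AxbMode.dispGen D → AxbMode.IsExponential AxbMode.sqGen S →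
      AxbMode.IsUnitaryRep (AxbMode.rep D S) ∧
      -- `H = H_+ ⊕ H_-`, with inequivalent summands
      AxbMode.halfSpace (-1) = (AxbMode.halfSpace 1)ᗮ ∧
      ¬ AxbMode.AreEquivalent (AxbMode.rep D S) (AxbMode.halfSpace 1) (AxbMode.halfSpace (-1)) ∧
      -- `H_±` is irreducible and square-summable, with projection `θ(±Y)` and DMC operator `D_±`
      (∀ s : ℝ, s = 1 ∨ s = -1 →
        AxbMode.fnY (fun y => AxbMode.theta (s * y)) =
          ((AxbMode.halfSpace s).starProjection.toLinearMap).toPMap ⊤ ∧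
        AxbMode.IsIrrep (AxbMode.rep D S) (AxbMode.halfSpace s) ∧
        AxbMode.IsSquareSummable (AxbMode.rep D S) AxbMode.leftHaar (AxbMode.halfSpace s) ∧
        AxbMode.IsPosSqrt (AxbMode.sqrtDmc s) (AxbMode.dmc s) ∧
        AxbMode.IsDMC (AxbMode.rep D S) AxbMode.leftHaar (AxbMode.halfSpace s) (AxbMode.dmc s)) ∧
      -- the group average of a positive operator, as an identity in `[0, ∞]`
      (∀ A : AxbMode.Mode →L[ℂ] AxbMode.Mode, A.IsPositive →
        ∀ (ι : Type) (b : HilbertBasis ι ℂ AxbMode.Mode) (φ : AxbMode.Mode),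
          ∫⁻ g, ENNReal.ofReal (AxbMode.aveElem (AxbMode.rep D S) A φ φ g).re
              ∂AxbMode.leftHaar =
            ‖(AxbMode.halfSpace 1).starProjection φ‖ₑ ^ 2 *
                AxbMode.posTrace b (AxbMode.sqrtDmc 1) A +
              ‖(AxbMode.halfSpace (-1)).starProjection φ‖ₑ ^ 2 *
                AxbMode.posTrace b (AxbMode.sqrtDmc (-1)) A) ∧
      -- the group average of an operator of finite trace, in the weak operator sense
      (∀ A : AxbMode.Mode →L[ℂ] AxbMode.Mode,
        (∃ τ : ℂ, AxbMode.HasTrace AxbMode.sqrtDmcTotal A τ) →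
        ∃ τp τm : ℂ, AxbMode.HasTrace (AxbMode.sqrtDmc 1) A τp ∧
          AxbMode.HasTrace (AxbMode.sqrtDmc (-1)) A τm ∧
          ∀ φ φ' : AxbMode.Mode,
            MeasureTheory.Integrable (AxbMode.aveElem (AxbMode.rep D S) A φ φ')
              AxbMode.leftHaar ∧
            ∫ g, AxbMode.aveElem (AxbMode.rep D S) A φ φ' g ∂AxbMode.leftHaar =
              τp * ⟪φ, (AxbMode.halfSpace 1).starProjection φ'⟫_ℂ +
                τm * ⟪φ, (AxbMode.halfSpace (-1)).starProjection φ'⟫_ℂ) := by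
  refine ⟨⟨_, AxbMode.isExponential_displacement, fun D hD => AxbMode.displacement_eq hD⟩,
    ⟨_, AxbMode.isExponential_squeezing, fun S hS => AxbMode.squeezing_eq hS⟩,
    AxbMode.isHaarMeasure_leftHaar,
    ⟨AxbMode.isSelfAdjoint_fnY measurable_id, AxbMode.quadY_mem_graph⟩, ?_⟩
  intro D S hD hS
  rw [AxbMode.rep_eq_affRep hD hS]
  refine ⟨AxbMode.isUnitaryRep_affRep, AxbMode.halfSpace_neg one_ne_zero,
    AxbMode.not_areEquivalent,
    fun s hs => ⟨AxbMode.fnY_theta (AxbMode.ne_zero_of_sign hs), AxbMode.isIrrep_halfSpace hs,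
      AxbMode.isSquareSummable_halfSpace hs, AxbMode.isPosSqrt_sqrtDmc s, AxbMode.isDMC_dmc hs⟩,
    fun A hA ι b φ => AxbMode.lintegral_aveElem hA b φ, ?_⟩
  -- A single nuclear decomposition of `T` provides both traces, as `∑ ⟪P_s v_i, P_s u_i⟫`, and the
  -- integral formula.
  rintro A ⟨τ, T, ⟨u, v, hs, hT⟩, h, -⟩
  exact ⟨_, _, AxbMode.hasTrace_sqrtDmc one_ne_zero hs hT h,
    AxbMode.hasTrace_sqrtDmc (neg_ne_zero.mpr one_ne_zero) hs hT h,
    fun φ φ' => ⟨AxbMode.integrable_aveElem hs hT h φ φ', AxbMode.integral_aveElem hs hT h φ φ'⟩⟩
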